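/- Let $k$ be an algebraically closed field of characteristic $0$, and grade the free algebra $k\langle x,y\rangle$ by $\deg x=\deg y=1$. Definitions. An $n$-dimensional quantum polynomial algebra is a (left and right) noetherian connected graded $k$-algebra $S$ of global dimension $n$ with Hilbert series $(1-t)^{-n}$ and with $\underline{\mathrm{Ext}}^i_S(k,S)=0$ for $i\ne n$ and $\underline{\mathrm{Ext}}^n_S(k,S)\cong k(n)$. An element $r$ of a ring $R$ is regular if it is neither a left nor a right zero divisor, and normal if $Rr=rR$; a sequence $(r_1,\dots,r_m)$ in $R$ is regular normal if the image of $r_i$ in $R/(r_1,\dots,r_{i-1})$ is regular and normal for every $i$ (all ideals are two-sided). A sequence of elements of degree $2$ (not necessarily homogeneous) in a graded algebra $S$ is strongly regular normal if it and the sequence of the degree $2$ components of its entries are both regular normal. Let ${\cal A}$ be the set of linearly independent triples $(f,g,h)$ of elements of degree $2$ in $k\langle x,y\rangle$ such that $h$ is homogeneous, $S=k\langle x,y\rangle/(h)$ is a $2$-dimensional quantum polynomial algebra, and $(\bar f,\bar g)$ is a strongly regular normal sequence of degree $2$ in $S$. Let ${\cal B}\subset{\cal A}$ be the set of those triples for which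 moreover $S\cong k[x,y]$ as graded algebras. Two triples $F,F'$ in $k\langle x,y\rangle$ are st-equivalent, $F\sim_{st}F'$, if there are a graded algebra automorphism $\phi$ of $k\langle x,y\rangle$ and $(\alpha_{ij})\in \mathrm{GL}_3(k)$ with $F'_j=\sum_i\alpha_{ij}\phi(F_i)$ for all $j$. Theorem. Let $(f,g,h)\in{\cal A}$ and $E=k\langle x,y\rangle/(f,g,h)$. (1) $E$ is not commutative if and only if $(f,g,h)$ is st-equivalent to one of $$(x^2,y^2,xy-\lambda yx)\ (\lambda\in k,\ \lambda\ne 0,1),\quad (x^2,y^2+yx,xy+yx),\quad (x^2,y^2+1,xy+yx),\quad (x^2+1,y^2+1,xy+yx).$$ (2) $E$ is commutative if and only if $(f,g,h)\sim_{st}(f',g',xy-yx)$ for some $f',g'$ with $(f',g',xy-yx)\in{\cal B}$. (3) If $(f,g,h)$ is not st-equivalent to any element of ${\cal B}$, then it is st-equivalent to one of $$(x^2,y^2,xy-\lambda yx)\ (\lambda\in k,\ \lambda\ne 0,1),\quad (x^2,xy+y^2,xy+yx),\quad (x^2,y^2+1,xy+yx),\quad (x^2+1,y^2+1,xy+yx).$$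 -/

import Mathlib

universe u

namespace NAPC

noncomputable section

/-! ### Two-sided ideals, regular normal sequences -/

section Sequences

variable {R : Type u} [Ring R]

/-- The two-sided ideal generated by a set, as an `Ideal`, so that the quotient `R ⧸ idealOf s`
is again a ring. -/
def idealOf (s : Set R) : Ideal R := (TwoSidedIdeal.span s).asIdeal

instance (s : Set R) : (idealOf s).IsTwoSided := by unfold idealOf; infer_instance

/-- `f` is normal: `R f = f R`. -/
def IsNormalElement (f : R) : Prop :=
  Set.range (fun r : R => r * f) = Set.range (fun r : R => f * r)

/-- A sequence is regular and normal if the class of each entry is regular (left and right) and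
normal modulo the two-sided ideal generated by the preceding entries. -/
def IsRegularNormalSeq {m : ℕ} (F : Fin m → R) : Prop :=
  ∀ i : Fin m,
    IsRegular (Ideal.Quotient.mk (idealOf (F '' {j | j < i})) (F i)) ∧
    IsNormalElement (Ideal.Quotient.mk (idealOf (F '' {j | j < i})) (F i))

end Sequences

section Graded

variable {k : Type u} [Field k] {A : Type u} [Ring A] [Algebra k A]

/-- For a grading `𝒜`, the element `f` has degree (exactly) `d`, and its component of degree `d`
is `p`. -/
def HasLeadingForm (𝒜 : ℤ → Submodule k A) (d : ℤ) (f p : A) : Prop :=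
  p ∈ 𝒜 d ∧ p ≠ 0 ∧ f - p ∈ ⨆ i < d, 𝒜 i

/-- A strongly regular normal sequence of degree `d`: both the sequence and the sequence of its
leading forms are regular normal sequences. -/
def IsStronglyRegularNormalSeq (𝒜 : ℤ → Submodule k A) (d : ℤ) {m : ℕ} (F : Fin m → A) : Prop :=
  ∃ P : Fin m → A, (∀ i, HasLeadingForm 𝒜 d (F i) (P i)) ∧
    IsRegularNormalSeq F ∧ IsRegularNormalSeq P

/-! ### Relations `∼ₛ`, `∼ₜ`, `∼ₛₜ` -/

/-- `F ∼ₛ F'`: `F'` is obtained from `F` by an invertible matrix of scalars. -/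
def SEquiv {m : ℕ} (F F' : Fin m → A) : Prop :=
  ∃ α : GL (Fin m) k, ∀ j, F' j = ∑ i, (α : Matrix (Fin m) (Fin m) k) i j • F i

/-- `F ∼ₜ F'`: `F'` is the image of `F` under a graded algebra automorphism. -/
def TEquiv (𝒜 : ℤ → Submodule k A) {m : ℕ} (F F' : Fin m → A) : Prop :=
  ∃ φ : A ≃ₐ[k] A, (∀ i a, φ a ∈ 𝒜 i ↔ a ∈ 𝒜 i) ∧ ∀ j, F' j = φ (F j)

/-- `F ∼ₛₜ F'`: there is `F''` with `F ∼ₜ F'' ∼ₛ F'`. -/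
def STEquiv (𝒜 : ℤ → Submodule k A) {m : ℕ} (F F' : Fin m → A) : Prop :=
  ∃ F'' : Fin m → A, TEquiv 𝒜 F F'' ∧ SEquiv (k := k) F'' F'

/-! ### Graded Ext and quantum polynomial algebras -/

/-- A resolution of the trivial graded right module `A / A_{≥ 1}` by finitely generated graded free
right modules.  The `i`-th term is the module of columns `⨁ₐ A(-deg i a)`, the `i`-th differential
is left multiplication by the matrix `d i`, whose entries are homogeneous so that it preserves
degrees; the zeroth term is `A` itself, with the canonical projection to `A / A_{≥ 1}`. -/
structure GradedFreeResolution (𝒜 : ℤ → Submodule k A) where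
  rank : ℕ → ℕ
  deg : ∀ i, Fin (rank i) → ℤ
  d : ∀ i, Matrix (Fin (rank i)) (Fin (rank (i + 1))) A
  d_mem : ∀ i a b, d i a b ∈ 𝒜 (deg (i + 1) b - deg i a)
  rank_zero : rank 0 = 1
  deg_zero : ∀ a, deg 0 a = 0
  exact_zero : ∀ v : Fin (rank 0) → A,
    (∀ a, v a ∈ ⨆ i > 0, 𝒜 i) ↔ ∃ w, (d 0).mulVec w = v
  exact_succ : ∀ i (v : Fin (rank (i + 1)) → A),
    (d i).mulVec v = 0 ↔ ∃ w, (d (i + 1)).mulVec w = v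

namespace GradedFreeResolution

variable {𝒜 : ℤ → Submodule k A} (P : GradedFreeResolution 𝒜)

/-- Degree preserving homomorphisms from the `i`-th term to `A(j)`: a homomorphism is given by the
images of the basis vectors, i.e. by a row vector. -/
def cochains (i : ℕ) (j : ℤ) : Submodule k (Fin (P.rank i) → A) :=
  Submodule.pi Set.univ fun a => 𝒜 (P.deg i a + j)

/-- Composition with the differential, on row vectors. -/
def coboundary (i : ℕ) : (Fin (P.rank i) → A) →ₗ[k] (Fin (P.rank (i + 1)) → A) :=
  (Matrix.vecMulLinear (P.d i)).restrictScalars k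

def cocycles (i : ℕ) (j : ℤ) : Submodule k (Fin (P.rank i) → A) :=
  P.cochains i j ⊓ LinearMap.ker (P.coboundary i)

def coboundaries : ∀ (i : ℕ) (_ : ℤ), Submodule k (Fin (P.rank i) → A)
  | 0, _ => ⊥
  | i + 1, j => (P.cochains i j).map (P.coboundary i)

/-- The degree `j` part of the graded vector space `Extⁱ(k, A)`, that is,
`Extⁱ(k, A(j))` in the category of graded right modules. -/
abbrev ExtPiece (i : ℕ) (j : ℤ) : Type u :=
  P.cocycles i j ⧸ (P.coboundaries i j).submoduleOf (P.cocycles i j)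

end GradedFreeResolution

/-- The (right) global dimension of a ring. -/
def globalDimension (R : Type u) [Ring R] : WithBot ℕ∞ :=
  ⨆ M : ModuleCat.{u} Rᵐᵒᵖ, CategoryTheory.projectiveDimension M

/-- `A` with the grading `𝒜` is an `n`-dimensional quantum polynomial algebra. -/
structure IsQuantumPolynomialAlgebra (𝒜 : ℤ → Submodule k A) (n : ℕ) : Prop where
  gradedMonoid : SetLike.GradedMonoid 𝒜
  isInternal : DirectSum.IsInternal 𝒜
  nontrivial : Nontrivial A
  degree_zero : 𝒜 0 = 1
  degree_neg : ∀ i < 0, 𝒜 i = ⊥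
  locally_finite : ∀ i, Module.Finite k (𝒜 i)
  noetherian_left : IsNoetherianRing A
  noetherian_right : IsNoetherianRing Aᵐᵒᵖ
  gldim : globalDimension A = (n : ℕ∞)
  /-- `H_A(t) = (1 - t)⁻ⁿ`. -/
  hilbert : (PowerSeries.mk fun i : ℕ => (Module.finrank k (𝒜 i) : ℤ)) *
    (1 - PowerSeries.X) ^ n = 1
  /-- `Extⁱ(k, A) = 0` for `i ≠ n`, and `Extⁿ(k, A) ≅ k(n)`. -/
  gorenstein : ∃ P : GradedFreeResolution 𝒜, ∀ (i : ℕ) (j : ℤ),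
    (i = n ∧ j = -(n : ℤ) → Module.finrank k (P.ExtPiece i j) = 1) ∧
    (¬ (i = n ∧ j = -(n : ℤ)) → Subsingleton (P.ExtPiece i j))

end Graded

/-! ### The sets `𝒜_{n,m}^{∨,st}` and `ℬ_{n,m}^{∨,st}` -/

section Free

variable (k : Type u) [Field k]

/-- The standard grading of `k⟨x₁, …, xₙ⟩`, with all variables in degree `1`. -/
def freeGrading (n : ℕ) : ℤ → Submodule k (FreeAlgebra k (Fin n))
  | Int.ofNat d => Submodule.span k (Set.range (FreeAlgebra.ι k)) ^ d
  | Int.negSucc _ => ⊥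

variable {k}

/-- `k⟨x₁, …, xₙ⟩ / (H₁, …, H_l)`. -/
abbrev FreeQuot {n l : ℕ} (H : Fin l → FreeAlgebra k (Fin n)) : Type u :=
  FreeAlgebra k (Fin n) ⧸ idealOf (Set.range H)

/-- The quotient map. -/
abbrev toQuot {n l : ℕ} (H : Fin l → FreeAlgebra k (Fin n)) :
    FreeAlgebra k (Fin n) →ₐ[k] FreeQuot H :=
  Ideal.Quotient.mkₐ k (idealOf (Set.range H))

/-- The grading of the quotient induced by that of the free algebra (for homogeneous `H`). -/
def quotGrading {n l : ℕ} (H : Fin l → FreeAlgebra k (Fin n)) : ℤ → Submodule k (FreeQuot H) :=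
  fun i => (freeGrading k n i).map (toQuot H).toLinearMap

/-- `(F, H) ∈ 𝒜_{n,m}^{∨,st}`. -/
structure InAst {n m l : ℕ} (F : Fin m → FreeAlgebra k (Fin n))
    (H : Fin l → FreeAlgebra k (Fin n)) : Prop where
  degree : ∀ i, ∃ p, HasLeadingForm (freeGrading k n) 2 (F i) p
  homogeneous : ∀ i, H i ∈ freeGrading k n 2
  linearIndependent : LinearIndependent k (Fin.append F H)
  quantum : IsQuantumPolynomialAlgebra (quotGrading H) n
  stronglyRegularNormal : IsStronglyRegularNormalSeq (quotGrading H) 2 fun i => toQuot H (F i)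

/-- `(F, H) ∈ ℬ_{n,m}^{∨,st}`: moreover `k⟨x₁, …, xₙ⟩ / (H)` is isomorphic, as a graded algebra, to
the commutative polynomial algebra. -/
def InBst {n m l : ℕ} (F : Fin m → FreeAlgebra k (Fin n))
    (H : Fin l → FreeAlgebra k (Fin n)) : Prop :=
  InAst F H ∧ ∃ e : FreeQuot H ≃ₐ[k] MvPolynomial (Fin n) k,
    ∀ (i : ℕ) (s : FreeQuot H),
      s ∈ quotGrading H i ↔ e s ∈ MvPolynomial.homogeneousSubmodule (Fin n) k i

/-- `F ∼ₛₜ F'` in `k⟨x, y⟩`, for triples. -/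
abbrev FreeSTEquiv (F F' : Fin 3 → FreeAlgebra k (Fin 2)) : Prop :=
  STEquiv (freeGrading k 2) F F'

variable (k)

/-- The first variable of `k⟨x, y⟩`. -/
abbrev X : FreeAlgebra k (Fin 2) := FreeAlgebra.ι k 0

/-- The second variable of `k⟨x, y⟩`. -/
abbrev Y : FreeAlgebra k (Fin 2) := FreeAlgebra.ι k 1

end Free

end

end NAPC

namespace NAPC

noncomputable section

/-! ### The free algebra: graded components, coefficients, linear substitutions -/

section FreeAlgebraBasics

variable {k : Type u} [Field k]

theorem mem_idealOf {R : Type u} [Ring R] {s : Set R} {a : R} :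
    a ∈ idealOf s ↔ a ∈ TwoSidedIdeal.span s := TwoSidedIdeal.mem_asIdeal

theorem subset_idealOf {R : Type u} [Ring R] {s : Set R} {a : R} (ha : a ∈ s) : a ∈ idealOf s :=
  mem_idealOf.2 (TwoSidedIdeal.subset_span ha)

theorem idealOf_mul_right {R : Type u} [Ring R] {s : Set R} {a : R} (ha : a ∈ idealOf s) (b : R) :
    a * b ∈ idealOf s :=
  mem_idealOf.2 (TwoSidedIdeal.mul_mem_right _ _ _ (mem_idealOf.1 ha))

/-- An ideal closed under right multiplication contains `idealOf s` as soon as it contains `s`. -/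
theorem idealOf_le {R : Type u} [Ring R] {s : Set R} {J : Ideal R}
    (hJ : ∀ a ∈ J, ∀ b, a * b ∈ J) (hs : s ⊆ J) : idealOf s ≤ J := by
  intro a ha
  have key : TwoSidedIdeal.span s ≤ TwoSidedIdeal.mk' (J : Set R) J.zero_mem
      (fun h₁ h₂ => J.add_mem h₁ h₂) (fun h => J.neg_mem h) (fun h => J.mul_mem_left _ h)
      (fun h => hJ _ h _) :=
    TwoSidedIdeal.span_le.2 fun b hb => (TwoSidedIdeal.mem_mk' _ _ _ _ _ _ _).2 (hs hb)
  exact (TwoSidedIdeal.mem_mk' _ _ _ _ _ _ _).1 (key (mem_idealOf.1 ha))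

theorem idealOf_mono_of_subset {R : Type u} [Ring R] {s t : Set R} (h : s ⊆ idealOf t) :
    idealOf s ≤ idealOf t :=
  idealOf_le (fun _ ha b => idealOf_mul_right ha b) h

theorem map_mem_idealOf {R R' : Type u} [Ring R] [Ring R'] (φ : R →+* R') {s : Set R} {t : Set R'}
    (h : ∀ a ∈ s, φ a ∈ idealOf t) {a : R} (ha : a ∈ idealOf s) : φ a ∈ idealOf t := by
  have : idealOf s ≤ (idealOf t).comap φ :=
    idealOf_le (fun a ha b => by
      rw [Ideal.mem_comap, map_mul]; exact idealOf_mul_right ha _) h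
  exact this ha

theorem idealOf_empty {R : Type u} [Ring R] : idealOf (∅ : Set R) = ⊥ :=
  le_bot_iff.1 (idealOf_le (fun a ha b => by
    rw [Ideal.mem_bot] at ha ⊢; rw [ha, zero_mul]) (Set.empty_subset _))

theorem freeGrading_ofNat (n d : ℕ) : freeGrading k n (d : ℤ) =
    Submodule.span k (Set.range (FreeAlgebra.ι k)) ^ d := rfl

theorem freeGrading_zero (n : ℕ) : freeGrading k n 0 = 1 := by
  rw [← Int.ofNat_zero]; exact pow_zero _

theorem freeGrading_one (n : ℕ) :
    freeGrading k n 1 = Submodule.span k (Set.range (FreeAlgebra.ι k)) := by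
  rw [← Int.ofNat_one]; exact pow_one _

theorem freeGrading_two (n : ℕ) : freeGrading k n 2 = freeGrading k n 1 * freeGrading k n 1 := by
  rw [freeGrading_one, ← pow_two]; rfl

theorem freeGrading_neg (n : ℕ) {i : ℤ} (hi : i < 0) : freeGrading k n i = ⊥ := by
  match i, hi with
  | Int.negSucc _, _ => rfl

theorem mul_mem_freeGrading {n : ℕ} {i j : ℤ} {a b : FreeAlgebra k (Fin n)}
    (ha : a ∈ freeGrading k n i) (hb : b ∈ freeGrading k n j) :
    a * b ∈ freeGrading k n (i + j) := by
  rcases lt_or_ge i 0 with hi | hi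
  · rw [freeGrading_neg n hi, Submodule.mem_bot] at ha; simp [ha]
  rcases lt_or_ge j 0 with hj | hj
  · rw [freeGrading_neg n hj, Submodule.mem_bot] at hb; simp [hb]
  lift i to ℕ using hi
  lift j to ℕ using hj
  rw [← Nat.cast_add]
  rw [freeGrading_ofNat] at *
  rw [pow_add]
  exact Submodule.mul_mem_mul ha hb

/-- The algebra homomorphism recording degrees as powers of a central variable. -/
def degreeMap (n : ℕ) : FreeAlgebra k (Fin n) →ₐ[k] Polynomial (FreeAlgebra k (Fin n)) :=
  FreeAlgebra.lift k fun i => Polynomial.monomial 1 (FreeAlgebra.ι k i)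

/-- The homogeneous component of degree `d`. -/
def comp (n d : ℕ) : FreeAlgebra k (Fin n) →ₗ[k] FreeAlgebra k (Fin n) where
  toFun u := (degreeMap n u).coeff d
  map_add' u v := by simp
  map_smul' c u := by simp

theorem degreeMap_of_mem {n d : ℕ} {u : FreeAlgebra k (Fin n)}
    (hu : u ∈ freeGrading k n (d : ℤ)) : degreeMap n u = Polynomial.monomial d u := by
  rw [freeGrading_ofNat] at hu
  induction hu using Submodule.pow_induction_on_left' with
  | algebraMap r => 
    rw [AlgHom.commutes]; simp [Polynomial.algebraMap_apply]
  | add x y i hx hy ihx ihy => rw [map_add, ihx, ihy, ← map_add]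
  | mem_mul m hm i x hx ih =>
    have : degreeMap n m = Polynomial.monomial 1 m := by
      induction hm using Submodule.span_induction with
      | mem x hx => obtain ⟨j, rfl⟩ := hx; simp [degreeMap]
      | zero => simp
      | add x y _ _ hx hy => rw [map_add, hx, hy, ← map_add]
      | smul c x _ hx => rw [map_smul, hx, Polynomial.smul_monomial]
    rw [map_mul, ih, this, Polynomial.monomial_mul_monomial, add_comm]

theorem comp_of_mem {n d : ℕ} {u : FreeAlgebra k (Fin n)} (hu : u ∈ freeGrading k n (d : ℤ))
    (e : ℕ) : comp n e u = if d = e then u else 0 := by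
  change (degreeMap n u).coeff e = _
  rw [degreeMap_of_mem hu, Polynomial.coeff_monomial]

theorem comp_mul (n d : ℕ) (u v : FreeAlgebra k (Fin n)) :
    comp n d (u * v) = ∑ x ∈ Finset.HasAntidiagonal.antidiagonal d, comp n x.1 u * comp n x.2 v := by
  change (degreeMap n (u * v)).coeff d = _
  rw [map_mul, Polynomial.coeff_mul]; rfl

theorem comp_mem (n d : ℕ) (u : FreeAlgebra k (Fin n)) : comp n d u ∈ freeGrading k n (d : ℤ) := by
  induction u using FreeAlgebra.induction generalizing d with
  | grade0 r =>
    have h : algebraMap k (FreeAlgebra k (Fin n)) r ∈ freeGrading k n ((0 : ℕ) : ℤ) := by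
      rw [Nat.cast_zero, freeGrading_zero]; exact Submodule.algebraMap_mem r
    rw [comp_of_mem h]; split_ifs with h0
    · subst h0; exact h
    · exact zero_mem _
  | grade1 x =>
    have h : FreeAlgebra.ι k x ∈ freeGrading k n ((1 : ℕ) : ℤ) := by
      rw [Nat.cast_one, freeGrading_one]; exact Submodule.subset_span ⟨x, rfl⟩
    rw [comp_of_mem h]; split_ifs with h0
    · subst h0; exact h
    · exact zero_mem _
  | mul a b ha hb =>
    rw [comp_mul]
    refine Submodule.sum_mem _ fun x hx => ?_
    rw [← Finset.HasAntidiagonal.mem_antidiagonal.1 hx, Nat.cast_add]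
    exact mul_mem_freeGrading (ha _) (hb _)
  | add a b ha hb => rw [map_add]; exact add_mem (ha _) (hb _)

theorem comp_mul_zero (u v : FreeAlgebra k (Fin 2)) :
    comp 2 0 (u * v) = comp 2 0 u * comp 2 0 v := by
  simp [comp_mul]

theorem comp_mul_one (u v : FreeAlgebra k (Fin 2)) :
    comp 2 1 (u * v) = comp 2 0 u * comp 2 1 v + comp 2 1 u * comp 2 0 v := by
  simp [comp_mul, Finset.Nat.antidiagonal_succ]

theorem comp_mul_two (u v : FreeAlgebra k (Fin 2)) :
    comp 2 2 (u * v) = comp 2 0 u * comp 2 2 v + comp 2 1 u * comp 2 1 v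
      + comp 2 2 u * comp 2 0 v := by
  simp [comp_mul, Finset.Nat.antidiagonal_succ, add_assoc]

theorem comp_mul_three (u v : FreeAlgebra k (Fin 2)) :
    comp 2 3 (u * v) = comp 2 0 u * comp 2 3 v + comp 2 1 u * comp 2 2 v
      + comp 2 2 u * comp 2 1 v + comp 2 3 u * comp 2 0 v := by
  simp [comp_mul, Finset.Nat.antidiagonal_succ, add_assoc]

theorem mem_freeGrading_zero {n : ℕ} {u : FreeAlgebra k (Fin n)} :
    u ∈ freeGrading k n 0 ↔ ∃ c : k, u = c • 1 := by
  rw [freeGrading_zero, Submodule.mem_one]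
  simp [Algebra.algebraMap_eq_smul_one, eq_comm]

theorem mem_freeGrading_one {u : FreeAlgebra k (Fin 2)} :
    u ∈ freeGrading k 2 1 ↔ ∃ a b : k, u = a • X k + b • Y k := by
  have : Set.range (FreeAlgebra.ι k : Fin 2 → FreeAlgebra k (Fin 2)) = {X k, Y k} := by
    ext; simp [Fin.exists_fin_two, eq_comm]
  rw [freeGrading_one, this, Submodule.mem_span_pair]
  simp [eq_comm]

theorem X_mem : X k ∈ freeGrading k 2 1 := mem_freeGrading_one.2 ⟨1, 0, by simp⟩

theorem Y_mem : Y k ∈ freeGrading k 2 1 := mem_freeGrading_one.2 ⟨0, 1, by simp⟩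

theorem mem_freeGrading_two {u : FreeAlgebra k (Fin 2)} :
    u ∈ freeGrading k 2 2 ↔ ∃ a b c d : k,
      u = a • (X k * X k) + b • (X k * Y k) + c • (Y k * X k) + d • (Y k * Y k) := by
  constructor
  · intro hu
    rw [freeGrading_two] at hu
    induction hu using Submodule.mul_induction_on' with
    | mem_mul_mem m hm n hn =>
      obtain ⟨a, b, rfl⟩ := mem_freeGrading_one.1 hm
      obtain ⟨c, d, rfl⟩ := mem_freeGrading_one.1 hn
      refine ⟨a * c, a * d, b * c, b * d, ?_⟩
      simp only [mul_add, add_mul, smul_mul_assoc, mul_smul_comm, smul_smul, smul_add]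
      module
    | add x _ y _ hx hy =>
      obtain ⟨a, b, c, d, rfl⟩ := hx
      obtain ⟨a', b', c', d', rfl⟩ := hy
      exact ⟨a + a', b + b', c + c', d + d', by module⟩
  · rintro ⟨a, b, c, d, rfl⟩
    rw [freeGrading_two]
    have hX := X_mem (k := k)
    have hY := Y_mem (k := k)
    exact add_mem (add_mem (add_mem (Submodule.smul_mem _ _ (Submodule.mul_mem_mul hX hX))
      (Submodule.smul_mem _ _ (Submodule.mul_mem_mul hX hY)))
      (Submodule.smul_mem _ _ (Submodule.mul_mem_mul hY hX)))
      (Submodule.smul_mem _ _ (Submodule.mul_mem_mul hY hY))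

variable (k) in
/-- The elements of degree at most one. -/
def low : Submodule k (FreeAlgebra k (Fin 2)) := ⨆ i < (2 : ℤ), freeGrading k 2 i

theorem mem_low {u : FreeAlgebra k (Fin 2)} :
    u ∈ low k ↔ ∃ c a b : k, u = c • 1 + a • X k + b • Y k := by
  constructor
  · intro hu
    have hle : low k ≤ freeGrading k 2 0 ⊔ freeGrading k 2 1 := by
      refine iSup₂_le fun i hi => ?_
      rcases lt_or_ge i 0 with h | h
      · rw [freeGrading_neg 2 h]; exact bot_le
      · obtain rfl | rfl : i = 0 ∨ i = 1 := by lia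
        · exact le_sup_left
        · exact le_sup_right
    obtain ⟨v, hv, w, hw, rfl⟩ := Submodule.mem_sup.1 (hle hu)
    obtain ⟨c, rfl⟩ := mem_freeGrading_zero.1 hv
    obtain ⟨a, b, rfl⟩ := mem_freeGrading_one.1 hw
    exact ⟨c, a, b, by module⟩
  · rintro ⟨c, a, b, rfl⟩
    have h0 : freeGrading k 2 0 ≤ low k := le_iSup₂_of_le 0 (by norm_num) le_rfl
    have h1 : freeGrading k 2 1 ≤ low k := le_iSup₂_of_le 1 (by norm_num) le_rfl
    exact add_mem (add_mem (h0 (mem_freeGrading_zero.2 ⟨c, rfl⟩))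
      (Submodule.smul_mem _ _ (h1 X_mem))) (Submodule.smul_mem _ _ (h1 Y_mem))

/-- The coefficient of a word. -/
def wordCoeff (w : List (Fin 2)) : FreeAlgebra k (Fin 2) →ₗ[k] k where
  toFun u := (FreeAlgebra.equivMonoidAlgebraFreeMonoid u).coeff (FreeMonoid.ofList w)
  map_add' u v := by simp
  map_smul' c u := by simp

theorem wordCoeff_word (w v : List (Fin 2)) :
    wordCoeff (k := k) w (v.map (FreeAlgebra.ι k)).prod = if v = w then 1 else 0 := by
  have : FreeAlgebra.equivMonoidAlgebraFreeMonoid (v.map (FreeAlgebra.ι k)).prod =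
      MonoidAlgebra.single (FreeMonoid.ofList v) (1 : k) := by
    induction v with
    | nil => simp [MonoidAlgebra.one_def]
    | cons a v ih =>
      rw [List.map_cons, List.prod_cons, map_mul, ih]
      simp [FreeAlgebra.equivMonoidAlgebraFreeMonoid, MonoidAlgebra.single_mul_single,
        FreeMonoid.ofList_cons]
  change (FreeAlgebra.equivMonoidAlgebraFreeMonoid _).coeff _ = _
  rw [this]
  exact @Finsupp.single_apply _ _ _ _ _ _ (instDecidableEqList v w)

theorem wordCoeff_one (w : List (Fin 2)) : wordCoeff (k := k) w 1 = if [] = w then 1 else 0 :=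
  wordCoeff_word w []

theorem wordCoeff_ι (w : List (Fin 2)) (a : Fin 2) :
    wordCoeff w (FreeAlgebra.ι k a) = if [a] = w then 1 else 0 := by
  simpa using wordCoeff_word (k := k) w [a]

theorem wordCoeff_ι₂ (w : List (Fin 2)) (a b : Fin 2) :
    wordCoeff w (FreeAlgebra.ι k a * FreeAlgebra.ι k b) = if [a, b] = w then 1 else 0 := by
  simpa using wordCoeff_word (k := k) w [a, b]

theorem wordCoeff_ι₃ (w : List (Fin 2)) (a b c : Fin 2) :
    wordCoeff w (FreeAlgebra.ι k a * (FreeAlgebra.ι k b * FreeAlgebra.ι k c)) =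
      if [a, b, c] = w then 1 else 0 := by
  simpa using wordCoeff_word (k := k) w [a, b, c]

/-- Coefficients in degree at most two are determined by the element. -/
theorem coeffs_of_eq_zero {c a b m₁ m₂ m₃ m₄ : k}
    (h : c • (1 : FreeAlgebra k (Fin 2)) + a • X k + b • Y k + m₁ • (X k * X k) + m₂ • (X k * Y k)
      + m₃ • (Y k * X k) + m₄ • (Y k * Y k) = 0) :
    c = 0 ∧ a = 0 ∧ b = 0 ∧ m₁ = 0 ∧ m₂ = 0 ∧ m₃ = 0 ∧ m₄ = 0 := by
  have key := fun w => congrArg (wordCoeff w) h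
  simp only [map_add, map_smul, wordCoeff_one, wordCoeff_ι, wordCoeff_ι₂, map_zero] at key
  refine ⟨?_, ?_, ?_, ?_, ?_, ?_, ?_⟩
  · simpa using key []
  · simpa using key [0]
  · simpa using key [1]
  · simpa using key [0, 0]
  · simpa using key [0, 1]
  · simpa using key [1, 0]
  · simpa using key [1, 1]

/-- Coefficients in degree three are determined by the element. -/
theorem cubic_coeffs_of_eq_zero {m : Fin 8 → k}
    (h : m 0 • (X k * (X k * X k)) + m 1 • (X k * (X k * Y k)) + m 2 • (X k * (Y k * X k))
      + m 3 • (X k * (Y k * Y k)) + m 4 • (Y k * (X k * X k)) + m 5 • (Y k * (X k * Y k))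
      + m 6 • (Y k * (Y k * X k)) + m 7 • (Y k * (Y k * Y k)) = 0) : ∀ i, m i = 0 := by
  have key := fun w => congrArg (wordCoeff w) h
  simp only [map_add, map_smul, wordCoeff_ι₃, map_zero] at key
  intro i
  fin_cases i
  · simpa using key [0, 0, 0]
  · simpa using key [0, 0, 1]
  · simpa using key [0, 1, 0]
  · simpa using key [0, 1, 1]
  · simpa using key [1, 0, 0]
  · simpa using key [1, 0, 1]
  · simpa using key [1, 1, 0]
  · simpa using key [1, 1, 1]

/-- The cubic part of the ideal generated by the quadratic element `h`. -/
def InCubic (h u : FreeAlgebra k (Fin 2)) : Prop :=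
  ∃ l₁ ∈ freeGrading k 2 1, ∃ l₂ ∈ freeGrading k 2 1, u = l₁ * h + h * l₂

theorem components_of_mem_idealOf {h : FreeAlgebra k (Fin 2)} (hh : h ∈ freeGrading k 2 2)
    {u : FreeAlgebra k (Fin 2)} (hu : u ∈ idealOf (Set.range ![h])) :
    comp 2 0 u = 0 ∧ comp 2 1 u = 0 ∧ (∃ c : k, comp 2 2 u = c • h) ∧ InCubic h (comp 2 3 u) := by
  have hscal : ∀ v : FreeAlgebra k (Fin 2), ∃ c : k, comp 2 0 v = c • 1 := fun v =>
    mem_freeGrading_zero.1 (comp_mem 2 0 v)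
  -- The four conditions cut out a left ideal, closed also under right multiplication: since h has
  -- degree two, multiplying by v only involves the components of v of degree zero and one.
  let J : Ideal (FreeAlgebra k (Fin 2)) :=
    { carrier := {u | comp 2 0 u = 0 ∧ comp 2 1 u = 0 ∧ (∃ c : k, comp 2 2 u = c • h) ∧
        InCubic h (comp 2 3 u)}
      zero_mem' := ⟨map_zero _, map_zero _, ⟨0, by simp⟩, 0, zero_mem _, 0, zero_mem _, by simp⟩
      add_mem' := by
        rintro a b ⟨h0, h1, ⟨c, h2⟩, l₁, hl₁, l₂, hl₂, h3⟩
          ⟨h0', h1', ⟨c', h2'⟩, l₁', hl₁', l₂', hl₂', h3'⟩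
        refine ⟨by rw [map_add, h0, h0', add_zero], by rw [map_add, h1, h1', add_zero],
          ⟨c + c', by rw [map_add, h2, h2', add_smul]⟩, l₁ + l₁', add_mem hl₁ hl₁', l₂ + l₂',
          add_mem hl₂ hl₂', ?_⟩
        rw [map_add, h3, h3', add_mul, mul_add]; abel
      smul_mem' := by
        rintro v a ⟨h0, h1, ⟨c, h2⟩, l₁, hl₁, l₂, hl₂, h3⟩
        obtain ⟨d, hd⟩ := hscal v
        change comp 2 0 (v * a) = 0 ∧ comp 2 1 (v * a) = 0 ∧ (∃ c : k, comp 2 2 (v * a) = c • h) ∧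
          InCubic h (comp 2 3 (v * a))
        simp only [comp_mul_zero, comp_mul_one, comp_mul_two, comp_mul_three, h0, h1, h2, h3, hd,
          mul_zero, add_zero, zero_add, smul_mul_assoc, mul_smul_comm, one_mul, true_and]
        refine ⟨⟨d * c, by simp only [smul_smul, mul_comm]⟩, d • l₁ + c • comp 2 1 v, add_mem
          (Submodule.smul_mem _ _ hl₁) (Submodule.smul_mem _ _ (comp_mem 2 1 v)), d • l₂,
          Submodule.smul_mem _ _ hl₂, ?_⟩
        simp only [add_mul, smul_mul_assoc, mul_smul_comm, smul_add]
        abel }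
  have hJ : idealOf (Set.range ![h]) ≤ J := by
    refine idealOf_le ?_ ?_
    · rintro a ⟨h0, h1, ⟨c, h2⟩, l₁, hl₁, l₂, hl₂, h3⟩ v
      obtain ⟨d, hd⟩ := hscal v
      change comp 2 0 (a * v) = 0 ∧ comp 2 1 (a * v) = 0 ∧ (∃ c : k, comp 2 2 (a * v) = c • h) ∧
        InCubic h (comp 2 3 (a * v))
      simp only [comp_mul_zero, comp_mul_one, comp_mul_two, comp_mul_three, h0, h1, h2, h3, hd,
        zero_mul, smul_zero, add_zero, zero_add, smul_mul_assoc, mul_smul_comm, mul_one, true_and]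
      refine ⟨⟨d * c, by simp only [smul_smul, mul_comm]⟩, d • l₁, Submodule.smul_mem _ _ hl₁,
        d • l₂ + c • comp 2 1 v, add_mem (Submodule.smul_mem _ _ hl₂)
        (Submodule.smul_mem _ _ (comp_mem 2 1 v)), ?_⟩
      simp only [mul_add, smul_mul_assoc, mul_smul_comm, smul_add]
      abel
    · rintro _ ⟨i, rfl⟩
      have hh' : h ∈ freeGrading k 2 ((2 : ℕ) : ℤ) := hh
      fin_cases i
      change comp 2 0 h = 0 ∧ comp 2 1 h = 0 ∧ (∃ c : k, comp 2 2 h = c • h) ∧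
        InCubic h (comp 2 3 h)
      simp only [comp_of_mem hh']
      exact ⟨rfl, rfl, ⟨1, by simp⟩, 0, zero_mem _, 0, zero_mem _, by simp⟩
  exact hJ hu

theorem inCubic_of_mem_idealOf {h u : FreeAlgebra k (Fin 2)} (hh : h ∈ freeGrading k 2 2)
    (hu3 : u ∈ freeGrading k 2 3) (hu : u ∈ idealOf (Set.range ![h])) : InCubic h u := by
  have := (components_of_mem_idealOf hh hu).2.2.2
  have hu3' : u ∈ freeGrading k 2 ((3 : ℕ) : ℤ) := hu3
  rwa [comp_of_mem hu3', if_pos rfl] at this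

theorem mem_idealOf_of_inCubic {h u : FreeAlgebra k (Fin 2)} (hu : InCubic h u) :
    u ∈ idealOf (Set.range ![h]) := by
  obtain ⟨l₁, -, l₂, -, rfl⟩ := hu
  have hh : h ∈ idealOf (Set.range ![h]) := subset_idealOf ⟨0, rfl⟩
  exact add_mem (Ideal.mul_mem_left _ _ hh) (idealOf_mul_right hh _)

/-- The ideal (h) has no components in degrees zero and one, and only the line through h in degree
two; so the low part v must vanish. -/
theorem eq_smul_of_mem_idealOf {h u v : FreeAlgebra k (Fin 2)} (hh : h ∈ freeGrading k 2 2)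
    (hv : v ∈ low k) (hu2 : u ∈ freeGrading k 2 2) (hu : v + u ∈ idealOf (Set.range ![h])) :
    ∃ c : k, v + u = c • h := by
  obtain ⟨c, a, b, rfl⟩ := mem_low.1 hv
  obtain ⟨h0, h1, ⟨e, h2⟩, -⟩ := components_of_mem_idealOf hh hu
  have hu2' : u ∈ freeGrading k 2 ((2 : ℕ) : ℤ) := hu2
  have m0 : c • (1 : FreeAlgebra k (Fin 2)) ∈ freeGrading k 2 ((0 : ℕ) : ℤ) :=
    mem_freeGrading_zero.2 ⟨c, rfl⟩
  have m1 : a • X k + b • Y k ∈ freeGrading k 2 ((1 : ℕ) : ℤ) :=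
    mem_freeGrading_one.2 ⟨a, b, rfl⟩
  rw [add_assoc (c • (1 : FreeAlgebra k (Fin 2)))] at *
  generalize c • (1 : FreeAlgebra k (Fin 2)) = v₀ at *
  generalize a • X k + b • Y k = v₁ at *
  simp only [map_add, comp_of_mem hu2', comp_of_mem m0, comp_of_mem m1] at h0 h1 h2
  norm_num at h0 h1 h2
  exact ⟨e, by rw [h0, h1, h2]; simp⟩

end FreeAlgebraBasics

end

end NAPC

namespace NAPC

noncomputable section

/-! ### Linear substitutions and st-equivalence -/

section Substitutions

variable {k : Type u} [Field k]

/-- A degree preserving automorphism of `k⟨x, y⟩`. -/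
def IsGradedAut (φ : FreeAlgebra k (Fin 2) ≃ₐ[k] FreeAlgebra k (Fin 2)) : Prop :=
  ∀ i u, φ u ∈ freeGrading k 2 i ↔ u ∈ freeGrading k 2 i

theorem IsGradedAut.symm {φ : FreeAlgebra k (Fin 2) ≃ₐ[k] FreeAlgebra k (Fin 2)}
    (hφ : IsGradedAut φ) : IsGradedAut φ.symm := fun i u => by
  rw [← hφ i (φ.symm u), AlgEquiv.apply_symm_apply]

theorem IsGradedAut.trans {φ ψ : FreeAlgebra k (Fin 2) ≃ₐ[k] FreeAlgebra k (Fin 2)}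
    (hφ : IsGradedAut φ) (hψ : IsGradedAut ψ) : IsGradedAut (φ.trans ψ) := fun i u => by
  rw [AlgEquiv.trans_apply, hψ, hφ]

theorem IsGradedAut.map_low {φ : FreeAlgebra k (Fin 2) ≃ₐ[k] FreeAlgebra k (Fin 2)}
    (hφ : IsGradedAut φ) {u : FreeAlgebra k (Fin 2)} (hu : u ∈ low k) : φ u ∈ low k := by
  obtain ⟨c, a, b, rfl⟩ := mem_low.1 hu
  obtain ⟨a₁, b₁, h₁⟩ := mem_freeGrading_one.1 ((hφ 1 _).2 (X_mem (k := k)))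
  obtain ⟨a₂, b₂, h₂⟩ := mem_freeGrading_one.1 ((hφ 1 _).2 (Y_mem (k := k)))
  refine mem_low.2 ⟨c, a * a₁ + b * a₂, a * b₁ + b * b₂, ?_⟩
  simp only [map_add, map_smul, map_one, h₁, h₂]
  module

theorem map_mem_freeGrading (φ : FreeAlgebra k (Fin 2) →ₐ[k] FreeAlgebra k (Fin 2))
    (hX : φ (X k) ∈ freeGrading k 2 1) (hY : φ (Y k) ∈ freeGrading k 2 1) {i : ℤ}
    {u : FreeAlgebra k (Fin 2)} (hu : u ∈ freeGrading k 2 i) : φ u ∈ freeGrading k 2 i := by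
  rcases lt_or_ge i 0 with h | h
  · rw [freeGrading_neg 2 h, Submodule.mem_bot] at hu
    simp [hu]
  lift i to ℕ using h
  rw [freeGrading_ofNat] at hu ⊢
  have hle : Submodule.map φ.toLinearMap (Submodule.span k (Set.range (FreeAlgebra.ι k))) ≤
      Submodule.span k (Set.range (FreeAlgebra.ι k)) := by
    rw [Submodule.map_span_le]
    rintro _ ⟨j, rfl⟩
    rw [← freeGrading_one]
    fin_cases j
    · exact hX
    · exact hY
  have := Submodule.mem_map_of_mem (f := φ.toLinearMap) hu
  rw [Submodule.map_pow] at this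
  exact pow_le_pow_left' hle i this

theorem exists_linearSubstitution {a b c d : k} (hD : a * d - b * c ≠ 0) :
    ∃ φ : FreeAlgebra k (Fin 2) ≃ₐ[k] FreeAlgebra k (Fin 2), IsGradedAut φ ∧
      φ (X k) = a • X k + b • Y k ∧ φ (Y k) = c • X k + d • Y k := by
  set D := a * d - b * c with hDdef
  let f : FreeAlgebra k (Fin 2) →ₐ[k] FreeAlgebra k (Fin 2) :=
    FreeAlgebra.lift k ![a • X k + b • Y k, c • X k + d • Y k]
  let g : FreeAlgebra k (Fin 2) →ₐ[k] FreeAlgebra k (Fin 2) :=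
    FreeAlgebra.lift k ![(d / D) • X k + (-b / D) • Y k, (-c / D) • X k + (a / D) • Y k]
  have fX : f (X k) = a • X k + b • Y k := by simp [f]
  have fY : f (Y k) = c • X k + d • Y k := by simp [f]
  have gX : g (X k) = (d / D) • X k + (-b / D) • Y k := by simp [g]
  have gY : g (Y k) = (-c / D) • X k + (a / D) • Y k := by simp [g]
  have hfg : f.comp g = AlgHom.id k _ := by
    ext j
    fin_cases j
    · change f (g (X k)) = X k
      rw [gX, map_add, map_smul, map_smul, fX, fY]
      match_scalars <;> field_simp <;> rw [hDdef] <;> ring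
    · change f (g (Y k)) = Y k
      rw [gY, map_add, map_smul, map_smul, fX, fY]
      match_scalars <;> field_simp <;> rw [hDdef] <;> ring
  have hgf : g.comp f = AlgHom.id k _ := by
    ext j
    fin_cases j
    · change g (f (X k)) = X k
      rw [fX, map_add, map_smul, map_smul, gX, gY]
      match_scalars <;> field_simp <;> rw [hDdef] <;> ring
    · change g (f (Y k)) = Y k
      rw [fY, map_add, map_smul, map_smul, gX, gY]
      match_scalars <;> field_simp <;> rw [hDdef] <;> ring
  refine ⟨AlgEquiv.ofAlgHom f g hfg hgf, fun i u => ⟨fun hu => ?_, fun hu => ?_⟩, fX, fY⟩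
  · have := map_mem_freeGrading g (gX ▸ mem_freeGrading_one.2 ⟨_, _, rfl⟩)
      (gY ▸ mem_freeGrading_one.2 ⟨_, _, rfl⟩) hu
    change g (f u) ∈ _ at this
    rwa [← AlgHom.comp_apply, hgf] at this
  · exact map_mem_freeGrading f (fX ▸ mem_freeGrading_one.2 ⟨_, _, rfl⟩)
      (fY ▸ mem_freeGrading_one.2 ⟨_, _, rfl⟩) hu

/-- The commutator of the variables is a semi-invariant of the graded automorphisms. -/
theorem IsGradedAut.map_commutator {φ : FreeAlgebra k (Fin 2) ≃ₐ[k] FreeAlgebra k (Fin 2)}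
    (hφ : IsGradedAut φ) : ∃ D : k, D ≠ 0 ∧
      φ (X k * Y k - Y k * X k) = D • (X k * Y k - Y k * X k) := by
  obtain ⟨a₁, b₁, h₁⟩ := mem_freeGrading_one.1 ((hφ 1 _).2 (X_mem (k := k)))
  obtain ⟨a₂, b₂, h₂⟩ := mem_freeGrading_one.1 ((hφ 1 _).2 (Y_mem (k := k)))
  have key : φ (X k * Y k - Y k * X k) = (a₁ * b₂ - b₁ * a₂) • (X k * Y k - Y k * X k) := by
    rw [map_sub, map_mul, map_mul, h₁, h₂]
    simp only [mul_add, add_mul, smul_mul_assoc, mul_smul_comm, smul_smul, smul_add]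
    module
  refine ⟨_, fun h0 => ?_, key⟩
  -- The scalar is the determinant of the substitution; if it were zero, the injective map would
  -- kill the nonzero commutator.
  rw [h0, zero_smul, EmbeddingLike.map_eq_zero_iff] at key
  have := coeffs_of_eq_zero (k := k) (c := 0) (a := 0) (b := 0) (m₁ := 0) (m₂ := 1) (m₃ := -1)
    (m₄ := 0) (by rw [← key]; module)
  exact one_ne_zero this.2.2.2.2.1

/-- A kernel vector of the matrix expressing `F'` in terms of `F` would be a linear relation among
the entries of `F'`, so independence of `F'` alone makes that matrix invertible. -/
theorem sEquiv_of_mem_span {A : Type u} [Ring A] [Algebra k A] {m : ℕ} {F F' : Fin m → A}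
    (hF' : LinearIndependent k F') (h : ∀ j, F' j ∈ Submodule.span k (Set.range F)) :
    SEquiv (k := k) F F' := by
  choose c hc using fun j => (Submodule.mem_span_range_iff_exists_fun k).1 (h j)
  let α : Matrix (Fin m) (Fin m) k := Matrix.of fun i j => c j i
  have hα : α.det ≠ 0 := by
    intro h0
    obtain ⟨v, hv, hv0⟩ := Matrix.exists_mulVec_eq_zero_iff.2 h0
    refine hv (funext (Fintype.linearIndependent_iff.1 hF' v ?_))
    calc ∑ j, v j • F' j = ∑ j, ∑ i, (c j i * v j) • F i := by
          refine Finset.sum_congr rfl fun j _ => ?_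
          rw [← hc j, Finset.smul_sum]
          exact Finset.sum_congr rfl fun i _ => by rw [smul_smul, mul_comm]
      _ = ∑ i, (α.mulVec v) i • F i := by
          rw [Finset.sum_comm]
          refine Finset.sum_congr rfl fun i _ => ?_
          rw [Matrix.mulVec, dotProduct, Finset.sum_smul]
          rfl
      _ = 0 := by simp [hv0]
  exact ⟨Matrix.GeneralLinearGroup.mkOfDetNeZero α hα, fun j => (hc j).symm⟩

theorem stEquiv_of_mem_span {m : ℕ} {F F' : Fin m → FreeAlgebra k (Fin 2)}
    (hF' : LinearIndependent k F') {φ : FreeAlgebra k (Fin 2) ≃ₐ[k] FreeAlgebra k (Fin 2)}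
    (hφ : IsGradedAut φ) (h : ∀ j, φ (F' j) ∈ Submodule.span k (Set.range F)) :
    STEquiv (freeGrading k 2) F F' := by
  refine ⟨fun j => φ.symm (F j), ⟨φ.symm, hφ.symm, fun j => rfl⟩, sEquiv_of_mem_span hF' fun j => ?_⟩
  have := Submodule.mem_map_of_mem (f := φ.symm.toLinearMap) (h j)
  rw [Submodule.map_span, ← Set.range_comp] at this
  simpa [Function.comp_def] using this

theorem STEquiv.exists_map_span {m : ℕ} {F F' : Fin m → FreeAlgebra k (Fin 2)}
    (h : STEquiv (freeGrading k 2) F F') :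
    ∃ φ : FreeAlgebra k (Fin 2) ≃ₐ[k] FreeAlgebra k (Fin 2), IsGradedAut φ ∧
      Submodule.span k (Set.range F') = (Submodule.span k (Set.range F)).map φ.toLinearMap := by
  obtain ⟨F'', ⟨φ, hφ, h₁⟩, α, h₂⟩ := h
  refine ⟨φ, hφ, ?_⟩
  have hF'' : F'' = φ.toLinearMap ∘ F := funext h₁
  rw [Submodule.map_span, ← Set.range_comp, ← hF'']
  apply le_antisymm
  · rw [Submodule.span_le]
    rintro _ ⟨j, rfl⟩
    rw [h₂]
    exact Submodule.sum_mem _ fun i _ => Submodule.smul_mem _ _ (Submodule.subset_span ⟨i, rfl⟩)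
  · rw [Submodule.span_le]
    rintro _ ⟨j, rfl⟩
    have : F'' j = ∑ i, ((α⁻¹ : GL (Fin m) k) : Matrix (Fin m) (Fin m) k) i j • F' i := by
      calc F'' j = ∑ l, (1 : Matrix (Fin m) (Fin m) k) l j • F'' l := by
            simp [Matrix.one_apply]
        _ = ∑ l, ((α * α⁻¹ : GL (Fin m) k) : Matrix (Fin m) (Fin m) k) l j • F'' l := by simp
        _ = _ := by
            simp only [h₂, Finset.smul_sum, Units.val_mul, Matrix.mul_apply, Finset.sum_smul]
            rw [Finset.sum_comm]
            simp only [smul_smul, mul_comm]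
    rw [this]
    exact Submodule.sum_mem _ fun i _ => Submodule.smul_mem _ _ (Submodule.subset_span ⟨i, rfl⟩)

/-- St-equivalent families have spans corresponding under a graded automorphism, and such an
automorphism preserves the line through the commutator. -/
theorem commutator_mem_span_iff {m : ℕ} {F F' : Fin m → FreeAlgebra k (Fin 2)}
    (h : STEquiv (freeGrading k 2) F F') :
    X k * Y k - Y k * X k ∈ Submodule.span k (Set.range F) ↔
      X k * Y k - Y k * X k ∈ Submodule.span k (Set.range F') := by
  obtain ⟨φ, hφ, hs⟩ := h.exists_map_span
  obtain ⟨D, hD, hc⟩ := hφ.map_commutator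
  rw [hs, ← Submodule.smul_mem_iff (Submodule.map _ _) hD, ← hc]
  constructor
  · exact fun h => ⟨_, h, rfl⟩
  · rintro ⟨u, hu, hu'⟩
    rwa [← φ.injective hu']

end Substitutions

end

end NAPC

namespace NAPC

noncomputable section

/-! ### Consequences of strong regularity and normality -/

section RegularNormal

variable {R : Type u} [Ring R]

/-- Normality turns the left ideal generated by the element into a two-sided one. -/
theorem exists_mul_of_mem_idealOf {a : R} (ha : ∀ r, ∃ s, a * r = s * a) {u : R}
    (hu : u ∈ idealOf {a}) : ∃ s, u = s * a := by
  have hle : idealOf {a} ≤ Ideal.span {a} := by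
    refine idealOf_le (fun b hb r => ?_) (by simpa using Ideal.mem_span_singleton_self a)
    obtain ⟨t, rfl⟩ := Ideal.mem_span_singleton'.1 hb
    obtain ⟨s, hs⟩ := ha r
    rw [mul_assoc, hs, ← mul_assoc]
    exact Ideal.mem_span_singleton'.2 ⟨_, rfl⟩
  obtain ⟨s, hs⟩ := Ideal.mem_span_singleton'.1 (hle hu)
  exact ⟨s, hs.symm⟩

theorem mul_mem_idealOf_singleton (s a : R) : s * a ∈ idealOf {a} :=
  Ideal.mul_mem_left _ _ (subset_idealOf rfl)

theorem exists_mul_add_of_mem_idealOf {a b : R} (ha : ∀ r, ∃ s, a * r = s * a)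
    (hb : ∀ r, ∃ s, b * r - s * b ∈ idealOf {a}) {u : R}
    (hu : u ∈ idealOf {a, b}) : ∃ s t, u = s * a + t * b := by
  have hle : idealOf {a, b} ≤ Ideal.span {a, b} := by
    refine idealOf_le (fun c hc r => ?_) Ideal.subset_span
    obtain ⟨s, t, rfl⟩ := Ideal.mem_span_pair.1 hc
    obtain ⟨s', hs⟩ := ha r
    obtain ⟨t', ht⟩ := hb r
    obtain ⟨w, hw⟩ := exists_mul_of_mem_idealOf ha ht
    refine Ideal.mem_span_pair.2 ⟨s * s' + t * w, t * t', ?_⟩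
    rw [add_mul, add_mul, mul_assoc s a, hs, mul_assoc t b, eq_add_of_sub_eq hw, mul_add]
    noncomm_ring
  obtain ⟨s, t, h⟩ := Ideal.mem_span_pair.1 (hle hu)
  exact ⟨s, t, h.symm⟩

theorem IsRegularNormalSeq.first {F : Fin 2 → R} (hF : IsRegularNormalSeq F) :
    (∀ a, F 0 * a = 0 → a = 0) ∧ (∀ a, a * F 0 = 0 → a = 0) ∧
    (∀ r, ∃ s, r * F 0 = F 0 * s) ∧ (∀ r, ∃ s, F 0 * r = s * F 0) := by
  obtain ⟨hreg, hnorm⟩ := hF 0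
  have hbot : idealOf (F '' {j | j < 0}) = ⊥ := by
    rw [show {j : Fin 2 | j < 0} = ∅ by ext j; simp, Set.image_empty, idealOf_empty]
  have hz : ∀ a : R, Ideal.Quotient.mk (idealOf (F '' {j | j < 0})) a = 0 ↔ a = 0 := fun a => by
    rw [Ideal.Quotient.eq_zero_iff_mem, hbot, Ideal.mem_bot]
  have he : ∀ a b : R, Ideal.Quotient.mk (idealOf (F '' {j | j < 0})) a =
      Ideal.Quotient.mk (idealOf (F '' {j | j < 0})) b → a = b := fun a b h => by
    rwa [← sub_eq_zero, ← map_sub, hz, sub_eq_zero] at h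
  refine ⟨fun a h => ?_, fun a h => ?_, fun r => ?_, fun r => ?_⟩
  · rw [← hz, map_mul] at h
    exact (hz a).1 (hreg.left (by simpa using h))
  · rw [← hz, map_mul] at h
    exact (hz a).1 (hreg.right (by simpa using h))
  · have : Ideal.Quotient.mk (idealOf (F '' {j | j < 0})) r * Ideal.Quotient.mk _ (F 0) ∈
        Set.range (fun r => r * Ideal.Quotient.mk (idealOf (F '' {j | j < 0})) (F 0)) := ⟨_, rfl⟩
    rw [hnorm] at this
    obtain ⟨s, hs⟩ := this
    obtain ⟨s, rfl⟩ := Ideal.Quotient.mk_surjective s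
    exact ⟨s, he _ _ (by rw [map_mul, map_mul]; exact hs.symm)⟩
  · have : Ideal.Quotient.mk _ (F 0) * Ideal.Quotient.mk (idealOf (F '' {j | j < 0})) r ∈
        Set.range (fun r => Ideal.Quotient.mk (idealOf (F '' {j | j < 0})) (F 0) * r) := ⟨_, rfl⟩
    rw [← hnorm] at this
    obtain ⟨s, hs⟩ := this
    obtain ⟨s, rfl⟩ := Ideal.Quotient.mk_surjective s
    exact ⟨s, he _ _ (by rw [map_mul, map_mul]; exact hs.symm)⟩

theorem image_lt_one (F : Fin 2 → R) : F '' {j | j < 1} = {F 0} := by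
  rw [show {j : Fin 2 | j < 1} = {0} by ext j; fin_cases j <;> simp, Set.image_singleton]

theorem IsRegularNormalSeq.second {F : Fin 2 → R} (hF : IsRegularNormalSeq F) :
    (∀ b, b * F 1 ∈ idealOf {F 0} → b ∈ idealOf {F 0}) ∧
    (∀ r, ∃ s, F 1 * r - s * F 1 ∈ idealOf {F 0}) := by
  -- The quotient ring depends on the generating set, so the set is generalised before being
  -- replaced by `{F 0}`.
  have key : ∀ s : Set R, s = {F 0} → ∀ _ : (idealOf s).IsTwoSided,
      IsRegular (Ideal.Quotient.mk (idealOf s) (F 1)) ∧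
        IsNormalElement (Ideal.Quotient.mk (idealOf s) (F 1)) →
      IsRegular (Ideal.Quotient.mk (idealOf {F 0}) (F 1)) ∧
        IsNormalElement (Ideal.Quotient.mk (idealOf {F 0}) (F 1)) := by
    rintro s rfl _ h
    exact h
  obtain ⟨hreg, hnorm⟩ := key _ (image_lt_one F) _ (hF 1)
  refine ⟨fun b h => ?_, fun r => ?_⟩
  · rw [← Ideal.Quotient.eq_zero_iff_mem, map_mul] at h
    exact Ideal.Quotient.eq_zero_iff_mem.1 (hreg.right (by simpa using h))
  · have : Ideal.Quotient.mk _ (F 1) * Ideal.Quotient.mk (idealOf {F 0}) r ∈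
        Set.range (fun r => Ideal.Quotient.mk (idealOf {F 0}) (F 1) * r) := ⟨_, rfl⟩
    rw [← hnorm] at this
    obtain ⟨s, hs⟩ := this
    obtain ⟨s, rfl⟩ := Ideal.Quotient.mk_surjective s
    refine ⟨s, Ideal.Quotient.eq_zero_iff_mem.1 ?_⟩
    rw [map_sub, map_mul, map_mul, sub_eq_zero]
    exact hs.symm

end RegularNormal

/-! ### The degree filtration and the absence of extra low-degree relations -/

section Filtration

variable {k : Type u} [Field k] {S : Type u} [Ring S] [Algebra k S] (𝒮 : ℤ → Submodule k S)

/-- The filtration by degree. -/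
def degreeLE (n : ℤ) : Submodule k S := ⨆ i ≤ n, 𝒮 i

theorem le_degreeLE {i n : ℤ} (h : i ≤ n) : 𝒮 i ≤ degreeLE 𝒮 n := le_iSup₂_of_le i h le_rfl

theorem degreeLE_mono {m n : ℤ} (h : m ≤ n) : degreeLE 𝒮 m ≤ degreeLE 𝒮 n :=
  iSup₂_le fun _ hi => le_degreeLE 𝒮 (hi.trans h)

theorem iSup_lt_eq_degreeLE (n : ℤ) : ⨆ i < n + 1, 𝒮 i = degreeLE 𝒮 n := by
  unfold degreeLE
  simp only [Int.lt_add_one_iff]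

variable [GradedRing 𝒮]

theorem mul_mem_degreeLE {m n : ℤ} {a b : S} (ha : a ∈ degreeLE 𝒮 m) (hb : b ∈ degreeLE 𝒮 n) :
    a * b ∈ degreeLE 𝒮 (m + n) := by
  have : degreeLE 𝒮 m * degreeLE 𝒮 n ≤ degreeLE 𝒮 (m + n) := by
    simp only [degreeLE, Submodule.iSup_mul, Submodule.mul_iSup]
    refine iSup₂_le fun j hj => iSup₂_le fun i hi => ?_
    refine (Submodule.mul_le.2 fun x hx y hy => ?_).trans (le_degreeLE 𝒮 (add_le_add hi hj))
    exact SetLike.mul_mem_graded hx hy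
  exact this (Submodule.mul_mem_mul ha hb)

theorem decompose_eq_zero_of_mem_degreeLE {n i : ℤ} (hi : n < i) {a : S}
    (ha : a ∈ degreeLE 𝒮 n) : (DirectSum.decompose 𝒮 a i : S) = 0 := by
  have : degreeLE 𝒮 n ≤ LinearMap.ker ((𝒮 i).subtype ∘ₗ
      (DirectSum.component k ℤ (fun i => 𝒮 i) i) ∘ₗ
      (DirectSum.decomposeLinearEquiv 𝒮).toLinearMap) := by
    refine iSup₂_le fun j hj x hx => ?_
    exact DirectSum.decompose_of_mem_ne 𝒮 hx (by lia)
  exact this ha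

theorem mem_degreeLE_of_decompose {n : ℤ} {a : S}
    (ha : ∀ i, n < i → (DirectSum.decompose 𝒮 a i : S) = 0) : a ∈ degreeLE 𝒮 n := by
  classical
  rw [← DirectSum.sum_support_decompose 𝒮 a]
  refine Submodule.sum_mem _ fun i _ => ?_
  rcases le_or_gt i n with h | h
  · exact le_degreeLE 𝒮 h (SetLike.coe_mem _)
  · rw [ha i h]; exact zero_mem _

theorem exists_mem_degreeLE (m : ℤ) (a : S) : ∃ N : ℕ, a ∈ degreeLE 𝒮 (m + N) := by
  classical
  obtain ⟨B, hB⟩ := ((DirectSum.decompose 𝒮 a).support : Set ℤ).toFinite.bddAbove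
  refine ⟨(B - m).toNat, mem_degreeLE_of_decompose 𝒮 fun i hi => ?_⟩
  by_contra h
  have : i ≤ B := hB (by simpa using h)
  lia

theorem sub_decompose_mem {n : ℤ} {a : S} (ha : a ∈ degreeLE 𝒮 n) :
    a - DirectSum.decompose 𝒮 a n ∈ degreeLE 𝒮 (n - 1) := by
  refine mem_degreeLE_of_decompose 𝒮 fun i hi => ?_
  rw [DirectSum.decompose_sub, DirectSum.sub_apply, AddSubgroupClass.coe_sub]
  rcases eq_or_ne n i with rfl | h
  · rw [DirectSum.decompose_of_mem_same 𝒮 (SetLike.coe_mem _), sub_self]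
  · rw [decompose_eq_zero_of_mem_degreeLE 𝒮 (by lia) ha,
      DirectSum.decompose_of_mem_ne 𝒮 (SetLike.coe_mem _) h, sub_zero]

/-- The top component of a product `a f` where `f` has leading form `p` of degree two. -/
theorem decompose_mul_top {n : ℤ} {a f p : S} (ha : a ∈ degreeLE 𝒮 n) (hp : p ∈ 𝒮 2)
    (hf : f - p ∈ degreeLE 𝒮 1) :
    (DirectSum.decompose 𝒮 (a * f) (n + 2) : S) = DirectSum.decompose 𝒮 a n * p := by
  set t : S := ((DirectSum.decompose 𝒮 a n : 𝒮 n) : S)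
  have ht : t ∈ 𝒮 n := SetLike.coe_mem _
  have hf2 : f ∈ degreeLE 𝒮 2 := by
    rw [← sub_add_cancel f p]
    exact add_mem (degreeLE_mono 𝒮 (by norm_num) hf) (le_degreeLE 𝒮 le_rfl hp)
  have hrest : a * f - t * p ∈ degreeLE 𝒮 (n + 1) := by
    rw [show a * f - t * p = (a - t) * f + t * (f - p) by noncomm_ring]
    refine add_mem ?_ (mul_mem_degreeLE 𝒮 (le_degreeLE 𝒮 le_rfl ht) hf)
    have := mul_mem_degreeLE 𝒮 (sub_decompose_mem 𝒮 ha) hf2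
    rwa [show n - 1 + 2 = n + 1 by ring] at this
  have h := decompose_eq_zero_of_mem_degreeLE 𝒮 (show n + 1 < n + 2 by lia) hrest
  rw [DirectSum.decompose_sub, DirectSum.sub_apply, AddSubgroupClass.coe_sub,
    DirectSum.decompose_of_mem_same 𝒮 (SetLike.mul_mem_graded ht hp), sub_eq_zero] at h
  exact h

/-- The top part of a f is the top part of a times p, which is nonzero by regularity of p. A crude
bound on the degree of a can therefore be lowered one step at a time. -/
theorem mem_degreeLE_of_mul_mem {m : ℤ} {a f p : S} (hp : p ∈ 𝒮 2)
    (hf : f - p ∈ degreeLE 𝒮 1) (hreg : ∀ a, a * p = 0 → a = 0)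
    (h : a * f ∈ degreeLE 𝒮 (m + 2)) : a ∈ degreeLE 𝒮 m := by
  obtain ⟨N, hN⟩ := exists_mem_degreeLE 𝒮 m a
  induction N with
  | zero => simpa using hN
  | succ N ih =>
    refine ih ?_
    have h0 := decompose_mul_top 𝒮 hN hp hf
    rw [decompose_eq_zero_of_mem_degreeLE 𝒮 (by push_cast; lia) h] at h0
    have := sub_decompose_mem 𝒮 hN
    rw [hreg _ h0.symm, sub_zero] at this
    convert this using 2
    push_cast; ring

/-- For a strongly regular normal sequence of degree two, the only elements of degree at most two
in the left ideal generated by it are the scalar combinations. -/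
theorem exists_smul_add_smul {f g p q : S} (h0 : 𝒮 0 = 1) (hneg : ∀ i < 0, 𝒮 i = ⊥)
    (hp : p ∈ 𝒮 2) (hq : q ∈ 𝒮 2)
    (hf : f - p ∈ degreeLE 𝒮 1) (hg : g - q ∈ degreeLE 𝒮 1) (hreg : ∀ a, a * p = 0 → a = 0)
    (hreg' : ∀ b s, b * q = s * p → ∃ s', b = s' * p) (hfg : ∃ t, f * g = t * f) (n : ℕ) :
    ∀ a b : S, b ∈ degreeLE 𝒮 n → a * f + b * g ∈ degreeLE 𝒮 2 →
      ∃ α β : k, a * f + b * g = α • f + β • g := by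
  have hscal : ∀ a ∈ degreeLE 𝒮 0, ∃ c : k, a = c • 1 := by
    intro a ha
    have : degreeLE 𝒮 0 ≤ 1 := iSup₂_le fun i hi => by
      rcases hi.lt_or_eq with h | rfl
      · rw [hneg i h]; exact bot_le
      · rw [h0]
    obtain ⟨c, hc⟩ := Submodule.mem_one.1 (this ha)
    exact ⟨c, by rw [← hc, Algebra.algebraMap_eq_smul_one]⟩
  have hlead : ∀ {f p : S}, p ∈ 𝒮 2 → f - p ∈ degreeLE 𝒮 1 → f ∈ degreeLE 𝒮 2 := by
    intro f p hp hf
    rw [← sub_add_cancel f p]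
    exact add_mem (degreeLE_mono 𝒮 (by norm_num) hf) (le_degreeLE 𝒮 le_rfl hp)
  induction n with
  | zero =>
    -- Here b is a scalar, so a f has degree at most two and a is a scalar as well.
    intro a b hb hu
    obtain ⟨β, rfl⟩ := hscal b hb
    have haf : a * f ∈ degreeLE 𝒮 (0 + 2) := by
      have := sub_mem hu (Submodule.smul_mem _ β (hlead hq hg))
      simpa using this
    obtain ⟨α, rfl⟩ := hscal a (mem_degreeLE_of_mul_mem 𝒮 hp hf hreg haf)
    exact ⟨α, β, by simp⟩
  | succ n ih =>
    intro a b hb hu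
    push_cast at hb
    have hbg : b * g ∈ degreeLE 𝒮 ((n : ℤ) + 1 + 2) := mul_mem_degreeLE 𝒮 hb (hlead hq hg)
    have haf : a * f ∈ degreeLE 𝒮 ((n : ℤ) + 1 + 2) := by
      have := sub_mem (degreeLE_mono 𝒮 (show (2 : ℤ) ≤ (n : ℤ) + 1 + 2 by lia) hu) hbg
      rwa [add_sub_cancel_right] at this
    have ha := mem_degreeLE_of_mul_mem 𝒮 hp hf hreg haf
    have htop := decompose_eq_zero_of_mem_degreeLE 𝒮 (show (2 : ℤ) < (n : ℤ) + 1 + 2 by lia) hu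
    rw [DirectSum.decompose_add, DirectSum.add_apply, AddMemClass.coe_add,
      decompose_mul_top 𝒮 ha hp hf, decompose_mul_top 𝒮 hb hq hg] at htop
    -- The top parts of a f and b g cancel, so the top part of b is a left multiple of p modulo
    -- which q is regular. Only the component b' of the multiplier in degree n - 1 contributes.
    obtain ⟨s, hs⟩ := hreg' (DirectSum.decompose 𝒮 b (n + 1))
      (-DirectSum.decompose 𝒮 a (n + 1)) (by rw [neg_mul]; exact eq_neg_of_add_eq_zero_right htop)
    set b' : S := ((DirectSum.decompose 𝒮 s ((n : ℤ) - 1) : 𝒮 ((n : ℤ) - 1)) : S)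
    have hb' : (DirectSum.decompose 𝒮 b (n + 1) : S) = b' * p := by
      have h1 := DirectSum.coe_decompose_mul_add_of_right_mem 𝒮 (i := (n : ℤ) - 1) (a := s) hp
      rw [show (n : ℤ) - 1 + 2 = n + 1 by ring, ← hs,
        DirectSum.decompose_of_mem_same 𝒮 (SetLike.coe_mem _)] at h1
      exact h1
    obtain ⟨t, ht⟩ := hfg
    have hnew : b - b' * f ∈ degreeLE 𝒮 n := by
      rw [show b - b' * f = (b - DirectSum.decompose 𝒮 b (n + 1)) - b' * (f - p) by
        rw [hb']; noncomm_ring]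
      refine sub_mem ?_ ?_
      · have := sub_decompose_mem 𝒮 hb
        rwa [add_sub_cancel_right] at this
      · have := mul_mem_degreeLE 𝒮 (le_degreeLE 𝒮 (le_refl ((n : ℤ) - 1))
          (SetLike.coe_mem (DirectSum.decompose 𝒮 s ((n : ℤ) - 1)))) hf
        rwa [sub_add_cancel] at this
    -- Moving b' f g into the first summand, by normality of f, lowers the degree of b.
    have heq : a * f + b * g = (a + b' * t) * f + (b - b' * f) * g := by
      rw [add_mul, sub_mul, mul_assoc, ← ht, mul_assoc]; abel
    rw [heq]
    exact ih _ _ hnew (heq ▸ hu)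

end Filtration

end

end NAPC

namespace NAPC

noncomputable section

/-! ### Quadratic data of a triple -/

section Data

variable {k : Type u} [Field k]

/-- A space `W` of relations with leading forms `p`, `q`, `h` such that every element of degree at
most two of the ideal generated by `W` lies in `W`. -/
structure LeadingData (W : Submodule k (FreeAlgebra k (Fin 2))) (p q h : FreeAlgebra k (Fin 2)) :
    Prop where
  p_mem : p ∈ freeGrading k 2 2
  q_mem : q ∈ freeGrading k 2 2
  h_mem : h ∈ freeGrading k 2 2
  exists_p : ∃ f ∈ W, f - p ∈ low k
  exists_q : ∃ g ∈ W, g - q ∈ low k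
  h_mem_W : h ∈ W
  le_span : ∀ u ∈ W, ∃ α β γ : k, u - (α • p + β • q + γ • h) ∈ low k
  low_inter : ∀ u ∈ W, u ∈ low k → u = 0
  inter : ∀ u ∈ low k, ∀ w ∈ freeGrading k 2 2, u + w ∈ idealOf (W : Set (FreeAlgebra k (Fin 2))) →
    u + w ∈ W

/-- The linear algebra extracted from a triple `(f, g, h)` whose first two entries form a strongly
regular normal sequence modulo `h`: here `W` is the span of the triple, and `p`, `q`, `h` are the
leading forms. -/
structure QuadraticData (W : Submodule k (FreeAlgebra k (Fin 2))) (p q h : FreeAlgebra k (Fin 2)) :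
    Prop extends LeadingData W p q h where
  normal : ∀ v ∈ freeGrading k 2 1, ∃ l ∈ freeGrading k 2 1, InCubic h (v * p - p * l)
  reg_left : ∀ v ∈ freeGrading k 2 1, InCubic h (v * p) → v = 0
  reg_right : ∀ v ∈ freeGrading k 2 1, InCubic h (p * v) → v = 0
  reg_second : ∀ v ∈ freeGrading k 2 1, ∀ m ∈ freeGrading k 2 1, InCubic h (v * q - m * p) → v = 0

theorem idealOf_span {s : Set (FreeAlgebra k (Fin 2))} :
    idealOf (Submodule.span k s : Set (FreeAlgebra k (Fin 2))) = idealOf s := by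
  apply le_antisymm
  · refine idealOf_mono_of_subset ?_
    have : Submodule.span k s ≤ (idealOf s).restrictScalars k :=
      Submodule.span_le.2 fun a ha => subset_idealOf ha
    exact this
  · exact idealOf_mono_of_subset fun a ha => subset_idealOf (Submodule.subset_span ha)

theorem toQuot_eq_zero {h u : FreeAlgebra k (Fin 2)} :
    toQuot ![h] u = 0 ↔ u ∈ idealOf (Set.range ![h]) := Ideal.Quotient.eq_zero_iff_mem

theorem toQuot_mem_quotGrading {h u : FreeAlgebra k (Fin 2)} {i : ℤ}
    (hu : u ∈ freeGrading k 2 i) : toQuot ![h] u ∈ quotGrading ![h] i :=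
  Submodule.mem_map_of_mem (f := (toQuot ![h]).toLinearMap) hu

theorem toQuot_mem_of_mem_low {h u : FreeAlgebra k (Fin 2)} (hu : u ∈ low k) :
    toQuot ![h] u ∈ degreeLE (quotGrading ![h]) 1 := by
  have : low k ≤ (degreeLE (quotGrading ![h]) 1).comap (toQuot ![h]).toLinearMap :=
    iSup₂_le fun i hi v hv =>
      le_degreeLE (quotGrading ![h]) (by lia : i ≤ 1) (toQuot_mem_quotGrading hv)
  exact this hu

theorem fin_append_eq {A : Type u} (f g h : A) : Fin.append ![f, g] ![h] = ![f, g, h] := by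
  ext j
  fin_cases j <;> rfl

/-- All later arguments are linear algebra in degrees one to three of the free algebra. Strong
regularity in S is translated here: identities in degree three of S become membership in the cubic
part of (h), and the filtered statement becomes the `inter` field. -/
theorem InAst.exists_quadraticData {f g h : FreeAlgebra k (Fin 2)} (hA : InAst ![f, g] ![h]) :
    ∃ p q, QuadraticData (Submodule.span k (Set.range ![f, g, h])) p q h := by
  have hh : h ∈ freeGrading k 2 2 := hA.homogeneous 0
  obtain ⟨p, hp, -, hfp⟩ := hA.degree 0
  obtain ⟨q, hq, -, hgq⟩ := hA.degree 1
  change f - p ∈ low k at hfp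
  change g - q ∈ low k at hgq
  have hQ := hA.quantum
  letI := hQ.isInternal.chooseDecomposition
  haveI := hQ.gradedMonoid
  letI : GradedRing (quotGrading ![h]) := {}
  set π := toQuot ![h] with hπ
  have hπs : Function.Surjective π := Ideal.Quotient.mkₐ_surjective _ _
  have hpS := toQuot_mem_quotGrading (h := h) hp
  have hqS := toQuot_mem_quotGrading (h := h) hq
  have hfS : π f - π p ∈ degreeLE (quotGrading ![h]) 1 := by
    rw [← map_sub]; exact toQuot_mem_of_mem_low hfp
  have hgS : π g - π q ∈ degreeLE (quotGrading ![h]) 1 := by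
    rw [← map_sub]; exact toQuot_mem_of_mem_low hgq
  obtain ⟨P, hP, hF, hPn⟩ := hA.stronglyRegularNormal
  -- The leading forms in the definition are only given by existence; uniqueness identifies them
  -- with the images of p and q.
  have huniq : ∀ {f p P : FreeQuot ![h]}, p ∈ quotGrading ![h] 2 →
      f - p ∈ degreeLE (quotGrading ![h]) 1 →
      HasLeadingForm (quotGrading ![h]) 2 f P → P = p := by
    intro f p P hp hf hP
    have h1 : f - P ∈ degreeLE (quotGrading ![h]) 1 := by
      rw [← iSup_lt_eq_degreeLE]; exact hP.2.2
    have h2 := sub_mem hf h1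
    rw [sub_sub_sub_cancel_left] at h2
    have h3 := decompose_eq_zero_of_mem_degreeLE _ (show (1 : ℤ) < 2 by norm_num) h2
    rw [DirectSum.decompose_of_mem_same _ (sub_mem hP.1 hp)] at h3
    exact sub_eq_zero.1 h3
  have hP0 : P 0 = π p := huniq hpS hfS (hP 0)
  have hP1 : P 1 = π q := huniq hqS hgS (hP 1)
  obtain ⟨pl, pr, pn, pn'⟩ := hPn.first
  obtain ⟨qr, -⟩ := hPn.second
  rw [hP0] at pl pr pn pn' qr
  rw [hP1] at qr
  obtain ⟨-, -, fn, fn'⟩ := hF.first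
  obtain ⟨-, gn⟩ := hF.second
  change ∀ r, ∃ s, r * π f = π f * s at fn
  change ∀ r, ∃ s, π f * r = s * π f at fn'
  change ∀ r, ∃ s, π g * r - s * π g ∈ idealOf {π f} at gn
  have zero_of : ∀ v ∈ freeGrading k 2 1, π v = 0 → v = 0 := by
    intro v hv h0
    have := (components_of_mem_idealOf hh (toQuot_eq_zero.1 h0)).2.1
    rwa [comp_of_mem (d := 1) hv, if_pos rfl] at this
  have cubic_of : ∀ u ∈ freeGrading k 2 3, π u = 0 → InCubic h u := fun u hu h0 =>
    inCubic_of_mem_idealOf hh hu (toQuot_eq_zero.1 h0)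
  have of_cubic : ∀ u, InCubic h u → π u = 0 := fun u hu =>
    toQuot_eq_zero.2 (mem_idealOf_of_inCubic hu)
  have reg_left : ∀ v ∈ freeGrading k 2 1, InCubic h (v * p) → v = 0 := fun v hv hc =>
    zero_of v hv (pr _ (by rw [← map_mul]; exact of_cubic _ hc))
  have qr' : ∀ b s, b * π q = s * π p → ∃ s', b = s' * π p := fun b s hbs =>
    exists_mul_of_mem_idealOf pn' (qr b (hbs ▸ mul_mem_idealOf_singleton _ _))
  have reg_second : ∀ v ∈ freeGrading k 2 1, ∀ m ∈ freeGrading k 2 1,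
      InCubic h (v * q - m * p) → v = 0 := by
    intro v hv m _ hc
    have h0 := of_cubic _ hc
    rw [map_sub, map_mul, map_mul, sub_eq_zero] at h0
    obtain ⟨s, hs⟩ := qr' _ _ h0
    have h1 := DirectSum.coe_decompose_mul_add_of_right_mem (quotGrading ![h])
      (i := -1) (a := s) hpS
    rw [show (-1 : ℤ) + 2 = 1 by norm_num, ← hs,
      DirectSum.decompose_of_mem_same _ (toQuot_mem_quotGrading hv)] at h1
    -- A degree-one multiple of p, which has degree two, can only involve the degree -1 component of
    -- the multiplier, and that is zero.
    have h2 : (DirectSum.decompose (quotGrading ![h]) s (-1) : FreeQuot ![h]) = 0 := by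
      exact (Submodule.mem_bot k).1 ((hQ.degree_neg (-1) (by norm_num)).le
        (SetLike.coe_mem (DirectSum.decompose (quotGrading ![h]) s (-1))))
    rw [h2, zero_mul] at h1
    exact zero_of v hv h1
  have hX0 : X k ≠ 0 := fun h0 => by
    have := coeffs_of_eq_zero (k := k) (c := 0) (a := 1) (b := 0) (m₁ := 0) (m₂ := 0) (m₃ := 0)
      (m₄ := 0) (by rw [h0]; simp)
    exact one_ne_zero this.2.1
  have hcub : ∀ c : k, InCubic h (X k * c • h) := fun c =>
    ⟨c • X k, Submodule.smul_mem _ _ X_mem, 0, zero_mem _, by simp⟩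
  have hspan : ∀ u, u ∈ Submodule.span k (Set.range ![f, g, h]) ↔
      ∃ α β γ : k, u = α • f + β • g + γ • h := by
    intro u
    rw [Submodule.mem_span_range_iff_exists_fun]
    constructor
    · rintro ⟨c, rfl⟩
      exact ⟨c 0, c 1, c 2, by simp [Fin.sum_univ_three]⟩
    · rintro ⟨α, β, γ, rfl⟩
      exact ⟨![α, β, γ], by simp [Fin.sum_univ_three]⟩
  have hle : ∀ α β γ : k, α • f + β • g + γ • h - (α • p + β • q + γ • h) ∈ low k := by
    intro α β γ
    rw [show α • f + β • g + γ • h - (α • p + β • q + γ • h) = α • (f - p) + β • (g - q) by module]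
    exact add_mem (Submodule.smul_mem _ _ hfp) (Submodule.smul_mem _ _ hgq)
  refine ⟨p, q, ⟨hp, hq, hh, ⟨f, Submodule.subset_span ⟨0, rfl⟩, hfp⟩,
    ⟨g, Submodule.subset_span ⟨1, rfl⟩, hgq⟩, Submodule.subset_span ⟨2, rfl⟩, ?_, ?_, ?_⟩, ?_,
    reg_left, ?_, reg_second⟩
  · intro u hu
    obtain ⟨α, β, γ, rfl⟩ := (hspan u).1 hu
    exact ⟨α, β, γ, hle α β γ⟩
  · intro u hu hlow
    obtain ⟨α, β, γ, rfl⟩ := (hspan u).1 hu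
    have hzero : α • p + β • q + γ • h = 0 := by
      have h1 := sub_mem hlow (hle α β γ)
      rw [sub_sub_cancel] at h1
      obtain ⟨c, a, b, h2⟩ := mem_low.1 h1
      obtain ⟨m₁, m₂, m₃, m₄, h3⟩ := mem_freeGrading_two.1 (add_mem (add_mem
        (Submodule.smul_mem _ α hp) (Submodule.smul_mem _ β hq)) (Submodule.smul_mem _ γ hh))
      obtain ⟨rfl, rfl, rfl, -⟩ := coeffs_of_eq_zero (k := k) (c := c) (a := a) (b := b)
        (m₁ := -m₁) (m₂ := -m₂) (m₃ := -m₃) (m₄ := -m₄) (by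
          rw [← sub_eq_zero.2 (h2.symm.trans h3)]; module)
      simpa using h2
    -- Otherwise q would lie in the span of p and h, making X q a multiple of p modulo h and
    -- contradicting regularity of q modulo p.
    have hβ : β = 0 := by
      by_contra hβ
      refine hX0 (reg_second _ X_mem ((-(α / β)) • X k) (Submodule.smul_mem _ _ X_mem) ?_)
      have : q = (-(α / β)) • p + (-(γ / β)) • h := by
        have h2 : β • q = (-α) • p + (-γ) • h := by
          rw [← sub_eq_zero, ← hzero]; module
        rw [← inv_smul_smul₀ hβ q, h2]
        match_scalars <;> field_simp
      rw [show X k * q - (-(α / β)) • X k * p = X k * (-(γ / β)) • h by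
        rw [this, mul_add, smul_mul_assoc, mul_smul_comm, add_sub_cancel_left]]
      exact hcub _
    subst hβ
    have hα : α = 0 := by
      by_contra hα
      refine hX0 (reg_left _ X_mem ?_)
      have : p = (-(γ / α)) • h := by
        have h2 : α • p = (-γ) • h := by
          rw [← sub_eq_zero, ← hzero]; module
        rw [← inv_smul_smul₀ hα p, h2]
        match_scalars
        field_simp
      rw [this]
      exact hcub _
    subst hα
    simpa using hzero
  · intro u hu w hw hI
    rw [idealOf_span] at hI
    have hI' : π (u + w) ∈ idealOf {π f, π g} := by
      refine map_mem_idealOf π.toRingHom ?_ hI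
      rintro _ ⟨j, rfl⟩
      fin_cases j
      · exact subset_idealOf (Or.inl rfl)
      · exact subset_idealOf (Or.inr rfl)
      · have : π h = 0 := toQuot_eq_zero.2 (subset_idealOf ⟨0, rfl⟩)
        change π h ∈ _
        rw [this]; exact zero_mem _
    obtain ⟨a, b, hab⟩ := exists_mul_add_of_mem_idealOf fn' gn hI'
    have hdeg : a * π f + b * π g ∈ degreeLE (quotGrading ![h]) 2 := by
      rw [← hab, map_add]
      exact add_mem (degreeLE_mono _ (by norm_num) (toQuot_mem_of_mem_low hu))
        (le_degreeLE _ le_rfl (toQuot_mem_quotGrading hw))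
    obtain ⟨N, hN⟩ := exists_mem_degreeLE (quotGrading ![h]) 0 b
    rw [zero_add] at hN
    obtain ⟨α, β, hαβ⟩ := exists_smul_add_smul (quotGrading ![h]) hQ.degree_zero hQ.degree_neg
      hpS hqS hfS hgS pr qr' (fn' (π g)) N a b hN hdeg
    rw [← hab] at hαβ
    -- Subtracting α f + β g leaves an element of (h) of degree at most two, hence a multiple of h;
    -- the subtraction is split into its low and quadratic parts.
    have hu' : u - α • (f - p) - β • (g - q) ∈ low k :=
      sub_mem (sub_mem hu (Submodule.smul_mem _ _ hfp)) (Submodule.smul_mem _ _ hgq)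
    have hw' : w - α • p - β • q ∈ freeGrading k 2 2 :=
      sub_mem (sub_mem hw (Submodule.smul_mem _ _ hp)) (Submodule.smul_mem _ _ hq)
    obtain ⟨γ, hγ⟩ := eq_smul_of_mem_idealOf hh hu' hw' (by
      rw [← toQuot_eq_zero, show u - α • (f - p) - β • (g - q) + (w - α • p - β • q) =
        (u + w) - α • f - β • g by module]
      change π _ = 0
      rw [map_sub, map_sub, map_smul, map_smul, hαβ]; abel)
    refine (hspan _).2 ⟨α, β, γ, ?_⟩
    rw [← hγ]; module
  · intro v hv
    obtain ⟨r, hr⟩ := pn (π v)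
    -- Since v p is homogeneous of degree three, only the degree-one component of r matters.
    obtain ⟨l, hl, hl'⟩ := SetLike.coe_mem (DirectSum.decompose (quotGrading ![h]) r 1)
    change π l = _ at hl'
    refine ⟨l, hl, cubic_of _ (sub_mem (mul_mem_freeGrading hv hp) (mul_mem_freeGrading hp hl)) ?_⟩
    have h1 := DirectSum.coe_decompose_mul_add_of_left_mem (quotGrading ![h])
      (j := 1) (b := r) hpS
    rw [show (2 : ℤ) + 1 = 1 + 2 by norm_num, ← hr, DirectSum.decompose_of_mem_same _
      (SetLike.mul_mem_graded (toQuot_mem_quotGrading hv) hpS), ← hl'] at h1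
    rw [map_sub, map_mul, map_mul, sub_eq_zero]
    exact h1
  · exact fun v hv hc => zero_of v hv (pl _ (by rw [← map_mul]; exact of_cubic _ hc))

end Data

end

end NAPC

namespace NAPC

noncomputable section

/-! ### Invariance of the quadratic data under change of relations and variables -/

section Transport

variable {k : Type u} [Field k]

theorem InCubic.add {h u v : FreeAlgebra k (Fin 2)} (hu : InCubic h u) (hv : InCubic h v) :
    InCubic h (u + v) := by
  obtain ⟨l₁, h₁, l₂, h₂, rfl⟩ := hu
  obtain ⟨m₁, h₃, m₂, h₄, rfl⟩ := hv
  exact ⟨l₁ + m₁, add_mem h₁ h₃, l₂ + m₂, add_mem h₂ h₄, by noncomm_ring⟩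

theorem InCubic.smul {h u : FreeAlgebra k (Fin 2)} (c : k) (hu : InCubic h u) :
    InCubic h (c • u) := by
  obtain ⟨l₁, h₁, l₂, h₂, rfl⟩ := hu
  exact ⟨c • l₁, Submodule.smul_mem _ _ h₁, c • l₂, Submodule.smul_mem _ _ h₂, by simp⟩

theorem InCubic.mul_left {h l : FreeAlgebra k (Fin 2)} (hl : l ∈ freeGrading k 2 1) :
    InCubic h (l * h) := ⟨l, hl, 0, zero_mem _, by simp⟩

theorem InCubic.mul_right {h l : FreeAlgebra k (Fin 2)} (hl : l ∈ freeGrading k 2 1) :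
    InCubic h (h * l) := ⟨0, zero_mem _, l, hl, by simp⟩

theorem inCubic_smul_iff {h u : FreeAlgebra k (Fin 2)} {c : k} (hc : c ≠ 0) :
    InCubic (c • h) u ↔ InCubic h u := by
  constructor
  · rintro ⟨l₁, h₁, l₂, h₂, rfl⟩
    exact ⟨c • l₁, Submodule.smul_mem _ _ h₁, c • l₂, Submodule.smul_mem _ _ h₂, by simp⟩
  · rintro ⟨l₁, h₁, l₂, h₂, rfl⟩
    exact ⟨c⁻¹ • l₁, Submodule.smul_mem _ _ h₁, c⁻¹ • l₂, Submodule.smul_mem _ _ h₂, by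
      simp [smul_smul, hc]⟩

/-- These conditions involve p and q only through the span. `QuadraticData` has no such symmetry,
since q is regular only modulo p. -/
theorem LeadingData.swap {W : Submodule k (FreeAlgebra k (Fin 2))}
    {p q h : FreeAlgebra k (Fin 2)} (D : LeadingData W p q h) : LeadingData W q p h :=
  { D with
    p_mem := D.q_mem
    q_mem := D.p_mem
    exists_p := D.exists_q
    exists_q := D.exists_p
    le_span := fun u hu => by
      obtain ⟨α, β, γ, h⟩ := D.le_span u hu
      exact ⟨β, α, γ, by rwa [add_comm (β • q)]⟩ }

/-- Rescaling the leading forms and adding multiples of the others. -/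
theorem LeadingData.change {W : Submodule k (FreeAlgebra k (Fin 2))}
    {p q h : FreeAlgebra k (Fin 2)} (D : LeadingData W p q h) {a c e : k} (ha : a ≠ 0)
    (hc : c ≠ 0) (he : e ≠ 0) (r s t : k) :
    LeadingData W (a • p + t • h) (c • q + r • p + s • h) (e • h) := by
  obtain ⟨f, hf, hfp⟩ := D.exists_p
  obtain ⟨g, hg, hgq⟩ := D.exists_q
  refine ⟨add_mem (Submodule.smul_mem _ _ D.p_mem) (Submodule.smul_mem _ _ D.h_mem),
    add_mem (add_mem (Submodule.smul_mem _ _ D.q_mem) (Submodule.smul_mem _ _ D.p_mem)) (Submodule.smul_mem _ _ D.h_mem), Submodule.smul_mem _ _ D.h_mem,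
    ⟨a • f + t • h, add_mem (Submodule.smul_mem _ _ hf) (Submodule.smul_mem _ _ D.h_mem_W), ?_⟩,
    ⟨c • g + r • f + s • h, add_mem (add_mem (Submodule.smul_mem _ _ hg) (Submodule.smul_mem _ _ hf)) (Submodule.smul_mem _ _ D.h_mem_W), ?_⟩,
    Submodule.smul_mem _ _ D.h_mem_W, ?_, D.low_inter, D.inter⟩
  · rw [add_sub_add_right_eq_sub, ← smul_sub]
    exact Submodule.smul_mem _ _ hfp
  · rw [show c • g + r • f + s • h - (c • q + r • p + s • h) = c • (g - q) + r • (f - p) by module]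
    exact add_mem (Submodule.smul_mem _ _ hgq) (Submodule.smul_mem _ _ hfp)
  · intro u hu
    obtain ⟨α, β, γ, hαβ⟩ := D.le_span u hu
    -- The change of leading forms is triangular; these are the coefficients found by back
    -- substitution.
    refine ⟨(α - β / c * r) / a, β / c,
      (γ - β / c * s - (α - β / c * r) / a * t) / e, ?_⟩
    convert hαβ using 2
    match_scalars <;> field_simp <;> ring

/-- The admissible changes respect the flag: h up to a scalar, p modulo h, and q modulo p and h. -/
theorem QuadraticData.change {W : Submodule k (FreeAlgebra k (Fin 2))}
    {p q h : FreeAlgebra k (Fin 2)} (D : QuadraticData W p q h) {a c e : k} (ha : a ≠ 0)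
    (hc : c ≠ 0) (he : e ≠ 0) (r s t : k) :
    QuadraticData W (a • p + t • h) (c • q + r • p + s • h) (e • h) := by
  refine ⟨D.toLeadingData.change ha hc he r s t, ?_, ?_, ?_, ?_⟩
  · intro v hv
    obtain ⟨l, hl, hcub⟩ := D.normal v hv
    refine ⟨l, hl, (inCubic_smul_iff he).2 ?_⟩
    have := ((hcub.smul a).add ((InCubic.mul_left hv).smul t)).add
      ((InCubic.mul_right hl).smul (-t))
    convert this using 1
    simp only [mul_add, add_mul, smul_mul_assoc, mul_smul_comm]
    module
  · intro v hv hcub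
    rw [inCubic_smul_iff he] at hcub
    refine D.reg_left v hv ?_
    have := (hcub.add ((InCubic.mul_left hv).smul (-t))).smul a⁻¹
    convert this using 1
    simp only [mul_add, smul_mul_assoc, mul_smul_comm]
    match_scalars <;> field_simp <;> ring
  · intro v hv hcub
    rw [inCubic_smul_iff he] at hcub
    refine D.reg_right v hv ?_
    have := (hcub.add ((InCubic.mul_right hv).smul (-t))).smul a⁻¹
    convert this using 1
    simp only [add_mul, smul_mul_assoc, mul_smul_comm]
    match_scalars <;> field_simp <;> ring
  · intro v hv m hm hcub
    rw [inCubic_smul_iff he] at hcub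
    refine D.reg_second v hv ((a / c) • m - (r / c) • v) (sub_mem (Submodule.smul_mem _ _ hm) (Submodule.smul_mem _ _ hv)) ?_
    have := ((hcub.add ((InCubic.mul_left hv).smul (-s))).add ((InCubic.mul_left hm).smul t)).smul
      c⁻¹
    convert this using 1
    simp only [mul_add, sub_mul, smul_mul_assoc, mul_smul_comm]
    match_scalars <;> field_simp <;> ring

theorem IsGradedAut.inCubic {φ : FreeAlgebra k (Fin 2) ≃ₐ[k] FreeAlgebra k (Fin 2)}
    (hφ : IsGradedAut φ) {h u : FreeAlgebra k (Fin 2)} (hu : InCubic h u) :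
    InCubic (φ h) (φ u) := by
  obtain ⟨l₁, h₁, l₂, h₂, rfl⟩ := hu
  exact ⟨φ l₁, (hφ _ _).2 h₁, φ l₂, (hφ _ _).2 h₂, by simp⟩

theorem IsGradedAut.inCubic_iff {φ : FreeAlgebra k (Fin 2) ≃ₐ[k] FreeAlgebra k (Fin 2)}
    (hφ : IsGradedAut φ) {h u : FreeAlgebra k (Fin 2)} :
    InCubic (φ h) (φ u) ↔ InCubic h u :=
  ⟨fun H => by simpa using hφ.symm.inCubic H, hφ.inCubic⟩

theorem LeadingData.map {W : Submodule k (FreeAlgebra k (Fin 2))}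
    {p q h : FreeAlgebra k (Fin 2)} (D : LeadingData W p q h)
    {φ : FreeAlgebra k (Fin 2) ≃ₐ[k] FreeAlgebra k (Fin 2)} (hφ : IsGradedAut φ) :
    LeadingData (W.map φ.toLinearMap) (φ p) (φ q) (φ h) := by
  obtain ⟨f, hf, hfp⟩ := D.exists_p
  obtain ⟨g, hg, hgq⟩ := D.exists_q
  refine ⟨(hφ _ _).2 D.p_mem, (hφ _ _).2 D.q_mem, (hφ _ _).2 D.h_mem,
    ⟨φ f, ⟨f, hf, rfl⟩, ?_⟩, ⟨φ g, ⟨g, hg, rfl⟩, ?_⟩, ⟨h, D.h_mem_W, rfl⟩, ?_, ?_, ?_⟩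
  · rw [← map_sub]; exact hφ.map_low hfp
  · rw [← map_sub]; exact hφ.map_low hgq
  · rintro _ ⟨u, hu, rfl⟩
    obtain ⟨α, β, γ, h1⟩ := D.le_span u hu
    exact ⟨α, β, γ, by simpa using hφ.map_low h1⟩
  · rintro _ ⟨u, hu, rfl⟩ hlow
    have : u ∈ low k := by simpa using hφ.symm.map_low hlow
    rw [D.low_inter u hu this, map_zero]
  · intro u hu w hw hI
    have h1 : φ.symm (u + w) ∈ idealOf (W : Set (FreeAlgebra k (Fin 2))) := by
      refine map_mem_idealOf (φ.symm : FreeAlgebra k (Fin 2) →ₐ[k] FreeAlgebra k (Fin 2)).toRingHom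
        ?_ hI
      rintro _ ⟨u, hu, rfl⟩
      refine subset_idealOf ?_
      change φ.symm (φ u) ∈ W
      simpa using hu
    have h2 := D.inter (φ.symm u) (hφ.symm.map_low hu) (φ.symm w) ((hφ.symm _ _).2 hw)
      (by rwa [← map_add])
    exact ⟨_, h2, by simp⟩

theorem QuadraticData.map {W : Submodule k (FreeAlgebra k (Fin 2))}
    {p q h : FreeAlgebra k (Fin 2)} (D : QuadraticData W p q h)
    {φ : FreeAlgebra k (Fin 2) ≃ₐ[k] FreeAlgebra k (Fin 2)} (hφ : IsGradedAut φ) :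
    QuadraticData (W.map φ.toLinearMap) (φ p) (φ q) (φ h) := by
  refine ⟨D.toLeadingData.map hφ, ?_, ?_, ?_, ?_⟩
  · intro v hv
    obtain ⟨l, hl, hc⟩ := D.normal (φ.symm v) ((hφ.symm _ _).2 hv)
    exact ⟨φ l, (hφ _ _).2 hl, by simpa using hφ.inCubic hc⟩
  · intro v hv hc
    have := D.reg_left (φ.symm v) ((hφ.symm _ _).2 hv) (by rw [← hφ.inCubic_iff]; simpa using hc)
    simpa using this
  · intro v hv hc
    have := D.reg_right (φ.symm v) ((hφ.symm _ _).2 hv) (by rw [← hφ.inCubic_iff]; simpa using hc)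
    simpa using this
  · intro v hv m hm hc
    have := D.reg_second (φ.symm v) ((hφ.symm _ _).2 hv) (φ.symm m) ((hφ.symm _ _).2 hm)
      (by rw [← hφ.inCubic_iff]; simpa using hc)
    simpa using this

/-- The elements of degree one and the component `k m` of degree two are independent modulo the
ideal as soon as `m` is not in the span of the leading forms. -/
theorem LeadingData.independent {W : Submodule k (FreeAlgebra k (Fin 2))}
    {p q h : FreeAlgebra k (Fin 2)} (D : LeadingData W p q h) {x y m : FreeAlgebra k (Fin 2)}
    (hxy : ∀ a b : k, a • x + b • y = 0 → a = 0 ∧ b = 0)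
    (hx : x ∈ freeGrading k 2 1) (hy : y ∈ freeGrading k 2 1)
    (hm : m ∈ freeGrading k 2 2) (hmW : ∀ α β γ : k, α • p + β • q + γ • h ≠ m)
    {c a b d : k} (hI : c • 1 + a • x + b • y + d • m ∈
      idealOf (W : Set (FreeAlgebra k (Fin 2)))) : c = 0 ∧ a = 0 ∧ b = 0 ∧ d = 0 := by
  obtain ⟨a₁, b₁, hx'⟩ := mem_freeGrading_one.1 hx
  obtain ⟨a₂, b₂, hy'⟩ := mem_freeGrading_one.1 hy
  have hl : c • 1 + a • x + b • y ∈ low k :=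
    mem_low.2 ⟨c, a * a₁ + b * a₂, a * b₁ + b * b₂, by rw [hx', hy']; module⟩
  have hW := D.inter _ hl _ (Submodule.smul_mem _ d hm) hI
  obtain ⟨α, β, γ, h1⟩ := D.le_span _ hW
  -- If d ≠ 0, the leading part d m of an element of `W` would lie in the span of p, q, h.
  have hd : d = 0 := by
    by_contra hd
    have hz : d • m - (α • p + β • q + γ • h) = 0 := by
      have h2 := sub_mem h1 hl
      rw [show c • 1 + a • x + b • y + d • m - (α • p + β • q + γ • h) - (c • 1 + a • x + b • y) =
        d • m - (α • p + β • q + γ • h) by abel] at h2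
      have h3 := sub_mem (Submodule.smul_mem _ d hm) (add_mem (add_mem
        (Submodule.smul_mem _ α D.p_mem) (Submodule.smul_mem _ β D.q_mem))
        (Submodule.smul_mem _ γ D.h_mem))
      obtain ⟨c', a', b', h4⟩ := mem_low.1 h2
      obtain ⟨m₁, m₂, m₃, m₄, h5⟩ := mem_freeGrading_two.1 h3
      obtain ⟨rfl, rfl, rfl, -⟩ := coeffs_of_eq_zero (k := k) (c := c') (a := a') (b := b')
        (m₁ := -m₁) (m₂ := -m₂) (m₃ := -m₃) (m₄ := -m₄) (by
          rw [← sub_eq_zero.2 (h4.symm.trans h5)]; module)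
      simpa using h4
    refine hmW (α / d) (β / d) (γ / d) ?_
    rw [← inv_smul_smul₀ hd m, sub_eq_zero.1 hz]
    module
  subst hd
  rw [zero_smul, add_zero] at hW
  have h0 := D.low_inter _ hW hl
  rw [hx', hy'] at h0
  obtain ⟨hc, hA, hB, -⟩ := coeffs_of_eq_zero (k := k) (c := c) (a := a * a₁ + b * a₂)
    (b := a * b₁ + b * b₂) (m₁ := 0) (m₂ := 0) (m₃ := 0) (m₄ := 0) (by rw [← h0]; module)
  obtain ⟨ha, hb⟩ := hxy a b (by
    rw [hx', hy', show a • (a₁ • X k + b₁ • Y k) + b • (a₂ • X k + b₂ • Y k) =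
      (a * a₁ + b * a₂) • X k + (a * b₁ + b * b₂) • Y k by module, hA, hB]; simp)
  exact ⟨hc, ha, hb, rfl⟩

end Transport

end

end NAPC

namespace NAPC

noncomputable section

/-! ### Consequences of associativity for filtered relations -/

section Relations

variable {k : Type u} [Field k] {E : Type u} [Ring E] [Algebra k E]

/-- The word y y y gives a² = 0. The words x y y and y y x then give b c = 0 and b² + 2c = 0. -/
theorem relations_jordan [CharZero k] {x y : E} {a b c : k}
    (hind : ∀ c a b d : k, c • 1 + a • x + b • y + d • (y * x) = 0 → c = 0 ∧ a = 0 ∧ b = 0 ∧ d = 0)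
    (hy : y * y = a • x + b • y + c • 1) (hxy : x * y = y * x + y * y) : a = 0 ∧ b = 0 ∧ c = 0 := by
  have e₁ : y * (y * y) = (y * y) * y := (mul_assoc _ _ _).symm
  rw [hy] at e₁ hxy
  simp only [mul_add, add_mul, mul_smul_comm, smul_mul_assoc, mul_one, one_mul, hxy] at e₁
  obtain ⟨-, h1, -⟩ := hind (-a * c) (-a * a) (-a * b) 0 (by
    linear_combination (norm := module) e₁)
  have ha : a = 0 := by simpa using h1
  subst ha
  have e₂ : x * (y * y) = (x * y) * y := (mul_assoc _ _ _).symm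
  rw [hxy, add_mul, mul_assoc y x y, hxy, hy] at e₂
  simp only [mul_add, add_mul, mul_smul_comm, smul_mul_assoc, mul_one, one_mul, hxy] at e₂
  have e₃ : y * (y * x) = (y * y) * x := (mul_assoc _ _ _).symm
  rw [hy] at e₃
  simp only [mul_add, add_mul, mul_smul_comm, smul_mul_assoc, mul_one, one_mul] at e₃
  rw [e₃, hy] at e₂
  obtain ⟨h2, -, h3, -⟩ := hind (b * c) 0 (b * b + 2 * c) 0 (by
    linear_combination (norm := module) -e₂)
  have hb : b = 0 := by
    by_contra hb
    have hc : c = 0 := by simpa [hb] using h2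
    rw [hc] at h3
    exact hb (by simpa using h3)
  subst hb
  exact ⟨rfl, rfl, by simpa using h3⟩

/-- Since yx is a multiple of xy, the products x·yx and xy·x agree only up to the factor l⁻¹ ≠ 1,
which kills a and c; the word y x y kills b. The independence required is that of x² and of y²,
because both mixed monomials reduce to lower degree. -/
theorem relations_node {x y : E} {l a b c : k} (hl : l ≠ 0) (hl1 : l ≠ 1)
    (hx : ∀ c a b d : k, c • 1 + a • x + b • y + d • (x * x) = 0 → c = 0 ∧ a = 0 ∧ b = 0 ∧ d = 0)
    (hy : ∀ c a b d : k, c • 1 + a • x + b • y + d • (y * y) = 0 → c = 0 ∧ a = 0 ∧ b = 0 ∧ d = 0)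
    (h₁ : x * y = a • x + b • y + c • 1) (hxy : x * y = l • (y * x)) :
    a = 0 ∧ b = 0 ∧ c = 0 := by
  have h₂ : y * x = l⁻¹ • (a • x + b • y + c • 1) := by rw [← h₁, hxy, inv_smul_smul₀ hl]
  have hl' : l - 1 ≠ 0 := sub_ne_zero.2 hl1
  have e₁ : x * (y * x) = (x * y) * x := (mul_assoc _ _ _).symm
  rw [h₂, h₁] at e₁
  simp only [mul_add, add_mul, mul_smul_comm, smul_mul_assoc, mul_one, one_mul, h₁, h₂] at e₁
  obtain ⟨-, h3, -, h4⟩ := hx 0 ((l - 1) * c) 0 ((l - 1) * a) (by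
    linear_combination (norm := (match_scalars <;> field_simp <;> ring)) (-l) • e₁)
  have ha : a = 0 := by simpa [hl'] using h4
  have hc : c = 0 := by simpa [hl'] using h3
  subst ha hc
  have e₂ : y * (x * y) = (y * x) * y := (mul_assoc _ _ _).symm
  rw [h₂, h₁] at e₂
  simp only [mul_add, add_mul, mul_smul_comm, smul_mul_assoc, mul_one, one_mul, h₁, h₂] at e₂
  obtain ⟨-, -, -, h5⟩ := hy 0 0 0 ((l - 1) * b) (by
    linear_combination (norm := (match_scalars <;> field_simp <;> ring)) l • e₂)
  exact ⟨rfl, by simpa [hl'] using h5, rfl⟩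

variable {x y : E}
  (hind : ∀ c a b d : k, c • 1 + a • x + b • y + d • (y * x) = 0 → c = 0 ∧ a = 0 ∧ b = 0 ∧ d = 0)

include hind

/-- From xy = l yx one gets x²y = l² yx² and xy² = l² y²x, whereas constants commute with
everything. So l² ≠ 1 kills the constant terms, and l ≠ 0, 1 kills the linear ones. -/
theorem relations_quantum {l β a₁ b₁ c₁ a₂ b₂ c₂ : k} (hl : l ≠ 0) (hl1 : l ^ 2 ≠ 1)
    (hx : x * x = a₁ • x + b₁ • y + c₁ • 1)
    (hy : y * y = (-β) • (x * y) + a₂ • x + b₂ • y + c₂ • 1) (hxy : x * y = l • (y * x)) :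
    (a₁ = 0 ∧ b₁ = 0 ∧ c₁ = 0) ∧ a₂ = 0 ∧ b₂ = 0 ∧ c₂ = 0 := by
  have hl' : l ^ 2 - 1 ≠ 0 := sub_ne_zero.2 hl1
  have hl2 : l - 1 ≠ 0 := fun h => hl' (by rw [sub_eq_zero.1 h]; ring)
  have e₁ : x * (x * x) = (x * x) * x := (mul_assoc _ _ _).symm
  rw [hx] at e₁
  simp only [mul_add, add_mul, mul_smul_comm, smul_mul_assoc, mul_one, one_mul, hxy] at e₁
  obtain ⟨-, -, -, h1⟩ := hind 0 0 0 ((l - 1) * b₁) (by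
    linear_combination (norm := module) e₁)
  have hb₁ : b₁ = 0 := by simpa [hl2] using h1
  subst hb₁
  have e₂ : (x * x) * y = l ^ 2 • (y * (x * x)) := by
    rw [mul_assoc, hxy, mul_smul_comm, ← mul_assoc, hxy, smul_mul_assoc, smul_smul, mul_assoc,
      pow_two]
  rw [hx] at e₂
  simp only [mul_add, add_mul, mul_smul_comm, smul_mul_assoc, mul_one, one_mul, hxy] at e₂
  obtain ⟨-, -, h2, h3⟩ := hind 0 0 ((l ^ 2 - 1) * c₁) (l * (l - 1) * a₁) (by
    linear_combination (norm := module) -e₂)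
  have hc₁ : c₁ = 0 := by simpa [hl'] using h2
  have ha₁ : a₁ = 0 := by simpa [hl, hl2] using h3
  subst hc₁ ha₁
  have hx0 : x * x = 0 := by simpa using hx
  have hxyx : x * (y * x) = 0 := by
    rw [← mul_assoc, hxy, smul_mul_assoc, mul_assoc, hx0, mul_zero, smul_zero]
  have e₃ : x * (y * y) = l ^ 2 • (y * y * x) := by
    rw [← mul_assoc, hxy, smul_mul_assoc, mul_assoc, hxy, mul_smul_comm, smul_smul, mul_assoc,
      pow_two]
  rw [hy] at e₃
  simp only [mul_add, add_mul, mul_smul_comm, smul_mul_assoc, mul_one, one_mul, hxy, hx0,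
    mul_assoc, hxyx, mul_zero, smul_zero] at e₃
  obtain ⟨-, h4, -, h5⟩ := hind 0 ((l ^ 2 - 1) * c₂) 0 (l * (l - 1) * b₂) (by
    linear_combination (norm := module) -e₃)
  have hc₂ : c₂ = 0 := by simpa [hl'] using h4
  have hb₂ : b₂ = 0 := by simpa [hl, hl2] using h5
  subst hc₂ hb₂
  have hxyy : x * (y * y) = 0 := by
    rw [hy]
    simp [mul_add, hxy, hxyx, hx0]
  have hyyx : y * (y * x) = 0 := by
    have : (l * l) • (y * (y * x)) = 0 := by
      rw [← smul_smul, ← mul_smul_comm, ← hxy, ← mul_assoc y x y, ← smul_mul_assoc, ← hxy,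
        mul_assoc, hxyy]
    simpa [hl] using this
  have e₄ : y * (y * y) = (y * y) * y := (mul_assoc _ _ _).symm
  rw [hy] at e₄
  simp only [mul_add, add_mul, mul_smul_comm, smul_mul_assoc, mul_one, one_mul, mul_assoc, hxyy,
    hxy, hyyx, smul_zero] at e₄
  obtain ⟨-, -, -, h6⟩ := hind 0 0 0 ((l - 1) * a₂) (by
    linear_combination (norm := module) -e₄)
  exact ⟨⟨rfl, rfl, rfl⟩, by simpa [hl2] using h6, rfl, rfl⟩

/-- For l = -1 the squares commute with both variables, so associativity puts no condition on the
constants. The linear coefficients appear doubled in front of yx and vanish. -/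
theorem relations_clifford [CharZero k] {a₁ b₁ c₁ a₂ b₂ c₂ : k}
    (hx : x * x = a₁ • x + b₁ • y + c₁ • 1) (hy : y * y = a₂ • x + b₂ • y + c₂ • 1)
    (hxy : x * y = -(y * x)) : (a₁ = 0 ∧ b₁ = 0) ∧ a₂ = 0 ∧ b₂ = 0 := by
  have e₁ : x * (x * x) = (x * x) * x := (mul_assoc _ _ _).symm
  have e₂ : (x * x) * y = y * (x * x) := by
    rw [mul_assoc, hxy, mul_neg, ← mul_assoc, hxy, neg_mul, neg_neg, mul_assoc]
  have e₃ : y * (y * y) = (y * y) * y := (mul_assoc _ _ _).symm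
  have e₄ : x * (y * y) = y * y * x := by
    rw [← mul_assoc, hxy, neg_mul, mul_assoc, hxy, mul_neg, neg_neg, mul_assoc]
  rw [hx] at e₁ e₂
  rw [hy] at e₃ e₄
  simp only [mul_add, add_mul, mul_smul_comm, smul_mul_assoc, mul_one, one_mul, hxy] at e₁ e₂ e₃ e₄
  obtain ⟨-, -, -, h1⟩ := hind 0 0 0 (2 * b₁) (by linear_combination (norm := module) -e₁)
  obtain ⟨-, -, -, h2⟩ := hind 0 0 0 (2 * a₁) (by linear_combination (norm := module) -e₂)
  obtain ⟨-, -, -, h3⟩ := hind 0 0 0 (2 * a₂) (by linear_combination (norm := module) e₃)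
  obtain ⟨-, -, -, h4⟩ := hind 0 0 0 (2 * b₂) (by linear_combination (norm := module) -e₄)
  exact ⟨⟨by simpa using h2, by simpa using h1⟩, by simpa using h3, by simpa using h4⟩

/-- Squares still commute with the variables, but y² now contains a nonzero multiple of xy, which
only anticommutes with them up to lower terms. This forces the constants to vanish too. -/
theorem relations_skew [CharZero k] {β a₁ b₁ c₁ a₂ b₂ c₂ : k} (hβ : β ≠ 0)
    (hx : x * x = a₁ • x + b₁ • y + c₁ • 1)
    (hy : y * y = (-β) • (x * y) + a₂ • x + b₂ • y + c₂ • 1) (hxy : x * y = -(y * x)) :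
    (a₁ = 0 ∧ b₁ = 0 ∧ c₁ = 0) ∧ a₂ = 0 ∧ b₂ = 0 ∧ c₂ = 0 := by
  have e₁ : x * (x * x) = (x * x) * x := (mul_assoc _ _ _).symm
  have e₂ : (x * x) * y = y * (x * x) := by
    rw [mul_assoc, hxy, mul_neg, ← mul_assoc, hxy, neg_mul, neg_neg, mul_assoc]
  rw [hx] at e₁ e₂
  simp only [mul_add, add_mul, mul_smul_comm, smul_mul_assoc, mul_one, one_mul, hxy] at e₁ e₂
  obtain ⟨-, -, -, h1⟩ := hind 0 0 0 (2 * b₁) (by linear_combination (norm := module) -e₁)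
  obtain ⟨-, -, -, h2⟩ := hind 0 0 0 (2 * a₁) (by linear_combination (norm := module) -e₂)
  have hb₁ : b₁ = 0 := by simpa using h1
  have ha₁ : a₁ = 0 := by simpa using h2
  subst hb₁ ha₁
  have hx0 : x * x = c₁ • 1 := by simpa using hx
  have hxyx : x * (y * x) = (-c₁) • y := by
    rw [← mul_assoc, hxy, neg_mul, mul_assoc, hx0, mul_smul_comm, mul_one, neg_smul]
  have e₃ : x * (y * y) = y * y * x := by
    rw [← mul_assoc, hxy, neg_mul, mul_assoc, hxy, mul_neg, neg_neg, mul_assoc]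
  rw [hy] at e₃
  simp only [mul_add, add_mul, mul_smul_comm, smul_mul_assoc, mul_one, one_mul, hxy, hx0,
    mul_neg, neg_mul, mul_assoc, hxyx] at e₃
  obtain ⟨-, -, h3, h4⟩ := hind 0 0 (2 * β * c₁) (2 * b₂) (by
    linear_combination (norm := module) -e₃)
  have hc₁ : c₁ = 0 := by simpa [hβ] using h3
  have hb₂ : b₂ = 0 := by simpa using h4
  subst hc₁ hb₂
  have hxyy : x * (y * y) = c₂ • x := by
    rw [hy]
    simp [mul_add, hxy, hxyx, hx0]
  have hyyx : y * (y * x) = c₂ • x := by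
    rw [← hxyy, ← mul_assoc x, hxy, neg_mul, mul_assoc, hxy, mul_neg, neg_neg]
  have e₄ : y * (y * y) = (y * y) * y := (mul_assoc _ _ _).symm
  rw [hy] at e₄
  simp only [mul_add, add_mul, mul_smul_comm, smul_mul_assoc, mul_one, one_mul, mul_assoc, hxyy,
    hxy, hyyx, mul_neg, neg_mul] at e₄
  obtain ⟨-, h5, -, h6⟩ := hind 0 (2 * β * c₂) 0 (2 * a₂) (by
    linear_combination (norm := module) e₄)
  exact ⟨⟨rfl, rfl, rfl⟩, by simpa using h6, rfl, by simpa [hβ] using h5⟩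

/-- Because x² = y², this element commutes with both x and y, which removes its linear part.
Comparing x·xy with x²·y and xy·y with x·y² then removes the remaining terms. -/
theorem relations_hyperbolic [CharZero k] {l a₁ b₁ c₁ a₃ b₃ c₃ : k} (hl : l ≠ 0) (hl1 : l ^ 2 ≠ 1)
    (hx : x * x = a₁ • x + b₁ • y + c₁ • 1) (hy : y * y = x * x)
    (hxy : x * y = l • (y * x) + a₃ • x + b₃ • y + c₃ • 1) :
    (a₁ = 0 ∧ b₁ = 0 ∧ c₁ = 0) ∧ a₃ = 0 ∧ b₃ = 0 ∧ c₃ = 0 := by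
  have hl' : l ^ 2 - 1 ≠ 0 := sub_ne_zero.2 hl1
  have hl2 : l - 1 ≠ 0 := fun h => hl' (by rw [sub_eq_zero.1 h]; ring)
  have hl3 : l + 1 ≠ 0 := fun h => hl' (by rw [eq_neg_of_add_eq_zero_left h]; ring)
  have e₁ : x * (x * x) = (x * x) * x := (mul_assoc _ _ _).symm
  have e₂ : (x * x) * y = y * (x * x) := by rw [← hy, mul_assoc]
  rw [hx] at e₁ e₂
  simp only [mul_add, add_mul, mul_smul_comm, smul_mul_assoc, mul_one, one_mul, hxy] at e₁ e₂
  obtain ⟨-, -, -, h1⟩ := hind (b₁ * c₃) (b₁ * a₃) (b₁ * b₃) ((l - 1) * b₁) (by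
    linear_combination (norm := module) e₁)
  obtain ⟨-, -, -, h2⟩ := hind (a₁ * c₃) (a₁ * a₃) (a₁ * b₃) ((l - 1) * a₁) (by
    linear_combination (norm := module) e₂)
  have hb₁ : b₁ = 0 := by simpa [hl2] using h1
  have ha₁ : a₁ = 0 := by simpa [hl2] using h2
  subst hb₁ ha₁
  have hx0 : x * x = c₁ • 1 := by simpa using hx
  have hy0 : y * y = c₁ • 1 := hy.trans hx0
  have hyxx : y * x * x = c₁ • y := by rw [mul_assoc, hx0, mul_smul_comm, mul_one]
  have hyyx : y * (y * x) = c₁ • x := by rw [← mul_assoc, hy0, smul_mul_assoc, one_mul]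
  have e₃ : x * (x * y) = (x * x) * y := (mul_assoc _ _ _).symm
  rw [hxy, hx0] at e₃
  simp only [mul_add, mul_smul_comm, smul_mul_assoc, mul_one, one_mul, ← mul_assoc x y x, hxy,
    hx0, add_mul, hyxx] at e₃
  obtain ⟨-, h3, h4, h5⟩ := hind ((l + 1) * c₁ * a₃ + b₃ * c₃)
    ((l + 1) * c₃ + b₃ * a₃) ((l ^ 2 - 1) * c₁ + b₃ * b₃) (2 * l * b₃) (by
    linear_combination (norm := module) e₃)
  have hb₃ : b₃ = 0 := by simpa [hl] using h5
  subst hb₃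
  have hc₁ : c₁ = 0 := by simpa [hl'] using h4
  have hc₃ : c₃ = 0 := by simpa [hl3] using h3
  subst hc₁ hc₃
  have e₄ : (x * y) * y = x * (y * y) := mul_assoc _ _ _
  rw [hxy, hy0] at e₄
  simp only [mul_add, mul_smul_comm, smul_mul_assoc, mul_one, mul_assoc, hxy,
    hy0, add_mul, hyyx] at e₄
  obtain ⟨-, -, -, h6⟩ := hind 0 (a₃ * a₃) 0 (2 * l * a₃) (by
    linear_combination (norm := module) e₄)
  exact ⟨⟨rfl, rfl, rfl⟩, by simpa [hl] using h6, rfl, rfl⟩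

end Relations

end

end NAPC

namespace NAPC

noncomputable section

/-! ### Normal forms from the leading forms -/

section Forms

variable {k : Type u} [Field k]

/-- Some graded automorphism moves all entries of `F'` into `W`. -/
def HasForm (W : Submodule k (FreeAlgebra k (Fin 2))) (F' : Fin 3 → FreeAlgebra k (Fin 2)) : Prop :=
  ∃ φ : FreeAlgebra k (Fin 2) ≃ₐ[k] FreeAlgebra k (Fin 2), IsGradedAut φ ∧ ∀ j, φ (F' j) ∈ W

theorem HasForm.of_map {W : Submodule k (FreeAlgebra k (Fin 2))}
    {F' : Fin 3 → FreeAlgebra k (Fin 2)}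
    {ψ : FreeAlgebra k (Fin 2) ≃ₐ[k] FreeAlgebra k (Fin 2)} (hψ : IsGradedAut ψ)
    (h : HasForm (W.map ψ.toLinearMap) F') : HasForm W F' := by
  obtain ⟨φ, hφ, hj⟩ := h
  refine ⟨φ.trans ψ.symm, hφ.trans hψ.symm, fun j => ?_⟩
  obtain ⟨u, hu, hu'⟩ := hj j
  change ψ.symm (φ (F' j)) ∈ W
  rw [← hu']
  change ψ.symm (ψ u) ∈ W
  simpa using hu

theorem hasForm_of_mem {W : Submodule k (FreeAlgebra k (Fin 2))} {u v w : FreeAlgebra k (Fin 2)}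
    (hu : u ∈ W) (hv : v ∈ W) (hw : w ∈ W) : HasForm W ![u, v, w] := by
  refine ⟨AlgEquiv.refl, fun i u => Iff.rfl, fun j => ?_⟩
  fin_cases j
  · exact hu
  · exact hv
  · exact hw

theorem hasForm_of_substitution {W : Submodule k (FreeAlgebra k (Fin 2))}
    {u v w : FreeAlgebra k (Fin 2)} {a b c d : k} (hD : a * d - b * c ≠ 0)
    (h : ∀ φ : FreeAlgebra k (Fin 2) ≃ₐ[k] FreeAlgebra k (Fin 2),
      φ (X k) = a • X k + b • Y k → φ (Y k) = c • X k + d • Y k → φ u ∈ W ∧ φ v ∈ W ∧ φ w ∈ W) :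
    HasForm W ![u, v, w] := by
  obtain ⟨φ, hφ, hX, hY⟩ := exists_linearSubstitution hD
  obtain ⟨hu, hv, hw⟩ := h φ hX hY
  refine ⟨φ, hφ, fun j => ?_⟩
  fin_cases j
  · exact hu
  · exact hv
  · exact hw

/-- The relations of the noncommutative normal forms. -/
def StandardForm (W : Submodule k (FreeAlgebra k (Fin 2))) : Prop :=
  (∃ c : k, c ≠ 0 ∧ c ≠ 1 ∧ HasForm W ![X k ^ 2, Y k ^ 2, X k * Y k - c • (Y k * X k)]) ∨
  HasForm W ![X k ^ 2, Y k ^ 2 + Y k * X k, X k * Y k + Y k * X k] ∨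
  HasForm W ![X k ^ 2, Y k ^ 2 + 1, X k * Y k + Y k * X k] ∨
  HasForm W ![X k ^ 2 + 1, Y k ^ 2 + 1, X k * Y k + Y k * X k]

/-- The relations of the commutative normal forms. -/
def CommutativeForm (W : Submodule k (FreeAlgebra k (Fin 2))) : Prop :=
  (∃ β : k, ∃ l ∈ low k, HasForm W ![Y k * Y k, X k * X k + β • (X k * Y k) + l,
    X k * Y k - Y k * X k]) ∨
  (∃ a c : k, a ≠ 0 ∧ c ≠ 0 ∧ ∃ l ∈ low k, HasForm W ![X k * Y k,
    a • (X k * X k) + c • (Y k * Y k) + l, X k * Y k - Y k * X k])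

theorem StandardForm.of_map {W : Submodule k (FreeAlgebra k (Fin 2))}
    {ψ : FreeAlgebra k (Fin 2) ≃ₐ[k] FreeAlgebra k (Fin 2)} (hψ : IsGradedAut ψ)
    (h : StandardForm (W.map ψ.toLinearMap)) : StandardForm W := by
  rcases h with ⟨c, h0, h1, h⟩ | h | h | h
  · exact Or.inl ⟨c, h0, h1, h.of_map hψ⟩
  · exact Or.inr (Or.inl (h.of_map hψ))
  · exact Or.inr (Or.inr (Or.inl (h.of_map hψ)))
  · exact Or.inr (Or.inr (Or.inr (h.of_map hψ)))

theorem CommutativeForm.of_map {W : Submodule k (FreeAlgebra k (Fin 2))}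
    {ψ : FreeAlgebra k (Fin 2) ≃ₐ[k] FreeAlgebra k (Fin 2)} (hψ : IsGradedAut ψ)
    (h : CommutativeForm (W.map ψ.toLinearMap)) : CommutativeForm W := by
  rcases h with ⟨β, l, hl, h⟩ | ⟨a, c, h0, h1, l, hl, h⟩
  · exact Or.inl ⟨β, l, hl, h.of_map hψ⟩
  · exact Or.inr ⟨a, c, h0, h1, l, hl, h.of_map hψ⟩

theorem lin_mem₃ {W : Submodule k (FreeAlgebra k (Fin 2))} {u v w : FreeAlgebra k (Fin 2)}
    (hu : u ∈ W) (hv : v ∈ W) (hw : w ∈ W) (a b c : k) : a • u + b • v + c • w ∈ W :=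
  add_mem (add_mem (W.smul_mem a hu) (W.smul_mem b hv)) (W.smul_mem c hw)

theorem X_Y_independent (a b : k) (h : a • X k + b • Y k = 0) : a = 0 ∧ b = 0 := by
  obtain ⟨-, ha, hb, -⟩ := coeffs_of_eq_zero (k := k) (c := 0) (a := a) (b := b) (m₁ := 0)
    (m₂ := 0) (m₃ := 0) (m₄ := 0) (by rw [← h]; module)
  exact ⟨ha, hb⟩

/-- The class of an element in the algebra with relations `W`. -/
abbrev cls (W : Submodule k (FreeAlgebra k (Fin 2))) : FreeAlgebra k (Fin 2) →ₐ[k]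
    FreeAlgebra k (Fin 2) ⧸ idealOf (W : Set (FreeAlgebra k (Fin 2))) :=
  Ideal.Quotient.mkₐ k (idealOf (W : Set (FreeAlgebra k (Fin 2))))

theorem cls_eq_zero {W : Submodule k (FreeAlgebra k (Fin 2))} {u : FreeAlgebra k (Fin 2)}
    (hu : u ∈ W) : cls W u = 0 :=
  Ideal.Quotient.eq_zero_iff_mem.2 (subset_idealOf hu)

/-- This supplies the independence hypotheses of the relation lemmas, with the quadratic monomial m₁
m₂ chosen outside the span of the leading forms. -/
theorem LeadingData.cls_independent {W : Submodule k (FreeAlgebra k (Fin 2))}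
    {p q h : FreeAlgebra k (Fin 2)} (D : LeadingData W p q h) {m₁ m₂ : FreeAlgebra k (Fin 2)}
    (h₁ : m₁ ∈ freeGrading k 2 1) (h₂ : m₂ ∈ freeGrading k 2 1)
    (hmW : ∀ α β γ : k, α • p + β • q + γ • h ≠ m₁ * m₂) (c a b d : k)
    (h0 : c • 1 + a • cls W (X k) + b • cls W (Y k) + d • (cls W m₁ * cls W m₂) = 0) :
    c = 0 ∧ a = 0 ∧ b = 0 ∧ d = 0 := by
  have hm : m₁ * m₂ ∈ freeGrading k 2 2 := by
    rw [freeGrading_two]; exact Submodule.mul_mem_mul h₁ h₂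
  refine D.independent X_Y_independent X_mem Y_mem hm hmW (Ideal.Quotient.eq_zero_iff_mem.1 ?_)
  change cls W _ = 0
  rw [← h0]
  simp only [map_add, map_smul, map_one, map_mul]

/-- The filtered relation with leading form `p`. -/
theorem LeadingData.exists_relation {W : Submodule k (FreeAlgebra k (Fin 2))}
    {p q h : FreeAlgebra k (Fin 2)} (D : LeadingData W p q h) : ∃ a b c : k,
      p - (a • X k + b • Y k + c • 1) ∈ W ∧
      cls W p = a • cls W (X k) + b • cls W (Y k) + c • 1 := by
  obtain ⟨f, hf, hfp⟩ := D.exists_p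
  obtain ⟨c, a, b, h0⟩ := mem_low.1 hfp
  have hmem : p - ((-a) • X k + (-b) • Y k + (-c) • 1) ∈ W := by
    convert hf using 1
    rw [← sub_add_cancel f p, h0]
    module
  refine ⟨-a, -b, -c, hmem, ?_⟩
  have := cls_eq_zero hmem
  rw [map_sub, sub_eq_zero] at this
  rw [this]
  simp only [map_add, map_smul, map_one]

theorem wordCoeff_eqs {u v : FreeAlgebra k (Fin 2)} (h : u = v) :
    (wordCoeff [0, 0] u = wordCoeff [0, 0] v ∧ wordCoeff [0, 1] u = wordCoeff [0, 1] v) ∧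
    (wordCoeff [1, 0] u = wordCoeff [1, 0] v ∧ wordCoeff [1, 1] u = wordCoeff [1, 1] v) := by
  subst h; exact ⟨⟨rfl, rfl⟩, rfl, rfl⟩

/-- Once y² itself lies in `W`, adding it to xy - yx - y² produces the commutator: E is commutative
although S is not. -/
theorem LeadingData.jordan [CharZero k] {W : Submodule k (FreeAlgebra k (Fin 2))} {β : k}
    (D : LeadingData W (Y k * Y k) (X k * X k + β • (X k * Y k))
      (X k * Y k - Y k * X k - Y k * Y k)) : CommutativeForm W := by
  have hind := D.cls_independent Y_mem X_mem (fun α β' γ h0 => by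
    have key := wordCoeff_eqs h0
    simp [wordCoeff_ι₂] at key
    obtain ⟨⟨h1, h2⟩, h3, -⟩ := key
    simp [h1] at h2
    simp [h2] at h3)
  obtain ⟨a, b, c, hp, hy⟩ := D.exists_relation
  obtain ⟨g, hg, hgq⟩ := D.exists_q
  have hxy := cls_eq_zero D.h_mem_W
  rw [map_sub, map_sub, sub_sub, sub_eq_zero] at hxy
  simp only [map_mul] at hy hxy
  obtain ⟨rfl, rfl, rfl⟩ := relations_jordan hind hy hxy
  have hp' : Y k * Y k ∈ W := by simpa using hp
  refine Or.inl ⟨β, g - (X k * X k + β • (X k * Y k)), hgq, hasForm_of_mem hp' ?_ ?_⟩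
  · rwa [add_sub_cancel]
  · simpa using add_mem D.h_mem_W hp'

theorem LeadingData.node {W : Submodule k (FreeAlgebra k (Fin 2))} {a c l : k} (ha : a ≠ 0)
    (hc : c ≠ 0) (hl : l ≠ 0) (hl1 : l ≠ 1)
    (D : LeadingData W (X k * Y k) (a • (X k * X k) + c • (Y k * Y k))
      (X k * Y k - l • (Y k * X k))) : CommutativeForm W := by
  have hindx := D.cls_independent X_mem X_mem (fun α β' γ h0 => by
    have key := wordCoeff_eqs h0
    simp [wordCoeff_ι₂, hc] at key
    obtain ⟨⟨h1, h2⟩, h3, h4⟩ := key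
    simp [h4] at h1)
  have hindy := D.cls_independent Y_mem Y_mem (fun α β' γ h0 => by
    have key := wordCoeff_eqs h0
    simp [wordCoeff_ι₂, ha] at key
    obtain ⟨⟨h1, h2⟩, h3, h4⟩ := key
    simp [h1] at h4)
  obtain ⟨a₁, b₁, c₁, hp, h₁⟩ := D.exists_relation
  obtain ⟨g, hg, hgq⟩ := D.exists_q
  have hxy := cls_eq_zero D.h_mem_W
  rw [map_sub, sub_eq_zero] at hxy
  simp only [map_mul, map_smul] at h₁ hxy
  obtain ⟨rfl, rfl, rfl⟩ := relations_node hl hl1 hindx hindy h₁ hxy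
  have hp' : X k * Y k ∈ W := by simpa using hp
  refine Or.inr ⟨a, c, ha, hc, g - (a • (X k * X k) + c • (Y k * Y k)), hgq,
    hasForm_of_mem hp' ?_ ?_⟩
  · rwa [add_sub_cancel]
  -- With xy and xy - l yx both in `W`, this combination is xy - yx.
  · convert lin_mem₃ hp' D.h_mem_W D.h_mem_W (1 - l⁻¹) l⁻¹ 0 using 1
    match_scalars <;> field_simp <;> ring

theorem LeadingData.quantum {W : Submodule k (FreeAlgebra k (Fin 2))} {b l : k}
    (hl : l ≠ 0) (hl1 : l ^ 2 ≠ 1)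
    (D : LeadingData W (X k * X k) (Y k * Y k + b • (X k * Y k))
      (X k * Y k - l • (Y k * X k))) : StandardForm W := by
  have hl2 : l ≠ 1 := fun h => hl1 (by rw [h]; ring)
  have hl3 : l + 1 ≠ 0 := fun h => hl1 (by rw [eq_neg_of_add_eq_zero_left h]; ring)
  have hind := D.cls_independent Y_mem X_mem (fun α β' γ h0 => by
    have key := wordCoeff_eqs h0
    simp [wordCoeff_ι₂] at key
    obtain ⟨⟨h1, h2⟩, h3, h4⟩ := key
    simp [h4] at h2
    simp [h2] at h3)
  obtain ⟨a₁, b₁, c₁, hp, h₁⟩ := D.exists_relation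
  obtain ⟨a₂, b₂, c₂, hq, h₂⟩ := D.swap.exists_relation
  have hxy := cls_eq_zero D.h_mem_W
  rw [map_sub, sub_eq_zero] at hxy
  simp only [map_add, map_mul, map_smul] at h₁ h₂ hxy
  obtain ⟨⟨rfl, rfl, rfl⟩, rfl, rfl, rfl⟩ := relations_quantum (β := b) hind hl hl1 h₁
    (by linear_combination (norm := module) h₂) hxy
  have hp' : X k * X k ∈ W := by simpa using hp
  have hq' : Y k * Y k + b • (X k * Y k) ∈ W := by simpa using hq
  -- Modulo xy - l yx, the square of y + c x contains xy with coefficient c(l + 1)/l. The choice c =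
  -- bl/(l + 1) makes this b, absorbing the mixed term of q.
  refine Or.inl ⟨l, hl, hl2, hasForm_of_substitution (a := 1) (b := 0) (c := b * l / (l + 1))
    (d := 1) (by simp) fun φ hX hY => ⟨?_, ?_, ?_⟩⟩
  · simpa [hX, pow_two] using hp'
  · rw [map_pow, hY]
    convert lin_mem₃ hp' hq' D.h_mem_W ((b * l / (l + 1)) ^ 2) 1 (-(b / (l + 1))) using 1
    simp only [pow_two, mul_add, add_mul, mul_smul_comm, smul_mul_assoc]
    match_scalars <;> field_simp <;> ring
  · rw [map_sub, map_smul, map_mul, map_mul, hX, hY]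
    convert lin_mem₃ hp' hq' D.h_mem_W ((b * l / (l + 1)) * (1 - l)) 0 1 using 1
    simp only [mul_add, add_mul, mul_smul_comm, smul_mul_assoc]
    match_scalars <;> field_simp <;> ring

theorem LeadingData.clifford [CharZero k] [IsAlgClosed k]
    {W : Submodule k (FreeAlgebra k (Fin 2))}
    (D : LeadingData W (X k * X k) (Y k * Y k) (X k * Y k + Y k * X k)) : StandardForm W := by
  have hind := D.cls_independent Y_mem X_mem (fun α β' γ h0 => by
    have key := wordCoeff_eqs h0
    simp [wordCoeff_ι₂] at key
    obtain ⟨⟨h1, h2⟩, h3, h4⟩ := key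
    simp [h2] at h3)
  obtain ⟨a₁, b₁, c₁, hp, h₁⟩ := D.exists_relation
  obtain ⟨a₂, b₂, c₂, hq, h₂⟩ := D.swap.exists_relation
  have hxy := cls_eq_zero D.h_mem_W
  simp only [map_add, map_mul] at h₁ h₂ hxy
  obtain ⟨⟨rfl, rfl⟩, rfl, rfl⟩ := relations_clifford hind h₁ h₂ (eq_neg_of_add_eq_zero_left hxy)
  have hp' : X k * X k - c₁ • 1 ∈ W := by simpa using hp
  have hq' : Y k * Y k - c₂ • 1 ∈ W := by simpa using hq
  have hh := D.h_mem_W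
  -- The relations become x² + s² and y² + t², and each nonzero constant is scaled to 1. If only s ≠
  -- 0 the variables are also exchanged; if both vanish, the result is the first family with
  -- parameter -1.
  obtain ⟨s, hs⟩ := IsAlgClosed.exists_pow_nat_eq (-c₁) (n := 2) (by norm_num)
  obtain ⟨t, ht⟩ := IsAlgClosed.exists_pow_nat_eq (-c₂) (n := 2) (by norm_num)
  have hs' : c₁ = - s ^ 2 := by rw [hs]; ring
  have ht' : c₂ = - t ^ 2 := by rw [ht]; ring
  subst hs' ht'
  clear hs ht
  have hxy' : ∀ a b : k, (a • X k) * (b • Y k) + (b • Y k) * (a • X k) ∈ W := fun a b => by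
    convert W.smul_mem (a * b) hh using 1
    simp only [mul_smul_comm, smul_mul_assoc]
    module
  rcases eq_or_ne s 0 with rfl | hs0 <;> rcases eq_or_ne t 0 with rfl | ht0
  · refine Or.inl ⟨-1, by simp, by norm_num, hasForm_of_mem ?_ ?_ ?_⟩
    · simpa [pow_two] using hp'
    · simpa [pow_two] using hq'
    · simpa using hh
  · refine Or.inr (Or.inr (Or.inl (hasForm_of_substitution (a := 1) (b := 0) (c := 0) (d := t⁻¹)
      (by simp [ht0]) fun φ hX hY => ⟨?_, ?_, ?_⟩)))
    · simpa [hX, pow_two] using hp'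
    · rw [map_add, map_pow, map_one, hY]
      convert W.smul_mem (t⁻¹ ^ 2) hq' using 1
      simp only [pow_two, mul_add, add_mul, mul_smul_comm, smul_mul_assoc]
      match_scalars <;> field_simp <;> ring
    · simpa [hX, hY] using hxy' 1 t⁻¹
  · refine Or.inr (Or.inr (Or.inl (hasForm_of_substitution (a := 0) (b := 1) (c := s⁻¹) (d := 0)
      (by simp [hs0]) fun φ hX hY => ⟨?_, ?_, ?_⟩)))
    · simpa [hX, pow_two] using hq'
    · rw [map_add, map_pow, map_one, hY]
      convert W.smul_mem (s⁻¹ ^ 2) hp' using 1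
      simp only [pow_two, mul_add, add_mul, mul_smul_comm, smul_mul_assoc]
      match_scalars <;> field_simp <;> ring
    · have := hxy' s⁻¹ 1
      rw [add_comm] at this
      simpa [hX, hY] using this
  · refine Or.inr (Or.inr (Or.inr (hasForm_of_substitution (a := s⁻¹) (b := 0) (c := 0) (d := t⁻¹)
      (by simp [hs0, ht0]) fun φ hX hY => ⟨?_, ?_, ?_⟩)))
    · rw [map_add, map_pow, map_one, hX]
      convert W.smul_mem (s⁻¹ ^ 2) hp' using 1
      simp only [pow_two, mul_add, add_mul, mul_smul_comm, smul_mul_assoc]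
      match_scalars <;> field_simp <;> ring
    · rw [map_add, map_pow, map_one, hY]
      convert W.smul_mem (t⁻¹ ^ 2) hq' using 1
      simp only [pow_two, mul_add, add_mul, mul_smul_comm, smul_mul_assoc]
      match_scalars <;> field_simp <;> ring
    · simpa [hX, hY] using hxy' s⁻¹ t⁻¹

theorem LeadingData.skew [CharZero k] {W : Submodule k (FreeAlgebra k (Fin 2))} {b : k}
    (hb : b ≠ 0) (D : LeadingData W (X k * X k) (Y k * Y k + b • (X k * Y k))
      (X k * Y k + Y k * X k)) : StandardForm W := by
  have hind := D.cls_independent Y_mem X_mem (fun α β' γ h0 => by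
    have key := wordCoeff_eqs h0
    simp [wordCoeff_ι₂] at key
    obtain ⟨⟨h1, h2⟩, h3, h4⟩ := key
    simp [h4] at h2
    simp [h2] at h3)
  obtain ⟨a₁, b₁, c₁, hp, h₁⟩ := D.exists_relation
  obtain ⟨a₂, b₂, c₂, hq, h₂⟩ := D.swap.exists_relation
  have hxy := cls_eq_zero D.h_mem_W
  simp only [map_add, map_mul, map_smul] at h₁ h₂ hxy
  obtain ⟨⟨rfl, rfl, rfl⟩, rfl, rfl, rfl⟩ := relations_skew hind hb h₁
    (by linear_combination (norm := module) h₂) (eq_neg_of_add_eq_zero_left hxy)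
  have hp' : X k * X k ∈ W := by simpa using hp
  have hq' : Y k * Y k + b • (X k * Y k) ∈ W := by simpa using hq
  -- Scaling x by -b turns y² + yx into y² - b yx, which equals y² + b xy minus b times xy + yx.
  refine Or.inr (Or.inl (hasForm_of_substitution (a := -b) (b := 0) (c := 0) (d := 1)
    (by simpa using hb) fun φ hX hY => ⟨?_, ?_, ?_⟩))
  · rw [map_pow, hX]
    convert W.smul_mem (b ^ 2) hp' using 1
    simp only [pow_two, add_mul, mul_add, mul_smul_comm, smul_mul_assoc]
    module
  · rw [map_add, map_pow, map_mul, hX, hY]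
    convert lin_mem₃ hp' hq' D.h_mem_W 0 1 (-b) using 1
    simp only [pow_two, add_mul, mul_add, mul_smul_comm, smul_mul_assoc]
    module
  · rw [map_add, map_mul, map_mul, hX, hY]
    convert W.smul_mem (-b) D.h_mem_W using 1
    simp only [add_mul, mul_add, mul_smul_comm, smul_mul_assoc]
    module

theorem LeadingData.hyperbolic [CharZero k] {W : Submodule k (FreeAlgebra k (Fin 2))} {l : k}
    (hl : l ≠ 0) (hl1 : l ^ 2 ≠ 1) (D : LeadingData W (X k * X k)
      (X k * Y k - l • (Y k * X k)) (Y k * Y k - X k * X k)) : StandardForm W := by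
  have hl2 : l ≠ 1 := fun h => hl1 (by rw [h]; ring)
  have hind := D.cls_independent Y_mem X_mem (fun α β' γ h0 => by
    have key := wordCoeff_eqs h0
    simp [wordCoeff_ι₂] at key
    obtain ⟨⟨h1, h2⟩, h3, h4⟩ := key
    simp [h2] at h3)
  obtain ⟨a₁, b₁, c₁, hp, h₁⟩ := D.exists_relation
  obtain ⟨a₂, b₂, c₂, hq, h₂⟩ := D.swap.exists_relation
  have hxy := cls_eq_zero D.h_mem_W
  simp only [map_sub, map_mul, map_smul] at h₁ h₂ hxy
  obtain ⟨⟨rfl, rfl, rfl⟩, rfl, rfl, rfl⟩ := relations_hyperbolic hind hl hl1 h₁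
    (sub_eq_zero.1 hxy) (by linear_combination (norm := module) h₂)
  have hp' : X k * X k ∈ W := by simpa using hp
  have hq' : X k * Y k - l • (Y k * X k) ∈ W := by simpa using hq
  refine Or.inl ⟨l, hl, hl2, hasForm_of_mem (by rwa [pow_two]) ?_ hq'⟩
  simpa [pow_two] using add_mem D.h_mem_W hp'

end Forms

end

end NAPC

namespace NAPC

noncomputable section

/-! ### Case analysis on the leading forms -/

section Cases

variable {k : Type u} [Field k]

/-- The quadratic element with the given coefficients. -/
def quad (a b c d : k) : FreeAlgebra k (Fin 2) :=
  a • (X k * X k) + b • (X k * Y k) + c • (Y k * X k) + d • (Y k * Y k)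

theorem exists_eq_quad {u : FreeAlgebra k (Fin 2)} (hu : u ∈ freeGrading k 2 2) :
    ∃ a b c d : k, u = quad a b c d := mem_freeGrading_two.1 hu

theorem X_ne_zero : X k ≠ 0 := fun h =>
  one_ne_zero (X_Y_independent (k := k) 1 0 (by rw [h]; simp)).1

theorem Y_ne_zero : Y k ≠ 0 := fun h =>
  one_ne_zero (X_Y_independent (k := k) 0 1 (by rw [h]; simp)).2

theorem QuadraticData.cast {W : Submodule k (FreeAlgebra k (Fin 2))}
    {p q h p' q' h' : FreeAlgebra k (Fin 2)} (D : QuadraticData W p q h) (hp : p = p')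
    (hq : q = q') (hh : h = h') : QuadraticData W p' q' h' := by
  subst hp hq hh; exact D

theorem LeadingData.cast {W : Submodule k (FreeAlgebra k (Fin 2))}
    {p q h p' q' h' : FreeAlgebra k (Fin 2)} (D : LeadingData W p q h) (hp : p = p')
    (hq : q = q') (hh : h = h') : LeadingData W p' q' h' := by
  subst hp hq hh; exact D

theorem inCubic_of_eq {h u : FreeAlgebra k (Fin 2)} (a b c d : k)
    (e : u = (a • X k + b • Y k) * h + h * (c • X k + d • Y k)) : InCubic h u :=
  ⟨_, mem_freeGrading_one.2 ⟨a, b, rfl⟩, _, mem_freeGrading_one.2 ⟨c, d, rfl⟩, e⟩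

/-- The normality of `p` modulo `h` in coordinates. -/
theorem QuadraticData.normal_coeffs {W : Submodule k (FreeAlgebra k (Fin 2))}
    {q : FreeAlgebra k (Fin 2)} {p₀ p₁ p₂ p₃ h₀ h₁ h₂ h₃ : k}
    (D : QuadraticData W (quad p₀ p₁ p₂ p₃) q (quad h₀ h₁ h₂ h₃)) (v₀ v₁ : k) :
    ∃ l₀ l₁ e₁ e₂ e₃ e₄ : k,
      (v₀ * p₀ - p₀ * l₀ = e₁ * h₀ + e₃ * h₀ ∧ v₀ * p₁ - p₀ * l₁ = e₁ * h₁ + e₄ * h₀) ∧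
      (v₀ * p₂ - p₁ * l₀ = e₁ * h₂ + e₃ * h₁ ∧ v₀ * p₃ - p₁ * l₁ = e₁ * h₃ + e₄ * h₁) ∧
      (v₁ * p₀ - p₂ * l₀ = e₂ * h₀ + e₃ * h₂ ∧ v₁ * p₁ - p₂ * l₁ = e₂ * h₁ + e₄ * h₂) ∧
      (v₁ * p₂ - p₃ * l₀ = e₂ * h₂ + e₃ * h₃ ∧ v₁ * p₃ - p₃ * l₁ = e₂ * h₃ + e₄ * h₃) := by
  obtain ⟨l, hl, l₁, hl₁, l₂, hl₂, e⟩ := D.normal _ (mem_freeGrading_one.2 ⟨v₀, v₁, rfl⟩)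
  obtain ⟨l₀', l₁', rfl⟩ := mem_freeGrading_one.1 hl
  obtain ⟨e₁, e₂, rfl⟩ := mem_freeGrading_one.1 hl₁
  obtain ⟨e₃, e₄, rfl⟩ := mem_freeGrading_one.1 hl₂
  refine ⟨l₀', l₁', e₁, e₂, e₃, e₄, ?_⟩
  have key := cubic_coeffs_of_eq_zero (k := k) (m :=
    ![v₀ * p₀ - p₀ * l₀' - (e₁ * h₀ + e₃ * h₀), v₀ * p₁ - p₀ * l₁' - (e₁ * h₁ + e₄ * h₀),
      v₀ * p₂ - p₁ * l₀' - (e₁ * h₂ + e₃ * h₁), v₀ * p₃ - p₁ * l₁' - (e₁ * h₃ + e₄ * h₁),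
      v₁ * p₀ - p₂ * l₀' - (e₂ * h₀ + e₃ * h₂), v₁ * p₁ - p₂ * l₁' - (e₂ * h₁ + e₄ * h₂),
      v₁ * p₂ - p₃ * l₀' - (e₂ * h₂ + e₃ * h₃), v₁ * p₃ - p₃ * l₁' - (e₂ * h₃ + e₄ * h₃)]) (by
    rw [← sub_eq_zero.2 e]
    simp only [quad, mul_add, add_mul, mul_smul_comm, smul_mul_assoc, mul_assoc]
    simp only [Matrix.cons_val]
    module)
  exact ⟨⟨sub_eq_zero.1 (key 0), sub_eq_zero.1 (key 1)⟩, ⟨sub_eq_zero.1 (key 2),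
    sub_eq_zero.1 (key 3)⟩, ⟨sub_eq_zero.1 (key 4), sub_eq_zero.1 (key 5)⟩,
    sub_eq_zero.1 (key 6), sub_eq_zero.1 (key 7)⟩

theorem QuadraticData.p_ne_zero {W : Submodule k (FreeAlgebra k (Fin 2))}
    {p q h : FreeAlgebra k (Fin 2)} (D : QuadraticData W p q h) : p ≠ 0 := fun h0 =>
  X_ne_zero (D.reg_left _ X_mem ⟨0, zero_mem _, 0, zero_mem _, by simp [h0]⟩)

/-- Modulo xy no quadratic p is both regular and normal. Without an x² term, x p vanishes. With one,
normality leaves only x² and xy in p, and then p y vanishes. -/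
theorem QuadraticData.false_of_XY {W : Submodule k (FreeAlgebra k (Fin 2))}
    {p q : FreeAlgebra k (Fin 2)} (D : QuadraticData W p q (quad 0 1 0 0)) : False := by
  obtain ⟨a, b, c, d, rfl⟩ := exists_eq_quad D.p_mem
  obtain ⟨l₀, l₁, e₁, e₂, e₃, e₄, ⟨h1, h2⟩, ⟨h3, h4⟩, ⟨h5, h6⟩, h7, h8⟩ := D.normal_coeffs 1 0
  by_cases ha : a = 0
  · subst ha
    refine X_ne_zero (D.reg_left _ X_mem (inCubic_of_eq b 0 c d ?_))
    simp only [quad, mul_add, add_mul, mul_smul_comm, smul_mul_assoc, mul_assoc]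
    module
  · have hl : l₀ = 1 := by
      have : a * (1 - l₀) = 0 := by linear_combination h1
      rcases mul_eq_zero.1 this with h | h
      · exact absurd h ha
      · exact (sub_eq_zero.1 h).symm
    subst hl
    obtain rfl : c = 0 := by linear_combination -h5
    obtain rfl : d = 0 := by linear_combination -h7
    refine Y_ne_zero (D.reg_right _ Y_mem (inCubic_of_eq a 0 0 b ?_))
    simp only [quad, mul_add, add_mul, mul_smul_comm, smul_mul_assoc, mul_assoc]
    module

/-- Normality removes the x² term of p. Regularity against y on both sides then requires both mixed
coefficients to be nonzero, which is incompatible with normality tested on x. -/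
theorem QuadraticData.false_of_YY {W : Submodule k (FreeAlgebra k (Fin 2))}
    {p q : FreeAlgebra k (Fin 2)} (D : QuadraticData W p q (quad 0 0 0 1)) : False := by
  obtain ⟨a, b, c, d, rfl⟩ := exists_eq_quad D.p_mem
  obtain ⟨l₀, l₁, e₁, e₂, e₃, e₄, ⟨h1, h2⟩, ⟨h3, h4⟩, ⟨h5, h6⟩, h7, h8⟩ := D.normal_coeffs 1 0
  obtain ⟨l₀', l₁', e₁', e₂', e₃', e₄', ⟨h1', h2'⟩, ⟨h3', h4'⟩, ⟨h5', h6'⟩, h7', h8'⟩ :=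
    D.normal_coeffs 0 1
  have ha : a = 0 := by
    by_contra ha
    have hl : l₀' = 0 := (mul_eq_zero.1 (show a * l₀' = 0 by
      linear_combination -h1')).resolve_left ha
    rw [hl] at h5'
    exact ha (by linear_combination h5')
  subst ha
  have hc : c ≠ 0 := by
    rintro rfl
    refine Y_ne_zero (D.reg_right _ Y_mem (inCubic_of_eq b 0 0 d ?_))
    simp only [quad, mul_add, add_mul, mul_smul_comm, smul_mul_assoc, mul_assoc]
    module
  have hb : b ≠ 0 := by
    rintro rfl
    refine Y_ne_zero (D.reg_left _ Y_mem (inCubic_of_eq 0 d c 0 ?_))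
    simp only [quad, mul_add, add_mul, mul_smul_comm, smul_mul_assoc, mul_assoc]
    module
  have hl0 : l₀ = 0 := by
    exact (mul_eq_zero.1 (show c * l₀ = 0 by linear_combination -h5)).resolve_left hc
  have : c = 0 := by
    rw [hl0] at h3
    linear_combination h3
  exact hc this

/-- Normality tested on y forces p to be a multiple of y² modulo h. After reduction q involves only
x² and xy, and its x² coefficient is nonzero because y·xy is a left multiple of y² modulo h. -/
theorem QuadraticData.jordan [CharZero k] {W : Submodule k (FreeAlgebra k (Fin 2))}
    {p q : FreeAlgebra k (Fin 2)} (D : QuadraticData W p q (quad 0 1 (-1) (-1))) :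
    CommutativeForm W := by
  obtain ⟨a, b, c, d, rfl⟩ := exists_eq_quad D.p_mem
  obtain ⟨α, β, γ, δ, rfl⟩ := exists_eq_quad D.q_mem
  have hpd : a = 0 ∧ b + c = 0 := by
    obtain ⟨l₀, l₁, e₁, e₂, e₃, e₄, ⟨h1, h2⟩, ⟨h3, h4⟩, ⟨h5, h6⟩, h7, h8⟩ := D.normal_coeffs 0 1
    have ha : a = 0 := by
      by_contra ha
      have hl0 : l₀ = 0 := (mul_eq_zero.1 (show a * l₀ = 0 by
        linear_combination -h1)).resolve_left ha
      subst hl0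
      have hl1 : l₁ = 1 := mul_left_cancel₀ ha (by linear_combination -h2 - h3 - h5)
      subst hl1
      exact ha (by linear_combination (-1 / 2) * (h4 + h6 + h7 + h2 - h5))
    subst ha
    refine ⟨rfl, ?_⟩
    by_contra hbc
    have hl0 : l₀ = 0 := (mul_eq_zero.1 (show (b + c) * l₀ = 0 by
      linear_combination -h2 - h3 - h5)).resolve_left hbc
    subst hl0
    have hl1 : l₁ = 1 := mul_left_cancel₀ hbc (by
      linear_combination -(h4 + h6 + h7 + h3 + 2 * h2))
    subst hl1
    exact hbc (by linear_combination h7 - h4 - h8 + h3)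
  obtain ⟨rfl, hbc⟩ := hpd
  obtain rfl : c = -b := eq_neg_of_add_eq_zero_right hbc
  have D₁ := (D.change one_ne_zero one_ne_zero one_ne_zero 0 γ (-b)).cast
    (p' := (d + b) • (Y k * Y k)) (by simp only [quad]; module) rfl (one_smul _ _)
  have hne : d + b ≠ 0 := fun h => D₁.p_ne_zero (by rw [h, zero_smul])
  have D₂ := (D₁.change (inv_ne_zero hne) one_ne_zero one_ne_zero ((γ - δ) / (d + b)) 0 0).cast
    (p' := Y k * Y k) (q' := α • (X k * X k) + (β + γ) • (X k * Y k))
    (by match_scalars <;> field_simp <;> ring)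
    (by simp only [quad]; match_scalars <;> field_simp <;> ring) (one_smul _ _)
  have hα : α ≠ 0 := by
    rintro rfl
    refine Y_ne_zero (D₂.reg_second _ Y_mem ((β + γ) • X k + (-(β + γ)) • Y k)
      (mem_freeGrading_one.2 ⟨_, _, rfl⟩) (inCubic_of_eq 0 0 0 (-(β + γ)) ?_))
    simp only [quad, mul_add, add_mul, mul_smul_comm, smul_mul_assoc, mul_assoc]
    module
  exact ((D₂.change one_ne_zero (inv_ne_zero hα) one_ne_zero 0 0 0).cast
    (q' := X k * X k + ((β + γ) / α) • (X k * Y k)) (by module)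
    (by match_scalars <;> field_simp <;> ring)
    (h' := X k * Y k - Y k * X k - Y k * Y k) (by simp only [quad]; module)).toLeadingData.jordan

/-- The leading form `p` modulo `xy - l yx`. -/
theorem QuadraticData.node_coeffs {W : Submodule k (FreeAlgebra k (Fin 2))}
    {q : FreeAlgebra k (Fin 2)} {a b c l : k} (hl : l ≠ 0) (hl1 : l ≠ 1)
    (D : QuadraticData W (quad a b 0 c) q (quad 0 1 (-l) 0)) :
    (a ≠ 0 → b = 0 ∧ (l ^ 2 - 1) * c = 0) ∧ (c ≠ 0 → b = 0) := by
  have hl' : l - 1 ≠ 0 := sub_ne_zero.2 hl1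
  obtain ⟨l₀, l₁, e₁, e₂, e₃, e₄, ⟨h1, h2⟩, ⟨h3, h4⟩, ⟨h5, h6⟩, h7, h8⟩ := D.normal_coeffs 1 0
  obtain ⟨m₀, m₁, f₁, f₂, f₃, f₄, ⟨g1, g2⟩, ⟨g3, g4⟩, ⟨g5, g6⟩, g7, g8⟩ := D.normal_coeffs 0 1
  refine ⟨fun ha => ?_, fun hc => ?_⟩
  · have hm₀ : m₀ = 0 := (mul_eq_zero.1 (show a * m₀ = 0 by linear_combination -g1)).resolve_left ha
    subst hm₀
    -- Modulo h one has y x² = l⁻² x² y, so comparing the x² y terms of y p and p (m₁ y) gives m₁ =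
    -- l⁻².
    have hm₁ : l ^ 2 * m₁ = 1 := mul_left_cancel₀ ha (by
      linear_combination -l ^ 2 * g2 - l * g3 - g5)
    have hb : b = 0 := by
      refine (mul_eq_zero.1 (show b * (l - 1) = 0 from ?_)).resolve_right hl'
      linear_combination l * g6 + g7 + l ^ 2 * g4 + b * hm₁
    subst hb
    exact ⟨rfl, by linear_combination l ^ 2 * g8 + c * hm₁⟩
  · have hl₁ : l₁ = 0 := (mul_eq_zero.1 (show c * l₁ = 0 by linear_combination -h8)).resolve_left hc
    subst hl₁
    -- Likewise x y² = l² y² x modulo h.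
    have hl₀ : l₀ = l ^ 2 := mul_left_cancel₀ hc (by
      linear_combination -h7 - l * h6 - l ^ 2 * h4)
    subst hl₀
    have he₃ : e₃ = 0 :=
      (mul_eq_zero.1 (show e₃ * l = 0 by linear_combination h5)).resolve_right hl
    have : b * (l * (l - 1)) = 0 := by linear_combination -l * h2 - h3 - he₃
    exact (mul_eq_zero.1 this).resolve_right (mul_ne_zero hl hl')

/-- The case where the first leading form is a square. -/
theorem QuadraticData.node_square [CharZero k] [IsAlgClosed k]
    {W : Submodule k (FreeAlgebra k (Fin 2))} {q : FreeAlgebra k (Fin 2)} {l : k} (hl : l ≠ 0)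
    (hl1 : l ≠ 1) (D : QuadraticData W (X k * X k) q (quad 0 1 (-l) 0)) : StandardForm W := by
  obtain ⟨α, β, γ, δ, rfl⟩ := exists_eq_quad D.q_mem
  have D₁ := (D.change one_ne_zero one_ne_zero one_ne_zero (-α) (γ / l) 0).cast
    (p' := X k * X k) (q' := (β + γ / l) • (X k * Y k) + δ • (Y k * Y k)) (by module)
    (by simp only [quad]; match_scalars <;> field_simp <;> ring) (one_smul _ _)
  -- If q were a multiple of xy, then x q would be a multiple of x² y = l² y x², a left multiple of
  -- p.
  have hδ : δ ≠ 0 := by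
    rintro rfl
    refine X_ne_zero (D₁.reg_second _ X_mem (((β + γ / l) * l ^ 2) • Y k)
      (Submodule.smul_mem _ _ Y_mem) (inCubic_of_eq (β + γ / l) 0 ((β + γ / l) * l) 0 ?_))
    simp only [quad, mul_add, add_mul, mul_smul_comm, smul_mul_assoc, mul_assoc]
    module
  have D₂ := (D₁.change one_ne_zero (inv_ne_zero hδ) one_ne_zero 0 0 0).cast
    (p' := X k * X k) (q' := Y k * Y k + ((β + γ / l) / δ) • (X k * Y k)) (by module)
    (by match_scalars <;> field_simp <;> ring)
    (h' := X k * Y k - l • (Y k * X k)) (by simp only [quad]; module)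
  -- Only l = -1 allows surviving constants; there a mixed term in q separates the skew form from
  -- the Clifford forms.
  by_cases hl2 : l ^ 2 = 1
  · obtain rfl : l = -1 := eq_neg_of_add_eq_zero_left ((mul_eq_zero.1
      (show (l - 1) * (l + 1) = 0 by linear_combination hl2)).resolve_left (sub_ne_zero.2 hl1))
    have D₃ := D₂.cast rfl rfl (h' := X k * Y k + Y k * X k) (by module)
    by_cases hb : (β + γ / -1) / δ = 0
    · exact (D₃.cast rfl (q' := Y k * Y k) (by rw [hb]; module) rfl).toLeadingData.clifford
    · exact D₃.toLeadingData.skew hb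
  · exact D₂.toLeadingData.quantum hl hl2

/-- Modulo xy and h, only the squares remain in q. Both must occur: x y² and y x² are left multiples
of xy modulo h, so q cannot be a single square. -/
theorem QuadraticData.node_product [CharZero k]
    {W : Submodule k (FreeAlgebra k (Fin 2))} {q : FreeAlgebra k (Fin 2)} {l : k} (hl : l ≠ 0)
    (hl1 : l ≠ 1) (D : QuadraticData W (X k * Y k) q (quad 0 1 (-l) 0)) : CommutativeForm W := by
  obtain ⟨α, β, γ, δ, rfl⟩ := exists_eq_quad D.q_mem
  have D₁ := (D.change one_ne_zero one_ne_zero one_ne_zero (-(β + γ / l)) (γ / l) 0).cast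
    (p' := X k * Y k) (q' := α • (X k * X k) + δ • (Y k * Y k)) (by module)
    (by simp only [quad]; match_scalars <;> field_simp <;> ring) (one_smul _ _)
  have hα : α ≠ 0 := by
    rintro rfl
    refine X_ne_zero (D₁.reg_second _ X_mem ((δ * l) • Y k)
      (Submodule.smul_mem _ _ Y_mem) (inCubic_of_eq 0 0 0 δ ?_))
    simp only [quad, mul_add, add_mul, mul_smul_comm, smul_mul_assoc, mul_assoc]
    module
  have hδ : δ ≠ 0 := by
    rintro rfl
    refine Y_ne_zero (D₁.reg_second _ Y_mem ((α / l ^ 2) • X k)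
      (Submodule.smul_mem _ _ X_mem) (inCubic_of_eq (-(α / l ^ 2)) 0 (-(α / l)) 0 ?_))
    simp only [quad, mul_add, add_mul, mul_smul_comm, smul_mul_assoc, mul_assoc]
    match_scalars <;> field_simp <;> ring
  exact (D₁.cast rfl rfl
    (h' := X k * Y k - l • (Y k * X k)) (by simp only [quad]; module)).toLeadingData.node hα hδ hl hl1

/-- Modulo p and h, q becomes d x² + b xy, and regularity modulo p excludes d = ±b. If d = 0 the
span of leading forms contains xy; if b = 0 it contains both squares. Otherwise the substitution x +
y, x - y makes p and h span the two squares, and q becomes an l-commutation relation with l² ≠ 1. -/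
theorem QuadraticData.node_sum [CharZero k] [IsAlgClosed k]
    {W : Submodule k (FreeAlgebra k (Fin 2))} {q : FreeAlgebra k (Fin 2)}
    (D : QuadraticData W (X k * X k + Y k * Y k) q (X k * Y k + Y k * X k)) :
    StandardForm W ∨ CommutativeForm W := by
  obtain ⟨α, β, γ, δ, rfl⟩ := exists_eq_quad D.q_mem
  have D₁ := (D.change one_ne_zero one_ne_zero one_ne_zero (-δ) (-γ) 0).cast
    (p' := X k * X k + Y k * Y k) (q' := (α - δ) • (X k * X k) + (β - γ) • (X k * Y k)) (by module)
    (by simp only [quad]; module) (one_smul _ _)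
  generalize α - δ = d at D₁
  generalize β - γ = b at D₁
  have h1 : d - b ≠ 0 := by
    intro h
    obtain rfl := sub_eq_zero.1 h
    refine X_ne_zero (k := k) ?_
    have := D₁.reg_second _ (mem_freeGrading_one.2 ⟨1, -1, rfl⟩) (d • X k)
      (Submodule.smul_mem _ _ X_mem) (inCubic_of_eq d 0 (-d) (-d) (by
        simp only [mul_add, add_mul, mul_smul_comm, smul_mul_assoc, mul_assoc]; module))
    exact absurd (X_Y_independent _ _ this).1 one_ne_zero
  have h2 : d + b ≠ 0 := by
    intro h
    obtain rfl := eq_neg_of_add_eq_zero_left h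
    refine X_ne_zero (k := k) ?_
    have := D₁.reg_second _ (mem_freeGrading_one.2 ⟨1, 1, rfl⟩) ((-b) • X k)
      (Submodule.smul_mem _ _ X_mem) (inCubic_of_eq b 0 (-b) b (by
        simp only [mul_add, add_mul, mul_smul_comm, smul_mul_assoc, mul_assoc]; module))
    exact absurd (X_Y_independent _ _ this).1 one_ne_zero
  by_cases hd : d = 0
  · subst hd
    have hb : b ≠ 0 := by simpa using h2
    -- The remaining argument uses only the span of the leading forms, so xy can be made the first
    -- one.
    exact Or.inr ((((D₁.toLeadingData.change one_ne_zero (inv_ne_zero hb) one_ne_zero 0 0 0).swap).cast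
      (p' := X k * Y k) (q' := (1 : k) • (X k * X k) + (1 : k) • (Y k * Y k))
      (h' := X k * Y k - (-1 : k) • (Y k * X k))
      (by match_scalars <;> field_simp <;> ring) (by module) (by module)).node one_ne_zero
      one_ne_zero (by norm_num) (by norm_num))
  · left
    by_cases hb : b = 0
    · subst hb
      have L := (D₁.toLeadingData.change one_ne_zero (inv_ne_zero hd) one_ne_zero 0 0 0).swap.cast
        (p' := X k * X k) (q' := X k * X k + Y k * Y k) (h' := X k * Y k + Y k * X k)
        (by match_scalars <;> field_simp <;> ring) (by module) (by module)
      exact ((L.change one_ne_zero one_ne_zero one_ne_zero (-1) 0 0).cast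
        (p' := X k * X k) (q' := Y k * Y k) (h' := X k * Y k + Y k * X k) (by module) (by module)
        (by module)).clifford
    · obtain ⟨φ, hφ, hX, hY⟩ := exists_linearSubstitution (k := k) (a := 1) (b := 1) (c := 1)
        (d := -1) (by norm_num)
      refine StandardForm.of_map hφ ?_
      -- Here p becomes 2(x² + y²), h becomes 2(x² - y²), and q becomes (d - b) xy + (d + b) yx plus
      -- squares; the coefficients isolate x², xy - l yx and y² - x².
      have L := ((D₁.toLeadingData.map hφ).change (a := 1 / 4) (c := 1 / (d - b)) (e := -1 / 2)
        (by norm_num) (by simpa using h1) (by norm_num) (-1 / 4 * (2 * d / (d - b)))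
        (-1 / 4 * (2 * b / (d - b))) (1 / 4)).cast
        (p' := X k * X k) (q' := X k * Y k - (-((d + b) / (d - b))) • (Y k * X k))
        (h' := Y k * Y k - X k * X k)
        (by simp only [map_add, map_smul, map_mul, hX, hY, mul_add, add_mul, mul_smul_comm,
              smul_mul_assoc]
            match_scalars <;> field_simp <;> ring)
        (by simp only [map_add, map_smul, map_mul, hX, hY, mul_add, add_mul, mul_smul_comm,
              smul_mul_assoc]
            match_scalars <;> field_simp <;> ring)
        (by simp only [map_add, map_smul, map_mul, hX, hY, mul_add, add_mul, mul_smul_comm,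
              smul_mul_assoc]
            match_scalars <;> field_simp <;> ring)
      refine L.hyperbolic (neg_ne_zero.2 (div_ne_zero h2 h1)) fun h => ?_
      rw [neg_sq, div_pow, div_eq_one_iff_eq (pow_ne_zero 2 h1)] at h
      have : 4 * (b * d) = 0 := by linear_combination h
      simp [hb, hd] at this

theorem QuadraticData.node [CharZero k] [IsAlgClosed k]
    {W : Submodule k (FreeAlgebra k (Fin 2))} {p q : FreeAlgebra k (Fin 2)} {l : k} (hl : l ≠ 0)
    (hl1 : l ≠ 1) (D : QuadraticData W p q (quad 0 1 (-l) 0)) :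
    StandardForm W ∨ CommutativeForm W := by
  obtain ⟨a, b, c, d, rfl⟩ := exists_eq_quad D.p_mem
  -- Adding a multiple of h removes the yx term of p.
  have D₁ := (D.change one_ne_zero one_ne_zero one_ne_zero 0 0 (c / l)).cast
    (p' := quad a (b + c / l) 0 d) (q' := q)
    (by simp only [quad]; match_scalars <;> field_simp <;> ring) (by module) (one_smul _ _)
  generalize b + c / l = b' at D₁
  obtain ⟨h1, h2⟩ := D₁.node_coeffs hl hl1
  by_cases ha : a = 0
  · subst ha
    by_cases hd : d = 0
    · subst hd
      have hb : b' ≠ 0 := fun h => D₁.p_ne_zero (by rw [h]; simp [quad])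
      exact Or.inr (((D₁.change (inv_ne_zero hb) one_ne_zero one_ne_zero 0 0 0).cast
        (p' := X k * Y k) (q' := q) (by simp only [quad]; match_scalars <;> field_simp <;> ring)
        (by module) (one_smul _ _)).node_product hl hl1)
    · obtain rfl := h2 hd
      -- Exchanging the variables turns y² into x² and replaces l by its inverse.
      obtain ⟨φ, hφ, hX, hY⟩ := exists_linearSubstitution (k := k) (a := 0) (b := 1) (c := 1)
        (d := 0) (by norm_num)
      left
      refine StandardForm.of_map hφ ?_
      exact (((D₁.map hφ).change (a := d⁻¹) (c := 1) (e := -l⁻¹) (inv_ne_zero hd) one_ne_zero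
        (by simpa using hl) 0 0 0).cast (p' := X k * X k) (q' := φ q) (h' := quad 0 1 (-l⁻¹) 0)
        (by simp only [quad, map_add, map_smul, map_mul, hX, hY, mul_add, add_mul, mul_smul_comm,
              smul_mul_assoc]
            match_scalars <;> field_simp <;> ring)
        (by module)
        (by simp only [quad, map_add, map_smul, map_mul, hX, hY, mul_add, add_mul, mul_smul_comm,
              smul_mul_assoc]
            match_scalars <;> field_simp <;> ring)).node_square (inv_ne_zero hl)
        (by simpa using hl1)
  · obtain ⟨rfl, h3⟩ := h1 ha
    by_cases hd : d = 0
    · subst hd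
      exact Or.inl (((D₁.change (inv_ne_zero ha) one_ne_zero one_ne_zero 0 0 0).cast
        (p' := X k * X k) (q' := q) (by simp only [quad]; match_scalars <;> field_simp <;> ring)
        (by module) (one_smul _ _)).node_square hl hl1)
    · have hl2 : l ^ 2 = 1 := sub_eq_zero.1 ((mul_eq_zero.1 h3).resolve_right hd)
      obtain rfl : l = -1 := eq_neg_of_add_eq_zero_left ((mul_eq_zero.1
      (show (l - 1) * (l + 1) = 0 by linear_combination hl2)).resolve_left (sub_ne_zero.2 hl1))
      -- With both squares present l = -1, and scaling y by a square root of a/d makes p a multiple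
      -- of x² + y².
      obtain ⟨s, hs⟩ := IsAlgClosed.exists_pow_nat_eq (a / d) (n := 2) (by norm_num)
      have hs0 : s ≠ 0 := by
        rintro rfl
        exact div_ne_zero ha hd (by rw [← hs]; ring)
      obtain rfl : a = s ^ 2 * d := by rw [hs]; field_simp
      obtain ⟨φ, hφ, hX, hY⟩ := exists_linearSubstitution (k := k) (a := 1) (b := 0) (c := 0)
        (d := s) (by simpa using hs0)
      have D₂ := ((D₁.map hφ).change (a := (s ^ 2 * d)⁻¹) (c := 1) (e := s⁻¹) (inv_ne_zero ha)
        one_ne_zero (inv_ne_zero hs0) 0 0 0).cast (p' := X k * X k + Y k * Y k) (q' := φ q)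
        (h' := X k * Y k + Y k * X k)
        (by simp only [quad, map_add, map_smul, map_mul, hX, hY, mul_add, add_mul, mul_smul_comm,
              smul_mul_assoc]
            match_scalars <;> field_simp <;> ring)
        (by module)
        (by simp only [quad, map_add, map_smul, map_mul, hX, hY, mul_add, add_mul, mul_smul_comm,
              smul_mul_assoc]
            match_scalars <;> field_simp <;> ring)
      exact D₂.node_sum.imp (StandardForm.of_map hφ) (CommutativeForm.of_map hφ)

end Cases

end

end NAPC

namespace NAPC

noncomputable section

/-! ### Normal forms of the quadratic relation -/

section Normalisation

variable {k : Type u} [Field k]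

/-- The sum b + c governs the symmetric part. If it vanishes, h is a commutator plus a multiple of
y². If not, a shear removes y² and leaves b xy + c yx, which is degenerate or proportional to xy - l
yx with l = -c/b ≠ 1. -/
theorem QuadraticData.isotropic [CharZero k] [IsAlgClosed k]
    {W : Submodule k (FreeAlgebra k (Fin 2))} {p q : FreeAlgebra k (Fin 2)} {b c d : k}
    (D : QuadraticData W p q (quad 0 b c d)) (h0 : quad 0 b c d ≠ 0) :
    StandardForm W ∨ CommutativeForm W ∨
      ∃ e : k, e ≠ 0 ∧ quad 0 b c d = e • (X k * Y k - Y k * X k) := by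
  by_cases hbc : b + c = 0
  · obtain rfl : c = -b := eq_neg_of_add_eq_zero_right hbc
    by_cases hb : b = 0
    · subst hb
      have hd : d ≠ 0 := fun h => h0 (by rw [h]; simp [quad])
      exact ((D.change one_ne_zero one_ne_zero (inv_ne_zero hd) 0 0 0).cast rfl rfl
        (h' := quad 0 0 0 1)
        (by simp only [quad]; match_scalars <;> field_simp <;> ring)).false_of_YY.elim
    by_cases hd : d = 0
    · subst hd
      exact Or.inr (Or.inr ⟨b, hb, by simp only [quad]; module⟩)
    -- Scaling y by -b/d equalises the coefficients of the commutator and of y² up to sign.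
    · obtain ⟨φ, hφ, hX, hY⟩ := exists_linearSubstitution (k := k) (a := 1) (b := 0) (c := 0)
        (d := -b / d) (by simpa using ⟨hb, hd⟩)
      have D₁ := ((D.map hφ).change (a := 1) (c := 1) (e := -d / b ^ 2) one_ne_zero one_ne_zero
        (div_ne_zero (neg_ne_zero.2 hd) (pow_ne_zero 2 hb)) 0 0 0).cast rfl rfl
        (h' := quad 0 1 (-1) (-1))
        (by simp only [quad, map_add, map_smul, map_mul, hX, hY, mul_add, add_mul, mul_smul_comm,
              smul_mul_assoc]
            match_scalars <;> field_simp <;> ring)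
      exact Or.inr (Or.inl (CommutativeForm.of_map hφ D₁.jordan))
  · obtain ⟨φ, hφ, hX, hY⟩ := exists_linearSubstitution (k := k) (a := 1) (b := -d / (b + c))
      (c := 0) (d := 1) (by norm_num)
    have D₁ := (D.map hφ).cast rfl rfl (h' := quad 0 b c 0)
        (by simp only [quad, map_add, map_smul, map_mul, hX, hY, mul_add, add_mul, mul_smul_comm,
              smul_mul_assoc]
            match_scalars <;> field_simp <;> ring)
    by_cases hb : b = 0
    · subst hb
      have hc : c ≠ 0 := by simpa using hbc
      obtain ⟨ψ, hψ, hX', hY'⟩ := exists_linearSubstitution (k := k) (a := 0) (b := 1)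
        (c := 1) (d := 0) (by norm_num)
      exact (((D₁.map hψ).change one_ne_zero one_ne_zero (inv_ne_zero hc) 0 0 0).cast rfl rfl
        (h' := quad 0 1 0 0)
        (by simp only [quad, map_add, map_smul, map_mul, hX', hY', mul_add, add_mul, mul_smul_comm,
              smul_mul_assoc]
            match_scalars <;> field_simp <;> ring)).false_of_XY.elim
    have D₂ := (D₁.change one_ne_zero one_ne_zero (inv_ne_zero hb) 0 0 0).cast rfl rfl
        (h' := quad 0 1 (- (-c / b)) 0)
        (by simp only [quad]; match_scalars <;> field_simp <;> ring)
    by_cases hc : c = 0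
    · subst hc
      exact (D₂.cast rfl rfl (h' := quad 0 1 0 0) (by simp)).false_of_XY.elim
    · refine or_assoc.1 (Or.inl ((D₂.node (div_ne_zero (neg_ne_zero.2 hc) hb) fun h => ?_).imp
        (StandardForm.of_map hφ) (CommutativeForm.of_map hφ)))
      rw [div_eq_one_iff_eq hb] at h
      exact hbc (by linear_combination -h)

/-- The possible normal forms, apart from the case in which `h` is a multiple of the
commutator. -/
theorem QuadraticData.normalForm [CharZero k] [IsAlgClosed k]
    {W : Submodule k (FreeAlgebra k (Fin 2))} {p q h : FreeAlgebra k (Fin 2)}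
    (D : QuadraticData W p q h) (h0 : h ≠ 0) :
    StandardForm W ∨ CommutativeForm W ∨
      ∃ e : k, e ≠ 0 ∧ h = e • (X k * Y k - Y k * X k) := by
  obtain ⟨a, b, c, d, rfl⟩ := exists_eq_quad D.h_mem
  by_cases ha : a = 0
  · subst ha
    exact D.isotropic h0
  -- The quadratic form attached to h has an isotropic vector (r, 1); under x ↦ rx + y, y ↦ x the
  -- coefficient of x² is the value of the form there.
  obtain ⟨r, hr⟩ := IsAlgClosed.exists_root
    (Polynomial.C a * Polynomial.X ^ 2 + Polynomial.C (b + c) * Polynomial.X + Polynomial.C d)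
    (by rw [Polynomial.degree_quadratic ha]; norm_num)
  replace hr : a * r ^ 2 + (b + c) * r + d = 0 := by simpa [Polynomial.IsRoot] using hr
  obtain ⟨φ, hφ, hX, hY⟩ := exists_linearSubstitution (k := k) (a := r) (b := 1)
    (c := 1) (d := 0) (by norm_num)
  have e : φ (quad a b c d) = quad 0 (a * r + c) (a * r + b) a := by
    obtain rfl : d = -(a * r ^ 2 + (b + c) * r) := by linear_combination hr
    simp only [quad, map_add, map_smul, map_mul, hX, hY, mul_add, add_mul, mul_smul_comm,
      smul_mul_assoc]
    match_scalars <;> ring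
  have h0' : φ (quad a b c d) ≠ 0 := fun h => h0 (φ.injective (h.trans (map_zero φ).symm))
  have D₁ := (D.map hφ).cast rfl rfl e
  rw [e] at h0'
  refine (D₁.isotropic h0').imp (StandardForm.of_map hφ) (Or.imp (CommutativeForm.of_map hφ) ?_)
  rintro ⟨ε, hε, h⟩
  obtain ⟨δ, hδ, h'⟩ := hφ.symm.map_commutator
  refine ⟨ε * δ, mul_ne_zero hε hδ, ?_⟩
  rw [← φ.symm_apply_apply (quad a b c d), e, h, map_smul, h', mul_smul]

end Normalisation

end

end NAPC

namespace NAPC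

noncomputable section

/-! ### Projective dimension over polynomial rings -/

section ProjectiveDimension

open CategoryTheory Polynomial TensorProduct

variable (A : Type u) [CommRing A] (K : Type u) [AddCommGroup K] [Module A K] [Module A[X] K]
  [IsScalarTower A A[X] K]

/-- The scalar extension to `A[X]` of an `A`-module, mapped to an `A[X]`-module. -/
def evalModule : PolynomialModule A K →ₗ[A[X]] K :=
  (LinearMap.liftBaseChange A[X] (LinearMap.id : K →ₗ[A] K)) ∘ₗ
    (PolynomialModule.polynomialTensorProductLEquivPolynomialModule A K).symm.toLinearMap

variable {K} in
theorem evalModule_single (n : ℕ) (m : K) :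
    evalModule A K (PolynomialModule.single A n m) = (Polynomial.X : A[X]) ^ n • m := by
  have : PolynomialModule.polynomialTensorProductLEquivPolynomialModule A K
      (((Polynomial.X : A[X]) ^ n) ⊗ₜ[A] m) = PolynomialModule.single A n m := by
    change (Polynomial.X : A[X]) ^ n • PolynomialModule.single A 0 m = _
    rw [X_pow_eq_monomial, PolynomialModule.monomial_smul_single, add_zero, one_smul]
  rw [← this]
  simp [evalModule]

theorem evalModule_surjective : Function.Surjective (evalModule A K) := fun m =>
  ⟨PolynomialModule.single A 0 m, by simp [evalModule_single]⟩

/-- Multiplication by `X` on `K`, as an `A`-linear map. -/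
def mulX : K →ₗ[A] K where
  toFun m := (Polynomial.X : A[X]) • m
  map_add' := smul_add _
  map_smul' a m := by
    rw [RingHom.id_apply, ← algebraMap_smul A[X] a, ← algebraMap_smul A[X] a, smul_smul, smul_smul,
      mul_comm]

/-- The first map of the characteristic sequence. -/
def charMap : PolynomialModule A K →ₗ[A[X]] PolynomialModule A K where
  toFun p := (Polynomial.X : A[X]) • p - PolynomialModule.map A (mulX A K) p
  map_add' p q := by rw [smul_add, map_add]; abel
  map_smul' f p := by
    rw [PolynomialModule.map_smul, Algebra.algebraMap_self, Polynomial.map_id, RingHom.id_apply,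
      smul_sub, smul_smul, smul_smul, mul_comm]

theorem charMap_single (n : ℕ) (m : K) :
    charMap A K (PolynomialModule.single A n m) =
      PolynomialModule.single A (n + 1) m - PolynomialModule.single A n ((Polynomial.X : A[X]) • m) := by
  change (Polynomial.X : A[X]) • _ - PolynomialModule.map A (mulX A K) _ = _
  rw [PolynomialModule.map_single, ← monomial_one_one_eq_X, PolynomialModule.monomial_smul_single,
    one_smul, add_comm 1 n, monomial_one_one_eq_X]
  rfl

/-- In the kernel each coefficient is X^m times the one m places further on, and far enough out
those are zero. -/
theorem charMap_injective : Function.Injective (charMap A K) := by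
  refine (injective_iff_map_eq_zero _).2 fun p hp => ?_
  have h (n : ℕ) : p.coeff n = (Polynomial.X : A[X]) • p.coeff (n + 1) := by
    have e : (Polynomial.X : A[X]) • p = monomial 1 (1 : A) • p := by rw [monomial_one_one_eq_X]
    have hp' : (Polynomial.X : A[X]) • p = PolynomialModule.map A (mulX A K) p := sub_eq_zero.1 hp
    have := congrArg (fun q => q.coeff (n + 1)) hp'
    simp only [e, PolynomialModule.monomial_smul_apply] at this
    rwa [if_pos (by omega), one_smul, Nat.add_sub_cancel] at this
  have h' (n m : ℕ) : p.coeff n = (Polynomial.X : A[X]) ^ m • p.coeff (n + m) := by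
    induction m with
    | zero => simp
    | succ m ih => rw [ih, h (n + m), smul_smul, pow_succ, add_assoc]
  ext n
  obtain ⟨N, hN⟩ := p.coeff.support.bddAbove
  rw [h' n (N + 1), Finsupp.notMem_support_iff.1 (fun h => ?_)]
  · simp
  · have := hN h
    omega

theorem range_charMap : LinearMap.range (charMap A K) = LinearMap.ker (evalModule A K) := by
  apply le_antisymm
  · rintro _ ⟨p, rfl⟩
    rw [LinearMap.mem_ker]
    induction p using PolynomialModule.induction_linear with
    | zero => simp
    | add p q hp hq => rw [map_add, map_add, hp, hq, add_zero]
    | single n m =>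
      rw [charMap_single, map_sub, evalModule_single, evalModule_single, pow_succ, mul_smul, sub_self]
  -- Modulo the range, every power of the formal variable can be moved into the action on K, so p is
  -- congruent to the constant polynomial with value `evalModule A K p`.
  · have key (p : PolynomialModule A K) :
        p - PolynomialModule.single A 0 (evalModule A K p) ∈ LinearMap.range (charMap A K) := by
      induction p using PolynomialModule.induction_linear with
      | zero => simp
      | add p q hp hq =>
        rw [map_add, PolynomialModule.single_add, add_sub_add_comm]
        exact add_mem hp hq
      | single n m =>
        rw [evalModule_single]
        induction n generalizing m with
        | zero => simp
        | succ n ih =>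
          have := add_mem (LinearMap.mem_range_self (charMap A K) (PolynomialModule.single A n m))
            (ih ((Polynomial.X : A[X]) • m))
          rwa [charMap_single, sub_add_sub_cancel, smul_smul, ← pow_succ] at this
    intro p hp
    have := key p
    rwa [LinearMap.mem_ker.1 hp, PolynomialModule.single_zero, sub_zero] at this

/-- The characteristic sequence 0 → K[X] → K[X] → K → 0 is exact, and K[X] is the scalar extension
of a projective module. -/
theorem hasProjectiveDimensionLE_one_of_projective [Module.Projective A K] :
    HasProjectiveDimensionLE (ModuleCat.of A[X] K) 1 := by
  have : Module.Projective A[X] (PolynomialModule A K) :=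
    Module.Projective.of_equiv
      (PolynomialModule.polynomialTensorProductLEquivPolynomialModule A K)
  have hS := LinearMap.shortExact_shortComplexKer (evalModule_surjective A K)
  refine (hS.hasProjectiveDimensionLT_X₃_iff 0 ?_).2 ?_
  · exact (IsProjective.iff_projective _).1 inferInstance
  · rw [zero_add, ← projective_iff_hasProjectiveDimensionLT_one]
    have : Module.Projective A[X] (LinearMap.ker (evalModule A K)) :=
      Module.Projective.of_equiv ((LinearEquiv.ofInjective _ (charMap_injective A K)).trans
        (LinearEquiv.ofEq _ _ (range_charMap A K)))
    exact (IsProjective.iff_projective _).1 inferInstance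

variable {A}

theorem exists_module_isScalarTower (M : Type u) [AddCommGroup M] [Module A[X] M] :
    ∃ _ : Module A M, IsScalarTower A A[X] M := by
  letI := Module.compHom M (algebraMap A A[X])
  exact ⟨inferInstance, ⟨fun a f m => by
    rw [Algebra.smul_def, mul_smul]
    rfl⟩⟩

theorem hasProjectiveDimensionLE_one_of_isField {F : Type u} [Field F] (M : ModuleCat.{u} F[X]) :
    HasProjectiveDimensionLE M 1 := by
  obtain ⟨_, _⟩ := exists_module_isScalarTower (A := F) M
  exact hasProjectiveDimensionLE_one_of_projective F M

/-- A free cover over A[X] is projective over A as well, so the first syzygy of M is A-projective.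
The characteristic sequence bounds its dimension by one. -/
theorem hasProjectiveDimensionLE_two (h : ∀ M : ModuleCat.{u} A, HasProjectiveDimensionLE M 1)
    (M : ModuleCat.{u} A[X]) : HasProjectiveDimensionLE M 2 := by
  obtain ⟨_, _⟩ := exists_module_isScalarTower (A := A) M
  have hf : Function.Surjective (Finsupp.linearCombination A[X] (id : M → M)) :=
    Finsupp.linearCombination_id_surjective _ _
  have hS := LinearMap.shortExact_shortComplexKer hf
  refine (hS.hasProjectiveDimensionLT_X₃_iff 1 ?_).2 ?_
  · exact (IsProjective.iff_projective _).1 inferInstance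
  · have hS' := LinearMap.shortExact_shortComplexKer
      (f := (Finsupp.linearCombination A[X] (id : M → M)).restrictScalars A) hf
    have := (hS'.hasProjectiveDimensionLT_X₃_iff 0
      ((IsProjective.iff_projective _).1 inferInstance)).1 (h (ModuleCat.of A M))
    rw [zero_add, ← projective_iff_hasProjectiveDimensionLT_one,
      ← IsProjective.iff_projective] at this
    have : Module.Projective A (LinearMap.ker (Finsupp.linearCombination A[X] (id : M → M))) := this
    exact hasProjectiveDimensionLE_one_of_projective A _

/-- The quotient by an ideal generated by a regular sequence of two elements has projective
dimension two. -/
theorem not_hasProjectiveDimensionLT_two {R : Type u} [CommRing R] [IsDomain R] {x y : R}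
    (hx : x ≠ 0) (hxy : ∀ a b : R, x * a = y * b → x ∣ b) (h1 : ∀ a b : R, a * x + b * y ≠ 1) :
    ¬ HasProjectiveDimensionLT (ModuleCat.of R (R ⧸ Ideal.span {x, y})) 2 := by
  intro h
  set I := Ideal.span {x, y} with hI
  have hS := LinearMap.shortExact_shortComplexKer (f := I.mkQ) I.mkQ_surjective
  have := (hS.hasProjectiveDimensionLT_X₃_iff 0
    ((IsProjective.iff_projective _).1 inferInstance)).1 h
  rw [zero_add, ← projective_iff_hasProjectiveDimensionLT_one,
      ← IsProjective.iff_projective] at this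
  have : Module.Projective R (LinearMap.ker I.mkQ) := this
  have : Module.Projective R I := Module.Projective.of_equiv (LinearEquiv.ofEq _ _ I.ker_mkQ)
  let x' : I := ⟨x, Ideal.subset_span (by simp)⟩
  let y' : I := ⟨y, Ideal.subset_span (by simp)⟩
  let f : R × R →ₗ[R] I := (LinearMap.toSpanSingleton R I x').coprod
    (LinearMap.toSpanSingleton R I y')
  have hf : Function.Surjective f := by
    rintro ⟨z, hz⟩
    obtain ⟨a, b, rfl⟩ := Ideal.mem_span_pair.1 hz
    exact ⟨(a, b), rfl⟩
  -- If the dimension were below two, I would be projective and R² → I would split. Comparing y s(x)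
  -- with x s(y) shows that x divides both coordinates of s(x); cancelling x then puts 1 in I.
  obtain ⟨s, hs⟩ := Module.projective_lifting_property f LinearMap.id hf
  have e1 : (s x').1 * x + (s x').2 * y = x := congrArg Subtype.val (LinearMap.congr_fun hs x')
  have e2 : y • s x' = x • s y' := by
    rw [← map_smul, ← map_smul]
    congr 1
    exact Subtype.ext (mul_comm y x)
  obtain ⟨a, ha⟩ := hxy (s y').1 (s x').1 (congrArg Prod.fst e2).symm
  obtain ⟨b, hb⟩ := hxy (s y').2 (s x').2 (congrArg Prod.snd e2).symm
  refine h1 a b (mul_left_cancel₀ hx ?_)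
  rw [ha, hb] at e1
  linear_combination e1

attribute [local instance] RingHomInvPair.of_ringEquiv in
theorem iSup_projectiveDimension_le {R R' : Type u} [Ring R] [Ring R'] (e : R ≃+* R') :
    ⨆ M : ModuleCat.{u} R', projectiveDimension M ≤ ⨆ M : ModuleCat.{u} R, projectiveDimension M := by
  refine iSup_le fun M => ?_
  letI : Module R M := Module.compHom M (e : R →+* R')
  refine le_trans (le_of_eq ?_) (le_iSup _ (ModuleCat.of R M))
  exact (ModuleCat.projectiveDimension_eq_of_semiLinearEquiv (M := ModuleCat.of R M) (N := M) e
    { AddEquiv.refl M with map_smul' := fun r m => rfl }).symm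

end ProjectiveDimension

end

end NAPC

namespace NAPC

noncomputable section

/-! ### The commutative polynomial algebra as a quotient of the free algebra -/

section Commutative

variable {k : Type u} [Field k]

theorem commute_of_mem_idealOf {l : ℕ} {H : Fin l → FreeAlgebra k (Fin 2)}
    (h : X k * Y k - Y k * X k ∈ idealOf (Set.range H)) (a b : FreeQuot H) : a * b = b * a := by
  have hXY : toQuot H (X k) * toQuot H (Y k) = toQuot H (Y k) * toQuot H (X k) := by
    rw [← map_mul, ← map_mul]
    exact Ideal.Quotient.eq.2 h
  have hι (i j : Fin 2) : Commute (toQuot H (FreeAlgebra.ι k i)) (toQuot H (FreeAlgebra.ι k j)) := by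
    fin_cases i <;> fin_cases j
    · exact Commute.refl _
    · exact hXY
    · exact hXY.symm
    · exact Commute.refl _
  have hι' (i : Fin 2) (b : FreeAlgebra k (Fin 2)) :
      Commute (toQuot H (FreeAlgebra.ι k i)) (toQuot H b) := by
    induction b using FreeAlgebra.induction with
    | grade0 r => rw [AlgHom.commutes]; exact (Algebra.commutes r _).symm
    | grade1 j => exact hι i j
    | mul a b ha hb => rw [map_mul]; exact ha.mul_right hb
    | add a b ha hb => rw [map_add]; exact ha.add_right hb
  obtain ⟨a, rfl⟩ := Ideal.Quotient.mk_surjective a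
  obtain ⟨b, rfl⟩ := Ideal.Quotient.mk_surjective b
  change Commute (toQuot H a) (toQuot H b)
  induction a using FreeAlgebra.induction with
  | grade0 r => rw [AlgHom.commutes]; exact Algebra.commutes r _
  | grade1 j => exact hι' j b
  | mul a c ha hc => rw [map_mul]; exact ha.mul_left hc
  | add a c ha hc => rw [map_add]; exact ha.add_left hc

/-- `k⟨x, y⟩ / (xy - yx)` is a commutative ring. -/
abbrev commRingOfCommutator {h : FreeAlgebra k (Fin 2)} (hh : h = X k * Y k - Y k * X k) :
    CommRing (FreeQuot ![h]) :=
  { (inferInstance : Ring (FreeQuot ![h])) with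
    mul_comm := commute_of_mem_idealOf (subset_idealOf ⟨0, hh⟩) }

theorem lift_X_eq_zero {u : FreeAlgebra k (Fin 2)}
    (hu : u ∈ idealOf (Set.range ![X k * Y k - Y k * X k])) :
    FreeAlgebra.lift k (MvPolynomial.X : Fin 2 → MvPolynomial (Fin 2) k) u = 0 := by
  have := map_mem_idealOf (t := ∅)
    (FreeAlgebra.lift k (MvPolynomial.X : Fin 2 → MvPolynomial (Fin 2) k)).toRingHom
    (s := Set.range ![X k * Y k - Y k * X k]) (by
      rintro _ ⟨i, rfl⟩
      fin_cases i
      simp [mul_comm]) hu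
  rwa [idealOf_empty] at this

/-- `k⟨x, y⟩ / (xy - yx)` is the polynomial algebra. -/
theorem exists_equiv_mvPolynomial :
    ∃ e : FreeQuot ![X k * Y k - Y k * X k] ≃ₐ[k] MvPolynomial (Fin 2) k,
      ∀ i, e (toQuot _ (FreeAlgebra.ι k i)) = MvPolynomial.X i := by
  letI := commRingOfCommutator (k := k) rfl
  let f : FreeQuot ![X k * Y k - Y k * X k] →ₐ[k] MvPolynomial (Fin 2) k :=
    Ideal.Quotient.liftₐ _ (FreeAlgebra.lift k MvPolynomial.X) fun u hu => lift_X_eq_zero hu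
  let g : MvPolynomial (Fin 2) k →ₐ[k] FreeQuot ![X k * Y k - Y k * X k] :=
    MvPolynomial.aeval fun i => toQuot _ (FreeAlgebra.ι k i)
  have hf (i : Fin 2) : f (toQuot _ (FreeAlgebra.ι k i)) = MvPolynomial.X i :=
    FreeAlgebra.lift_ι_apply _ _
  have hg (i : Fin 2) : g (MvPolynomial.X i) = toQuot _ (FreeAlgebra.ι k i) :=
    MvPolynomial.aeval_X _ _
  refine ⟨AlgEquiv.ofAlgHom f g ?_ ?_, hf⟩
  · refine MvPolynomial.algHom_ext fun i => ?_
    change f (g (MvPolynomial.X i)) = MvPolynomial.X i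
    rw [hg, hf]
  · refine AlgHom.ext fun s => ?_
    obtain ⟨u, rfl⟩ := Ideal.Quotient.mk_surjective s
    refine AlgHom.congr_fun (φ₁ := (g.comp f).comp (toQuot _)) (φ₂ := toQuot _) ?_ u
    ext i
    simp only [Function.comp_apply, AlgHom.comp_apply, hf, hg]

theorem quotGrading_neg {n l : ℕ} (H : Fin l → FreeAlgebra k (Fin n)) {i : ℤ} (hi : i < 0) :
    quotGrading H i = ⊥ := by
  rw [quotGrading, freeGrading_neg n hi, Submodule.map_bot]

/-- Both gradings consist of the powers of the span of the variables, and e matches the variables.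
-/
theorem mem_quotGrading_iff
    (e : FreeQuot ![X k * Y k - Y k * X k] ≃ₐ[k] MvPolynomial (Fin 2) k)
    (he : ∀ i, e (toQuot _ (FreeAlgebra.ι k i)) = MvPolynomial.X i) (i : ℕ)
    (s : FreeQuot ![X k * Y k - Y k * X k]) :
    s ∈ quotGrading ![X k * Y k - Y k * X k] i ↔
      e s ∈ MvPolynomial.homogeneousSubmodule (Fin 2) k i := by
  have key : (quotGrading ![X k * Y k - Y k * X k] i).map e.toLinearMap =
      MvPolynomial.homogeneousSubmodule (Fin 2) k i := by
    rw [quotGrading, ← Submodule.map_comp, freeGrading_ofNat,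
      ← MvPolynomial.homogeneousSubmodule_one_pow, MvPolynomial.homogeneousSubmodule_one_eq_span_X]
    change Submodule.map (e.toAlgHom.comp (toQuot _)).toLinearMap _ = _
    rw [Submodule.map_pow, Submodule.map_span, ← Set.range_comp]
    congr 3
    exact funext he
  rw [← key]
  exact ⟨fun h => ⟨s, h, rfl⟩, fun ⟨t, ht, h⟩ => e.injective h ▸ ht⟩

end Commutative

end

end NAPC

namespace NAPC

noncomputable section

/-! ### The polynomial algebra in two variables is a quantum polynomial algebra -/

section Polynomial

variable {k : Type u} [Field k] {A : Type u} [CommRing A] [Algebra k A]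

/-- `e` identifies `𝒜` with the standard grading of the polynomial algebra in two variables. -/
structure IsPolynomialGrading (𝒜 : ℤ → Submodule k A) (e : A ≃ₐ[k] MvPolynomial (Fin 2) k) :
    Prop where
  mem_iff : ∀ (i : ℕ) (s : A), s ∈ 𝒜 i ↔ e s ∈ MvPolynomial.homogeneousSubmodule (Fin 2) k i
  neg : ∀ i < 0, 𝒜 i = ⊥

variable {𝒜 : ℤ → Submodule k A} {e : A ≃ₐ[k] MvPolynomial (Fin 2) k}

namespace IsPolynomialGrading

theorem eq_zero_of_neg (h : IsPolynomialGrading 𝒜 e) {i : ℤ} (hi : i < 0) {a : A}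
    (ha : a ∈ 𝒜 i) : a = 0 :=
  (Submodule.mem_bot k).1 (h.neg i hi ▸ ha)

theorem gradedMonoid (h : IsPolynomialGrading 𝒜 e) : SetLike.GradedMonoid 𝒜 where
  one_mem := (h.mem_iff 0 1).2 (by rw [map_one]; exact MvPolynomial.isHomogeneous_one _ _)
  mul_mem i j a b ha hb := by
    rcases lt_or_ge i 0 with hi | hi
    · rw [h.eq_zero_of_neg hi ha, zero_mul]; exact zero_mem _
    rcases lt_or_ge j 0 with hj | hj
    · rw [h.eq_zero_of_neg hj hb, mul_zero]; exact zero_mem _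
    lift i to ℕ using hi
    lift j to ℕ using hj
    rw [← Nat.cast_add]
    refine (h.mem_iff _ _).2 ?_
    rw [map_mul]
    exact MvPolynomial.IsHomogeneous.mul ((h.mem_iff _ _).1 ha) ((h.mem_iff _ _).1 hb)

/-- The homogeneous components. -/
def component (h : IsPolynomialGrading 𝒜 e) (n : ℕ) (a : A) : 𝒜 n :=
  ⟨e.symm (MvPolynomial.homogeneousComponent n (e a)), (h.mem_iff _ _).2 (by
    rw [AlgEquiv.apply_symm_apply]; exact MvPolynomial.homogeneousComponent_mem _ _)⟩

theorem isInternal (h : IsPolynomialGrading 𝒜 e) : DirectSum.IsInternal 𝒜 := by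
  -- Homogeneous components recover the coordinates of a formal sum, which gives injectivity.
  have key (n : ℕ) (f : DirectSum ℤ fun i => 𝒜 i) :
      MvPolynomial.homogeneousComponent n (e (DirectSum.coeAddMonoidHom 𝒜 f)) = e (f n) := by
    induction f using DirectSum.induction_on with
    | zero => simp
    | add f g hf hg => simp only [map_add, hf, hg, DirectSum.add_apply, Submodule.coe_add]
    | of i x =>
      rw [DirectSum.coeAddMonoidHom_of]
      rcases lt_or_ge i 0 with hi | hi
      · obtain rfl : x = 0 := Subtype.ext (h.eq_zero_of_neg hi x.2)
        simp
      lift i to ℕ using hi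
      rw [MvPolynomial.homogeneousComponent_of_mem ((h.mem_iff _ _).1 x.2)]
      by_cases hni : n = i
      · subst hni
        rw [if_pos rfl, DirectSum.of_eq_same]
      · rw [if_neg hni, DirectSum.of_eq_of_ne _ _ _ (by exact_mod_cast hni)]
        simp
  constructor
  · refine (injective_iff_map_eq_zero _).2 fun f hf => ?_
    ext i
    rcases lt_or_ge i 0 with hi | hi
    · exact h.eq_zero_of_neg hi (f i).2
    lift i to ℕ using hi
    have := key i f
    rw [hf, map_zero, map_zero] at this
    exact e.injective (by rw [← this, DirectSum.zero_apply, Submodule.coe_zero, map_zero])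
  · intro a
    refine ⟨∑ n ∈ Finset.range ((e a).totalDegree + 1),
      DirectSum.of (fun i => 𝒜 i) (n : ℤ) (h.component n a), ?_⟩
    simp only [map_sum, DirectSum.coeAddMonoidHom_of]
    apply e.injective
    rw [map_sum]
    conv_rhs => rw [← MvPolynomial.sum_homogeneousComponent (e a)]
    simp [component]

theorem degree_zero (h : IsPolynomialGrading 𝒜 e) : 𝒜 0 = 1 := by
  ext s
  refine (h.mem_iff 0 s).trans ?_
  rw [← MvPolynomial.homogeneousSubmodule_one_pow, pow_zero, Submodule.mem_one, Submodule.mem_one]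
  refine exists_congr fun c => ?_
  rw [← e.commutes, e.injective.eq_iff]

theorem equiv_antidiagonal (n : ℕ) :
    Nonempty ({d : Fin 2 →₀ ℕ | d.degree = n} ≃ Finset.HasAntidiagonal.antidiagonal n) := by
  refine ⟨(Finsupp.equivFunOnFinite.trans (finTwoArrowEquiv ℕ)).subtypeEquiv fun d => ?_⟩
  simp [Finsupp.degree_eq_sum]

/-- The homogeneous part of degree `n`. -/
theorem nonempty_linearEquiv (h : IsPolynomialGrading 𝒜 e) (n : ℕ) :
    Nonempty (𝒜 n ≃ₗ[k] (Finset.HasAntidiagonal.antidiagonal n →₀ k)) := by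
  obtain ⟨ε⟩ := equiv_antidiagonal n
  have e₁ : 𝒜 n ≃ₗ[k] MvPolynomial.homogeneousSubmodule (Fin 2) k n :=
    LinearEquiv.ofSubmodules e.toLinearEquiv _ _ (by
      ext p
      refine ⟨fun ⟨s, hs, hp⟩ => hp ▸ (h.mem_iff n s).1 hs, fun hp => ⟨e.symm p, ?_, ?_⟩⟩
      · exact (h.mem_iff n _).2 (by rwa [AlgEquiv.apply_symm_apply])
      · exact e.apply_symm_apply p)
  exact ⟨e₁.trans ((LinearEquiv.ofEq _ _
    (MvPolynomial.homogeneousSubmodule_eq_finsupp_supported (Fin 2) k n)).trans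
      ((MvPolynomial.basisRestrictSupport k _).repr.trans (Finsupp.domLCongr ε)))⟩

theorem locally_finite (h : IsPolynomialGrading 𝒜 e) (i : ℤ) : Module.Finite k (𝒜 i) := by
  rcases lt_or_ge i 0 with hi | hi
  · rw [h.neg i hi]; infer_instance
  · lift i to ℕ using hi
    obtain ⟨ε⟩ := h.nonempty_linearEquiv i
    exact Module.Finite.equiv ε.symm

theorem finrank (h : IsPolynomialGrading 𝒜 e) (n : ℕ) : Module.finrank k (𝒜 n) = n + 1 := by
  obtain ⟨ε⟩ := h.nonempty_linearEquiv n
  rw [ε.finrank_eq]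
  simp

theorem hilbert (h : IsPolynomialGrading 𝒜 e) :
    (PowerSeries.mk fun i : ℕ => (Module.finrank k (𝒜 i) : ℤ)) * (1 - PowerSeries.X) ^ 2 = 1 := by
  refine Eq.trans ?_ (PowerSeries.mk_add_choose_mul_one_sub_pow_eq_one ℤ 1)
  congr 2
  funext n
  rw [h.finrank, Nat.choose_one_right, add_comm]

end IsPolynomialGrading

theorem isNoetherianRing_left (e : A ≃ₐ[k] MvPolynomial (Fin 2) k) : IsNoetherianRing A :=
  isNoetherianRing_of_ringEquiv _ e.symm.toRingEquiv

theorem isNoetherianRing_right (e : A ≃ₐ[k] MvPolynomial (Fin 2) k) : IsNoetherianRing Aᵐᵒᵖ :=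
  have := isNoetherianRing_left e
  isNoetherianRing_of_ringEquiv _ (RingEquiv.toOpposite A)

/-- The opposite ring is k[x][y]. The upper bound applies the characteristic sequence twice,
starting from a field; the lower bound comes from the quotient by the two variables. -/
theorem globalDimension_eq_two (e : A ≃ₐ[k] MvPolynomial (Fin 2) k) :
    globalDimension A = (2 : ℕ∞) := by
  let ε : Aᵐᵒᵖ ≃+* Polynomial (Polynomial k) :=
    ((RingEquiv.toOpposite A).symm.trans e.toRingEquiv).trans
      ((MvPolynomial.finSuccEquiv k 1).toRingEquiv.trans
        (Polynomial.mapEquiv (MvPolynomial.uniqueAlgEquiv k (Fin 1)).toRingEquiv))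
  refine le_antisymm ((iSup_projectiveDimension_le ε.symm).trans ?_)
    (le_trans ?_ (iSup_projectiveDimension_le ε))
  · exact iSup_le fun M => (CategoryTheory.projectiveDimension_le_iff M 2).2
      (hasProjectiveDimensionLE_two hasProjectiveDimensionLE_one_of_isField M)
  · refine le_trans ((CategoryTheory.projectiveDimension_ge_iff _ 2).2
      (not_hasProjectiveDimensionLT_two (x := (Polynomial.X : Polynomial (Polynomial k)))
      (y := Polynomial.C Polynomial.X) Polynomial.X_ne_zero ?_ ?_)) (le_iSup _ _)
    · intro a b hab
      refine (Polynomial.prime_X.dvd_or_dvd ⟨a, hab.symm⟩).resolve_left fun h => ?_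
      rw [Polynomial.X_dvd_iff, Polynomial.coeff_C_zero] at h
      exact Polynomial.X_ne_zero h
    · intro a b hab
      have := congrArg (fun p => (Polynomial.coeff p 0).coeff 0) hab
      simp at this

end Polynomial

end

end NAPC

namespace NAPC

noncomputable section

/-! ### The Koszul resolution -/

section Koszul

open Matrix

variable {k : Type u} [Field k] {A : Type u} [CommRing A] [Algebra k A]

/-- A homogeneous regular sequence of two elements of degree one which generates the augmentation
ideal. -/
structure IsKoszulPair (𝒜 : ℤ → Submodule k A) (x y : A) : Prop where
  x_mem : x ∈ 𝒜 1
  y_mem : y ∈ 𝒜 1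
  mul_left_cancel : ∀ a, a * x = 0 → a = 0
  coprime : ∀ a b, a * y = b * x → ∃ c, a = c * x ∧ b = c * y
  mem_of_mul_mem : ∀ i a, a * x ∈ 𝒜 (i + 1) → a ∈ 𝒜 i
  mem_iSup_iff : ∀ a, a ∈ ⨆ i > 0, 𝒜 i ↔ ∃ b c, a = x * b + y * c
  exists_eq : ∀ i ≠ 0, ∀ a ∈ 𝒜 i, ∃ b ∈ 𝒜 (i - 1), ∃ c ∈ 𝒜 (i - 1), a = b * y - c * x
  eq_zero_of_neg : ∀ i < 0, ∀ a ∈ 𝒜 i, a = 0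

/-- The ranks in the Koszul complex on two elements. -/
def koszulRank : ℕ → ℕ
  | 0 => 1
  | 1 => 2
  | 2 => 1
  | _ + 3 => 0

/-- The differentials of the Koszul complex on two elements. -/
def koszulDifferential (x y : A) :
    ∀ i, Matrix (Fin (koszulRank i)) (Fin (koszulRank (i + 1))) A
  | 0 => (!![x, y] : Matrix (Fin 1) (Fin 2) A)
  | 1 => (!![y; -x] : Matrix (Fin 2) (Fin 1) A)
  | _ + 2 => 0

variable {𝒜 : ℤ → Submodule k A} {x y : A}

/-- The Koszul complex is a resolution. -/
def IsKoszulPair.resolution (h : IsKoszulPair 𝒜 x y) : GradedFreeResolution 𝒜 where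
  rank := koszulRank
  deg i _ := i
  d := koszulDifferential x y
  d_mem i a b := by
    rw [Nat.cast_add, Nat.cast_one, add_sub_cancel_left]
    match i, a, b with
    | 0, a, b =>
      change (!![x, y] : Matrix (Fin 1) (Fin 2) A) a b ∈ _
      fin_cases a; fin_cases b
      · exact h.x_mem
      · exact h.y_mem
    | 1, a, b =>
      change (!![y; -x] : Matrix (Fin 2) (Fin 1) A) a b ∈ _
      fin_cases a <;> fin_cases b
      · exact h.y_mem
      · exact neg_mem h.x_mem
    | i + 2, a, b => exact zero_mem _
  rank_zero := rfl
  deg_zero _ := rfl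
  exact_zero (v : Fin 1 → A) := by
    change _ ↔ ∃ w : Fin 2 → A, (!![x, y] : Matrix (Fin 1) (Fin 2) A).mulVec w = v
    constructor
    · intro hv
      obtain ⟨b, c, hbc⟩ := (h.mem_iSup_iff _).1 (hv (0 : Fin 1))
      refine ⟨![b, c], funext fun i => ?_⟩
      fin_cases i
      simpa [Matrix.mulVec, dotProduct] using hbc.symm
    · rintro ⟨w, rfl⟩ i
      refine (h.mem_iSup_iff _).2 ⟨w 0, w 1, ?_⟩
      fin_cases i
      simp [Matrix.mulVec, dotProduct]
      rfl
  exact_succ i v := by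
    match i, v with
    | 0, v =>
      change (!![x, y] : Matrix (Fin 1) (Fin 2) A).mulVec v = 0 ↔
        ∃ w : Fin 1 → A, (!![y; -x] : Matrix (Fin 2) (Fin 1) A).mulVec w = v
      change Fin 2 → A at v
      constructor
      · intro hv
        have hv' := congrFun hv 0
        simp only [Matrix.mulVec, dotProduct, Fin.sum_univ_two] at hv'
        replace hv' : x * v 0 + y * v 1 = 0 := hv'
        obtain ⟨c, h1, h2⟩ := h.coprime (v 1) (-v 0) (by linear_combination hv')
        refine ⟨![-c], funext fun j => ?_⟩
        fin_cases j
        · simp [Matrix.mulVec, dotProduct]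
          linear_combination h2
        · simp [Matrix.mulVec, dotProduct]
          linear_combination -h1
      · rintro ⟨w, rfl⟩
        ext j
        fin_cases j
        simp [Matrix.mulVec, dotProduct]
        ring
    | 1, v =>
      change (!![y; -x] : Matrix (Fin 2) (Fin 1) A).mulVec v = 0 ↔
        ∃ w : Fin 0 → A, (0 : Matrix (Fin 1) (Fin 0) A).mulVec w = v
      change Fin 1 → A at v
      constructor
      · intro hv
        have hv' := congrFun hv 1
        simp only [Matrix.mulVec, dotProduct, Fin.sum_univ_one] at hv'
        replace hv' : -x * v 0 = 0 := hv'
        refine ⟨0, funext fun j => ?_⟩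
        fin_cases j
        simpa using (h.mul_left_cancel (v 0) (by linear_combination -hv')).symm
      · rintro ⟨w, rfl⟩
        simp
    | i + 2, v =>
      change Fin 0 → A at v
      exact ⟨fun _ => ⟨0, Subsingleton.elim (α := Fin 0 → A) _ _⟩,
        fun _ => Matrix.zero_mulVec _⟩

theorem subsingleton_extPiece {P : GradedFreeResolution 𝒜} {i : ℕ} {j : ℤ}
    (h : P.cocycles i j ≤ P.coboundaries i j) : Subsingleton (P.ExtPiece i j) := by
  refine ⟨fun a b => ?_⟩
  obtain ⟨a, rfl⟩ := Submodule.Quotient.mk_surjective _ a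
  obtain ⟨b, rfl⟩ := Submodule.Quotient.mk_surjective _ b
  exact (Submodule.Quotient.eq _).2 (h (a - b).2)

theorem IsKoszulPair.subsingleton_ext_zero (h : IsKoszulPair 𝒜 x y) (j : ℤ) :
    Subsingleton (h.resolution.ExtPiece 0 j) := by
  refine subsingleton_extPiece fun v hv => ?_
  change Fin 1 → A at v
  have hv' := congrFun (LinearMap.mem_ker.1 hv.2) (0 : Fin 2)
  change ((v : Fin 1 → A) ᵥ* (!![x, y] : Matrix (Fin 1) (Fin 2) A)) 0 = 0 at hv'
  refine (Submodule.mem_bot k).2 (funext fun i => ?_)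
  change Fin 1 at i
  fin_cases i
  exact h.mul_left_cancel _ (by simpa [Matrix.vecMul, dotProduct] using hv')

/-- The dual Koszul complex has the same shape, so coprimality again writes a cocycle as a
coboundary; divisibility by x determines the degree of the cochain. -/
theorem IsKoszulPair.subsingleton_ext_one (h : IsKoszulPair 𝒜 x y) (j : ℤ) :
    Subsingleton (h.resolution.ExtPiece 1 j) := by
  refine subsingleton_extPiece fun v hv => ?_
  change Fin 2 → A at v
  have hv' := congrFun (LinearMap.mem_ker.1 hv.2) (0 : Fin 1)
  change ((v : Fin 2 → A) ᵥ* (!![y; -x] : Matrix (Fin 2) (Fin 1) A)) 0 = 0 at hv'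
  have hv0 : v 0 ∈ 𝒜 ((1 : ℕ) + j) := hv.1 (0 : Fin 2) trivial
  rw [Nat.cast_one] at hv0
  simp [Matrix.vecMul, dotProduct] at hv'
  obtain ⟨c, h1, h2⟩ := h.coprime (v 0) (v 1) (by linear_combination hv')
  refine ⟨(fun _ => c : Fin 1 → A), fun a _ => ?_, ?_⟩
  · refine h.mem_of_mul_mem _ _ ?_
    rw [← h1]
    change v 0 ∈ 𝒜 (((0 : ℕ) + j) + 1)
    rwa [Nat.cast_zero, zero_add, add_comm]
  · change ((fun _ => c : Fin 1 → A) ᵥ* (!![x, y] : Matrix (Fin 1) (Fin 2) A)) = v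
    ext i
    fin_cases i
    · simpa [Matrix.vecMul, dotProduct] using h1.symm
    · simpa [Matrix.vecMul, dotProduct] using h2.symm

theorem IsKoszulPair.subsingleton_ext_two (h : IsKoszulPair 𝒜 x y) {j : ℤ} (hj : j ≠ -2) :
    Subsingleton (h.resolution.ExtPiece 2 j) := by
  refine subsingleton_extPiece fun v hv => ?_
  change Fin 1 → A at v
  have hv0 : v 0 ∈ 𝒜 ((2 : ℕ) + j) := hv.1 (0 : Fin 1) trivial
  rw [Nat.cast_ofNat] at hv0
  obtain ⟨b, hb, c, hc, hbc⟩ := h.exists_eq (2 + j) (by omega) _ hv0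
  have e : 2 + j - 1 = 1 + j := by ring
  rw [e] at hb hc
  refine ⟨(![b, c] : Fin 2 → A), fun a _ => ?_, ?_⟩
  · change Fin 2 at a
    change (![b, c] : Fin 2 → A) a ∈ 𝒜 (((1 : ℕ) : ℤ) + j)
    rw [Nat.cast_one]
    fin_cases a
    · exact hb
    · exact hc
  · change ((![b, c] : Fin 2 → A) ᵥ* (!![y; -x] : Matrix (Fin 2) (Fin 1) A)) = v
    ext i
    fin_cases i
    simp [Matrix.vecMul, dotProduct, hbc]
    ring

theorem IsKoszulPair.subsingleton_ext_add_three (h : IsKoszulPair 𝒜 x y) (i : ℕ) (j : ℤ) :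
    Subsingleton (h.resolution.ExtPiece (i + 3) j) := by
  refine subsingleton_extPiece fun v hv => ?_
  rw [Subsingleton.elim (α := Fin 0 → A) v 0]
  exact zero_mem _

/-- Coboundaries in this degree come from the component of degree -1, which is zero, so the Ext
group is all of the degree-zero component. -/
theorem IsKoszulPair.finrank_ext_two (h : IsKoszulPair 𝒜 x y) :
    Module.finrank k (h.resolution.ExtPiece 2 (-2)) = Module.finrank k (𝒜 0) := by
  have hb : (h.resolution.coboundaries 2 (-2)).submoduleOf (h.resolution.cocycles 2 (-2)) = ⊥ := by
    refine (Submodule.eq_bot_iff _).2 fun v hv => ?_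
    obtain ⟨w, hw, hwv⟩ := hv
    change Fin 2 → A at w
    have h0 : w = 0 := by
      ext a
      refine h.eq_zero_of_neg (-1) (by norm_num) _ ?_
      have : w a ∈ 𝒜 ((1 : ℕ) + -2) := hw a trivial
      simpa using this
    refine Subtype.ext (hwv.symm.trans ?_)
    rw [h0]
    exact map_zero _
  let ε : h.resolution.cocycles 2 (-2) ≃ₗ[k] 𝒜 0 :=
    { toFun := fun v => ⟨(v.1 : Fin 1 → A) (0 : Fin 1), by
        have : (v.1 : Fin 1 → A) (0 : Fin 1) ∈ 𝒜 ((2 : ℕ) + -2) := v.2.1 (0 : Fin 1) trivial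
        simpa using this⟩
      invFun := fun a => ⟨(fun _ => a.1 : Fin 1 → A),
        fun i _ => by
          change a.1 ∈ 𝒜 ((2 : ℕ) + -2)
          simpa using a.2, LinearMap.mem_ker.2 (Subsingleton.elim (α := Fin 0 → A) _ _)⟩
      map_add' := fun _ _ => rfl
      map_smul' := fun _ _ => rfl
      left_inv := fun v => Subtype.ext (funext fun i => by
        change Fin 1 at i
        fin_cases i
        rfl)
      right_inv := fun _ => rfl }
  exact ((Submodule.quotEquivOfEqBot _ hb).trans ε).finrank_eq

end Koszul

end

end NAPC

namespace NAPC

noncomputable section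

/-! ### The polynomial algebra as a quantum polynomial algebra -/

section Quantum

variable {k : Type u} [Field k]

theorem X_mul_eq_X_mul {i j : Fin 2} (hij : i ≠ j) {a b : MvPolynomial (Fin 2) k}
    (h : a * MvPolynomial.X j = b * MvPolynomial.X i) :
    ∃ c, a = c * MvPolynomial.X i ∧ b = c * MvPolynomial.X j := by
  have hd : (MvPolynomial.X i : MvPolynomial (Fin 2) k) ∣ a :=
    ((MvPolynomial.X_prime).dvd_or_dvd ⟨b, by rw [h, mul_comm]⟩).resolve_right fun h' =>
      hij (MvPolynomial.X_dvd_X.1 h')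
  obtain ⟨c, rfl⟩ := hd
  refine ⟨c, mul_comm _ _, mul_right_cancel₀ (MvPolynomial.X_ne_zero i) ?_⟩
  rw [← h]
  ring

theorem coeff_degree_of_mul_X {i : Fin 2} {n : ℕ} {a : MvPolynomial (Fin 2) k}
    (h : (a * MvPolynomial.X i).IsHomogeneous n) {d : Fin 2 →₀ ℕ} (hd : a.coeff d ≠ 0) :
    d.degree + 1 = n := by
  have := h (d := d + Finsupp.single i 1) (by rwa [MvPolynomial.coeff_mul_X])
  rw [map_add, Finsupp.weight_single] at this
  rw [Finsupp.degree_eq_weight_one]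
  rwa [Pi.one_apply, smul_eq_mul, mul_one] at this

theorem exists_of_mem_homogeneousSubmodule {n : ℕ} {p : MvPolynomial (Fin 2) k}
    (hp : p ∈ MvPolynomial.homogeneousSubmodule (Fin 2) k (n + 1)) :
    ∃ b ∈ MvPolynomial.homogeneousSubmodule (Fin 2) k n,
      ∃ c ∈ MvPolynomial.homogeneousSubmodule (Fin 2) k n,
        p = b * MvPolynomial.X 0 + c * MvPolynomial.X 1 := by
  rw [← MvPolynomial.homogeneousSubmodule_one_pow, pow_succ,
    MvPolynomial.homogeneousSubmodule_one_pow] at hp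
  induction hp using Submodule.mul_induction_on' with
  | mem_mul_mem u hu v hv =>
    rw [MvPolynomial.homogeneousSubmodule_one_eq_span_X] at hv
    obtain ⟨c, rfl⟩ := (Submodule.mem_span_range_iff_exists_fun k).1 hv
    refine ⟨c 0 • u, Submodule.smul_mem _ _ hu, c 1 • u, Submodule.smul_mem _ _ hu, ?_⟩
    rw [Fin.sum_univ_two, mul_add, mul_smul_comm, mul_smul_comm, smul_mul_assoc, smul_mul_assoc]
  | add u _ v _ hu hv =>
    obtain ⟨b, hb, c, hc, rfl⟩ := hu
    obtain ⟨b', hb', c', hc', rfl⟩ := hv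
    exact ⟨b + b', add_mem hb hb', c + c', add_mem hc hc', by ring⟩

variable {A : Type u} [CommRing A] [Algebra k A] {𝒜 : ℤ → Submodule k A}
  {e : A ≃ₐ[k] MvPolynomial (Fin 2) k}

theorem IsPolynomialGrading.mem_one (h : IsPolynomialGrading 𝒜 e) (i : Fin 2) :
    e.symm (MvPolynomial.X i) ∈ 𝒜 1 := by
  refine (h.mem_iff 1 _).2 ?_
  rw [AlgEquiv.apply_symm_apply]
  exact MvPolynomial.isHomogeneous_X _ _

theorem IsPolynomialGrading.mem_of_mul_mem (h : IsPolynomialGrading 𝒜 e) {i : Fin 2} {n : ℤ} {a : A}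
    (ha : a * e.symm (MvPolynomial.X i) ∈ 𝒜 (n + 1)) : a ∈ 𝒜 n := by
  by_cases h0 : e a = 0
  · rw [(map_eq_zero_iff e e.injective).1 h0]
    exact zero_mem _
  obtain ⟨d, hd⟩ := MvPolynomial.ne_zero_iff.1 h0
  rcases lt_or_ge (n + 1) 0 with hn | hn
  · have := congrArg e (h.eq_zero_of_neg hn ha)
    rw [map_mul, AlgEquiv.apply_symm_apply, map_zero] at this
    exact absurd this (mul_ne_zero h0 (MvPolynomial.X_ne_zero _))
  · obtain ⟨m, hm⟩ := Int.eq_ofNat_of_zero_le hn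
    rw [hm] at ha
    have hh := (h.mem_iff _ _).1 ha
    rw [map_mul, AlgEquiv.apply_symm_apply] at hh
    obtain rfl : n = (d.degree : ℤ) := by
      have := coeff_degree_of_mul_X hh hd
      omega
    refine (h.mem_iff _ _).2 fun d' hd' => ?_
    have h1 := coeff_degree_of_mul_X hh hd
    have h2 := coeff_degree_of_mul_X hh hd'
    rw [Finsupp.degree_eq_weight_one] at h1 h2 ⊢
    exact Nat.succ_injective (h2.trans h1.symm)

theorem IsPolynomialGrading.exists_eq (h : IsPolynomialGrading 𝒜 e) {i : ℤ} (hi : i ≠ 0) {a : A}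
    (ha : a ∈ 𝒜 i) : ∃ b ∈ 𝒜 (i - 1), ∃ c ∈ 𝒜 (i - 1),
      a = b * e.symm (MvPolynomial.X 0) + c * e.symm (MvPolynomial.X 1) := by
  rcases lt_or_ge i 0 with hneg | hpos
  · exact ⟨0, zero_mem _, 0, zero_mem _, by rw [h.eq_zero_of_neg hneg ha]; simp⟩
  · obtain ⟨n, rfl⟩ : ∃ n : ℕ, i = ((n + 1 : ℕ) : ℤ) := ⟨(i - 1).toNat, by omega⟩
    obtain ⟨b, hb, c, hc, hbc⟩ := exists_of_mem_homogeneousSubmodule ((h.mem_iff _ _).1 ha)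
    rw [Nat.cast_add, Nat.cast_one, add_sub_cancel_right]
    refine ⟨e.symm b, (h.mem_iff _ _).2 ?_, e.symm c, (h.mem_iff _ _).2 ?_, e.injective ?_⟩
    · rwa [AlgEquiv.apply_symm_apply]
    · rwa [AlgEquiv.apply_symm_apply]
    · simpa using hbc

theorem IsPolynomialGrading.mul_mem_iSup (h : IsPolynomialGrading 𝒜 e) {x : A} (hx : x ∈ 𝒜 1) (b : A) :
    x * b ∈ ⨆ i > 0, 𝒜 i := by
  have hb : b ∈ ⨆ i, 𝒜 i := by
    rw [h.isInternal.submodule_iSup_eq_top]; trivial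
  induction hb using Submodule.iSup_induction' with
  | mem i b hb =>
    rcases lt_or_ge i 0 with hi | hi
    · rw [h.eq_zero_of_neg hi hb, mul_zero]; exact zero_mem _
    · exact Submodule.mem_iSup_of_mem (1 + i) (Submodule.mem_iSup_of_mem (by omega)
        (h.gradedMonoid.mul_mem hx hb))
  | zero => rw [mul_zero]; exact zero_mem _
  | add a b _ _ ha hb => rw [mul_add]; exact add_mem ha hb

theorem IsPolynomialGrading.isKoszulPair (h : IsPolynomialGrading 𝒜 e) :
    IsKoszulPair 𝒜 (e.symm (MvPolynomial.X 0)) (e.symm (MvPolynomial.X 1)) where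
  x_mem := h.mem_one 0
  y_mem := h.mem_one 1
  mul_left_cancel a ha := by
    have := congrArg e ha
    rw [map_mul, AlgEquiv.apply_symm_apply, map_zero] at this
    exact (map_eq_zero_iff e e.injective).1
      ((mul_eq_zero.1 this).resolve_right (MvPolynomial.X_ne_zero _))
  coprime a b hab := by
    have := congrArg e hab
    rw [map_mul, map_mul, AlgEquiv.apply_symm_apply, AlgEquiv.apply_symm_apply] at this
    obtain ⟨c, h1, h2⟩ := X_mul_eq_X_mul zero_ne_one this
    exact ⟨e.symm c, e.injective (by simpa using h1), e.injective (by simpa using h2)⟩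
  mem_of_mul_mem _ _ ha := h.mem_of_mul_mem ha
  mem_iSup_iff a := by
    constructor
    · intro ha
      have : ⨆ i > 0, 𝒜 i ≤ (Ideal.span {e.symm (MvPolynomial.X 0),
          e.symm (MvPolynomial.X 1)}).restrictScalars k := iSup₂_le fun i hi a ha => by
        obtain ⟨b, -, c, -, hbc⟩ := h.exists_eq hi.ne' ha
        exact Ideal.mem_span_pair.2 ⟨b, c, hbc.symm⟩
      obtain ⟨b, c, hbc⟩ := Ideal.mem_span_pair.1 (this ha)
      exact ⟨b, c, by rw [← hbc]; ring⟩
    · rintro ⟨b, c, rfl⟩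
      exact add_mem (h.mul_mem_iSup (h.mem_one 0) b) (h.mul_mem_iSup (h.mem_one 1) c)
  exists_eq i hi a ha := by
    obtain ⟨b, hb, c, hc, hbc⟩ := h.exists_eq hi ha
    exact ⟨c, hc, -b, neg_mem hb, by rw [hbc]; ring⟩
  eq_zero_of_neg _ hi _ ha := h.eq_zero_of_neg hi ha

theorem IsPolynomialGrading.isQuantumPolynomialAlgebra (h : IsPolynomialGrading 𝒜 e) :
    IsQuantumPolynomialAlgebra 𝒜 2 where
  gradedMonoid := h.gradedMonoid
  isInternal := h.isInternal
  nontrivial := e.toEquiv.nontrivial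
  degree_zero := h.degree_zero
  degree_neg := h.neg
  locally_finite := h.locally_finite
  noetherian_left := isNoetherianRing_left e
  noetherian_right := isNoetherianRing_right e
  gldim := globalDimension_eq_two e
  hilbert := h.hilbert
  gorenstein := by
    have K := h.isKoszulPair
    refine ⟨K.resolution, fun i j => ⟨?_, fun hij => ?_⟩⟩
    · rintro ⟨rfl, rfl⟩
      exact K.finrank_ext_two.trans (h.finrank 0)
    · match i with
      | 0 => exact K.subsingleton_ext_zero j
      | 1 => exact K.subsingleton_ext_one j
      | 2 => exact K.subsingleton_ext_two fun hj => hij ⟨rfl, hj⟩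
      | i + 3 => exact K.subsingleton_ext_add_three i j

/-- `k⟨x, y⟩ / (xy - yx)` is a quantum polynomial algebra. -/
theorem isQuantumPolynomialAlgebra_commutator :
    IsQuantumPolynomialAlgebra (quotGrading ![X k * Y k - Y k * X k]) 2 := by
  obtain ⟨e, he⟩ := exists_equiv_mvPolynomial (k := k)
  letI := commRingOfCommutator (k := k) rfl
  exact IsPolynomialGrading.isQuantumPolynomialAlgebra (e := e)
    ⟨mem_quotGrading_iff e he, fun i hi => quotGrading_neg _ hi⟩

end Quantum

end

end NAPC

namespace NAPC

noncomputable section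

/-! ### Sequences in the commutative polynomial algebra -/

section CommutativeSequences

theorem isRegular_and_isNormalElement {R : Type u} [CommRing R] {s : Set R} {f : R}
    (h : ∀ a, a * f ∈ idealOf s → a ∈ idealOf s) :
    IsRegular (Ideal.Quotient.mk (idealOf s) f) ∧
      IsNormalElement (Ideal.Quotient.mk (idealOf s) f) := by
  have hcomm (r : R ⧸ idealOf s) :
      Ideal.Quotient.mk (idealOf s) f * r = r * Ideal.Quotient.mk (idealOf s) f := by
    obtain ⟨r, rfl⟩ := Ideal.Quotient.mk_surjective r
    rw [← map_mul, ← map_mul, mul_comm]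
  have hright : Function.Injective fun r => r * Ideal.Quotient.mk (idealOf s) f := by
    intro a b hab
    obtain ⟨a, rfl⟩ := Ideal.Quotient.mk_surjective a
    obtain ⟨b, rfl⟩ := Ideal.Quotient.mk_surjective b
    simp only [← map_mul] at hab
    have := Ideal.Quotient.eq.1 hab
    rw [← sub_mul] at this
    exact Ideal.Quotient.eq.2 (h _ this)
  refine ⟨⟨fun a b hab => hright ?_, hright⟩, ?_⟩
  · simpa only [hcomm] using hab
  · simp only [IsNormalElement, hcomm]

/-- Normality is automatic in a commutative ring, so only regularity of g modulo p remains. -/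
theorem isRegularNormalSeq_pair {R : Type u} [CommRing R] [IsDomain R] {p g : R} (hp : p ≠ 0)
    (h : ∀ a, p ∣ a * g → p ∣ a) : IsRegularNormalSeq ![p, g] := by
  intro i
  refine isRegular_and_isNormalElement fun a ha => ?_
  fin_cases i
  · have hs : (![p, g] : Fin 2 → R) '' {j | j < 0} = ∅ := by
      rw [show {j : Fin 2 | j < 0} = ∅ by ext j; simp, Set.image_empty]
    change a * p ∈ idealOf ((![p, g] : Fin 2 → R) '' {j | j < 0}) at ha
    change a ∈ idealOf ((![p, g] : Fin 2 → R) '' {j | j < 0})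
    rw [hs, idealOf_empty, Ideal.mem_bot] at ha ⊢
    exact (mul_eq_zero.1 ha).resolve_right hp
  · change a * g ∈ idealOf ((![p, g] : Fin 2 → R) '' {j | j < 1}) at ha
    change a ∈ idealOf ((![p, g] : Fin 2 → R) '' {j | j < 1})
    rw [image_lt_one] at ha ⊢
    obtain ⟨s, hs⟩ := exists_mul_of_mem_idealOf (fun r => ⟨r, mul_comm _ _⟩) ha
    obtain ⟨t, rfl⟩ := h a ⟨s, hs.trans (mul_comm _ _)⟩
    rw [mul_comm]
    exact mul_mem_idealOf_singleton _ _

theorem mul_dvd_of_mul_dvd_mul {R : Type u} [CommRing R] [IsDomain R] {p₁ p₂ g : R}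
    (h₁ : Prime p₁) (h₂ : Prime p₂) (hg₁ : ¬ p₁ ∣ g) (hg₂ : ¬ p₂ ∣ g) {a : R}
    (h : p₁ * p₂ ∣ a * g) : p₁ * p₂ ∣ a := by
  obtain ⟨b, rfl⟩ := (h₁.dvd_or_dvd ((dvd_mul_right _ _).trans h)).resolve_right hg₁
  rw [mul_assoc] at h
  have h' := (mul_dvd_mul_iff_left h₁.ne_zero).1 h
  exact mul_dvd_mul_left _ ((h₂.dvd_or_dvd h').resolve_right hg₂)

variable {k : Type u} [Field k]

theorem linearIndependent_triple {f g h : FreeAlgebra k (Fin 2)}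
    (H : ∀ a b c : k, a • f + b • g + c • h = 0 → a = 0 ∧ b = 0 ∧ c = 0) :
    LinearIndependent k ![f, g, h] := by
  refine Fintype.linearIndependent_iff.2 fun c hc i => ?_
  obtain ⟨h0, h1, h2⟩ := H (c 0) (c 1) (c 2) (by simpa [Fin.sum_univ_three] using hc)
  fin_cases i
  · exact h0
  · exact h1
  · exact h2

theorem commutator_mem : X k * Y k - Y k * X k ∈ freeGrading k 2 2 :=
  mem_freeGrading_two.2 ⟨0, 1, -1, 0, by module⟩

theorem toQuot_mem_iSup {l : ℕ} {H : Fin l → FreeAlgebra k (Fin 2)} {u : FreeAlgebra k (Fin 2)}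
    (hu : u ∈ low k) : toQuot H u ∈ ⨆ i < (2 : ℤ), quotGrading H i := by
  have : low k ≤ (⨆ i < (2 : ℤ), quotGrading H i).comap (toQuot H).toLinearMap :=
    iSup₂_le fun i hi v hv => Submodule.mem_iSup_of_mem i (Submodule.mem_iSup_of_mem hi
      (Submodule.mem_map_of_mem (f := (toQuot H).toLinearMap) hv))
  exact this hu

/-- Setting the i-th variable to zero and the other to t would make the left side vanish, but its t²
coefficient is `c (i + 1)`. In `Fin 2` the index i + 1 is the other variable. -/
theorem not_dvd_of_coeff_ne_zero
    (e : FreeQuot ![X k * Y k - Y k * X k] ≃ₐ[k] MvPolynomial (Fin 2) k)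
    (he : ∀ i, e (toQuot _ (FreeAlgebra.ι k i)) = MvPolynomial.X i) {c : Fin 2 → k} (β : k)
    {l : FreeAlgebra k (Fin 2)} (hl : l ∈ low k) (i : Fin 2) (hc : c (i + 1) ≠ 0) :
    ¬ ∃ s, toQuot ![X k * Y k - Y k * X k] (quad (c 0) β 0 (c 1) + l) =
      toQuot ![X k * Y k - Y k * X k] (FreeAlgebra.ι k i) * s := by
  rintro ⟨s, hs⟩
  let ψ : FreeQuot ![X k * Y k - Y k * X k] →ₐ[k] Polynomial k :=
    (MvPolynomial.aeval fun j => if j = i then 0 else Polynomial.X).comp e.toAlgHom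
  have hψ (j : Fin 2) : ψ (toQuot ![X k * Y k - Y k * X k] (FreeAlgebra.ι k j)) =
      if j = i then 0 else Polynomial.X := by
    change MvPolynomial.aeval _ (e _) = _
    rw [he, MvPolynomial.aeval_X]
  obtain ⟨c₀, a, b, rfl⟩ := mem_low.1 hl
  have := congrArg ψ hs
  rw [map_mul, hψ, if_pos rfl, zero_mul] at this
  simp only [quad, map_add, map_smul, map_mul, map_one, hψ] at this
  have h2 := congrArg (fun p => Polynomial.coeff p 2) this
  fin_cases i
  · simp [Polynomial.coeff_X, Polynomial.coeff_one, ← pow_two] at h2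
    exact hc h2
  · simp [Polynomial.coeff_X, Polynomial.coeff_one, ← pow_two] at h2
    exact hc h2

/-- A product of two variables and an element whose leading form is not divisible by these
variables. -/
theorem inBst_of_product {c : Fin 2 → k} (β : k) {l : FreeAlgebra k (Fin 2)} (hl : l ∈ low k)
    {i₁ i₂ : Fin 2} (h₁ : c (i₁ + 1) ≠ 0) (h₂ : c (i₂ + 1) ≠ 0)
    (hind : LinearIndependent k ![FreeAlgebra.ι k i₁ * FreeAlgebra.ι k i₂, quad (c 0) β 0 (c 1) + l,
      X k * Y k - Y k * X k]) :
    InBst ![FreeAlgebra.ι k i₁ * FreeAlgebra.ι k i₂, quad (c 0) β 0 (c 1) + l]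
      ![X k * Y k - Y k * X k] := by
  obtain ⟨e, he⟩ := exists_equiv_mvPolynomial (k := k)
  have hι (i : Fin 2) : FreeAlgebra.ι k i ∈ freeGrading k 2 1 := by
    fin_cases i
    · exact X_mem
    · exact Y_mem
  have hp : FreeAlgebra.ι k i₁ * FreeAlgebra.ι k i₂ ∈ freeGrading k 2 2 :=
    mul_mem_freeGrading (hι i₁) (hι i₂)
  have hq : quad (c 0) β 0 (c 1) ∈ freeGrading k 2 2 := mem_freeGrading_two.2 ⟨_, _, _, _, rfl⟩
  have hd₁ {l : FreeAlgebra k (Fin 2)} (hl : l ∈ low k) := not_dvd_of_coeff_ne_zero e he β hl i₁ h₁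
  have hd₂ {l : FreeAlgebra k (Fin 2)} (hl : l ∈ low k) := not_dvd_of_coeff_ne_zero e he β hl i₂ h₂
  have hp0 : toQuot ![X k * Y k - Y k * X k] (FreeAlgebra.ι k i₁ * FreeAlgebra.ι k i₂) ≠ 0 := by
    intro h
    have := congrArg e h
    rw [map_mul, map_mul, he, he, map_zero] at this
    exact mul_ne_zero (MvPolynomial.X_ne_zero _) (MvPolynomial.X_ne_zero _) this
  have hq0 : toQuot ![X k * Y k - Y k * X k] (quad (c 0) β 0 (c 1)) ≠ 0 := fun h =>
    hd₁ (zero_mem _) ⟨0, by rw [add_zero, h, mul_zero]⟩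
  refine ⟨⟨?_, ?_, ?_, isQuantumPolynomialAlgebra_commutator, ?_⟩, e, mem_quotGrading_iff e he⟩
  · intro i
    fin_cases i
    · refine ⟨FreeAlgebra.ι k i₁ * FreeAlgebra.ι k i₂, hp, fun h => hp0 (by rw [h, map_zero]), ?_⟩
      simp
    · refine ⟨quad (c 0) β 0 (c 1), hq, fun h => hq0 (by rw [h, map_zero]), ?_⟩
      change quad (c 0) β 0 (c 1) + l - quad (c 0) β 0 (c 1) ∈ low k
      rwa [add_sub_cancel_left]
  · intro i
    fin_cases i
    exact commutator_mem
  · rwa [fin_append_eq]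
  -- Stated for every low part, so that l gives the sequence itself and 0 gives its leading forms.
  · have hreg (l : FreeAlgebra k (Fin 2)) (hl : l ∈ low k) : IsRegularNormalSeq
        ![toQuot ![X k * Y k - Y k * X k] (FreeAlgebra.ι k i₁ * FreeAlgebra.ι k i₂),
          toQuot ![X k * Y k - Y k * X k] (quad (c 0) β 0 (c 1) + l)] := by
      letI := commRingOfCommutator (k := k) rfl
      haveI : IsDomain (FreeQuot ![X k * Y k - Y k * X k]) :=
        MulEquiv.isDomain (MvPolynomial (Fin 2) k) e.toMulEquiv
      have hprime (i : Fin 2) :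
          Prime (toQuot ![X k * Y k - Y k * X k] (FreeAlgebra.ι k i)) := by
        refine (MulEquiv.prime_iff e.toMulEquiv).1 ?_
        change Prime (e _)
        rw [he]
        exact MvPolynomial.X_prime
      refine isRegularNormalSeq_pair hp0 fun a ha => ?_
      rw [map_mul] at ha ⊢
      exact mul_dvd_of_mul_dvd_mul (hprime i₁) (hprime i₂) (hd₁ hl) (hd₂ hl) ha
    refine ⟨![toQuot _ (FreeAlgebra.ι k i₁ * FreeAlgebra.ι k i₂),
      toQuot _ (quad (c 0) β 0 (c 1))], ?_, ?_, ?_⟩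
    · intro i
      fin_cases i
      · exact ⟨toQuot_mem_quotGrading hp, hp0, by simp⟩
      · refine ⟨toQuot_mem_quotGrading hq, hq0, ?_⟩
        change toQuot ![X k * Y k - Y k * X k] (quad (c 0) β 0 (c 1) + l) -
          toQuot ![X k * Y k - Y k * X k] (quad (c 0) β 0 (c 1)) ∈ _
        rw [← map_sub, add_sub_cancel_left]
        exact toQuot_mem_iSup hl
    · convert hreg l hl using 1
      ext i
      fin_cases i <;> rfl
    · convert hreg 0 (zero_mem _) using 3
      rw [add_zero]

end CommutativeSequences

end

end NAPC

namespace NAPC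

noncomputable section

/-! ### The classification -/

section Classification

variable {k : Type u} [Field k]

theorem mem_span_triple {f g h u : FreeAlgebra k (Fin 2)} :
    u ∈ Submodule.span k (Set.range ![f, g, h]) ↔ ∃ α β γ : k, u = α • f + β • g + γ • h := by
  rw [Submodule.mem_span_range_iff_exists_fun]
  constructor
  · rintro ⟨c, rfl⟩
    exact ⟨c 0, c 1, c 2, by simp [Fin.sum_univ_three]⟩
  · rintro ⟨α, β, γ, rfl⟩
    exact ⟨![α, β, γ], by simp [Fin.sum_univ_three]⟩

theorem HasForm.stEquiv {F F' : Fin 3 → FreeAlgebra k (Fin 2)}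
    (h : HasForm (Submodule.span k (Set.range F)) F') (hF' : LinearIndependent k F') :
    FreeSTEquiv F F' := by
  obtain ⟨φ, hφ, hj⟩ := h
  exact stEquiv_of_mem_span hF' hφ hj

theorem linearIndependent_quantum (c : k) :
    LinearIndependent k ![X k ^ 2, Y k ^ 2, X k * Y k - c • (Y k * X k)] :=
  linearIndependent_triple fun α β γ h => by
    obtain ⟨-, -, -, h1, h2, -, h4⟩ := coeffs_of_eq_zero (k := k) (c := 0) (a := 0) (b := 0)
      (m₁ := α) (m₂ := γ) (m₃ := -(γ * c)) (m₄ := β) (by rw [← h, pow_two, pow_two]; module)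
    exact ⟨h1, h4, h2⟩

theorem linearIndependent_skew :
    LinearIndependent k ![X k ^ 2, Y k ^ 2 + Y k * X k, X k * Y k + Y k * X k] :=
  linearIndependent_triple fun α β γ h => by
    obtain ⟨-, -, -, h1, h2, -, h4⟩ := coeffs_of_eq_zero (k := k) (c := 0) (a := 0) (b := 0)
      (m₁ := α) (m₂ := γ) (m₃ := β + γ) (m₄ := β) (by rw [← h, pow_two, pow_two]; module)
    exact ⟨h1, h4, h2⟩

theorem linearIndependent_skew' :
    LinearIndependent k ![X k ^ 2, X k * Y k + Y k ^ 2, X k * Y k + Y k * X k] :=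
  linearIndependent_triple fun α β γ h => by
    obtain ⟨-, -, -, h1, -, h3, h4⟩ := coeffs_of_eq_zero (k := k) (c := 0) (a := 0) (b := 0)
      (m₁ := α) (m₂ := β + γ) (m₃ := γ) (m₄ := β) (by rw [← h, pow_two, pow_two]; module)
    exact ⟨h1, h4, h3⟩

theorem linearIndependent_clifford (a b : k) :
    LinearIndependent k ![X k ^ 2 + a • 1, Y k ^ 2 + b • 1, X k * Y k + Y k * X k] :=
  linearIndependent_triple fun α β γ h => by
    obtain ⟨-, -, -, h1, h2, -, h4⟩ := coeffs_of_eq_zero (k := k) (c := α * a + β * b) (a := 0)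
      (b := 0) (m₁ := α) (m₂ := γ) (m₃ := γ) (m₄ := β) (by rw [← h, pow_two, pow_two]; module)
    exact ⟨h1, h4, h2⟩

theorem HasForm.stEquiv_clifford {a b : k} {u v : FreeAlgebra k (Fin 2)}
    {F : Fin 3 → FreeAlgebra k (Fin 2)} (hu : u = X k ^ 2 + a • 1) (hv : v = Y k ^ 2 + b • 1)
    (h : HasForm (Submodule.span k (Set.range F)) ![u, v, X k * Y k + Y k * X k]) :
    FreeSTEquiv F ![u, v, X k * Y k + Y k * X k] :=
  h.stEquiv (hu ▸ hv ▸ linearIndependent_clifford a b)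

theorem commutator_notMem_quantum {c : k} (hc : c ≠ 1) : X k * Y k - Y k * X k ∉
    Submodule.span k (Set.range ![X k ^ 2, Y k ^ 2, X k * Y k - c • (Y k * X k)]) := by
  rw [mem_span_triple]
  rintro ⟨α, β, γ, h⟩
  obtain ⟨-, -, -, -, h2, h3, -⟩ := coeffs_of_eq_zero (k := k) (c := 0) (a := 0) (b := 0)
      (m₁ := α) (m₂ := γ - 1) (m₃ := 1 - γ * c) (m₄ := β)
      (by rw [← sub_eq_zero.2 h.symm, pow_two, pow_two]; module)
  exact hc (by linear_combination -h3 - c * h2)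

theorem commutator_notMem_skew [CharZero k] : X k * Y k - Y k * X k ∉
    Submodule.span k (Set.range ![X k ^ 2, Y k ^ 2 + Y k * X k, X k * Y k + Y k * X k]) := by
  rw [mem_span_triple]
  rintro ⟨α, β, γ, h⟩
  obtain ⟨-, -, -, -, h2, h3, h4⟩ := coeffs_of_eq_zero (k := k) (c := 0) (a := 0) (b := 0)
      (m₁ := α) (m₂ := γ - 1) (m₃ := β + γ + 1) (m₄ := β)
      (by rw [← sub_eq_zero.2 h.symm, pow_two, pow_two]; module)
  exact two_ne_zero (α := k) (by linear_combination h3 - h2 - h4)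

theorem commutator_notMem_clifford [CharZero k] {a b : k} {u v : FreeAlgebra k (Fin 2)}
    (hu : u = X k ^ 2 + a • 1) (hv : v = Y k ^ 2 + b • 1) : X k * Y k - Y k * X k ∉
    Submodule.span k (Set.range ![u, v, X k * Y k + Y k * X k]) := by
  rw [mem_span_triple]
  rintro ⟨α, β, γ, h⟩
  subst hu hv
  obtain ⟨-, -, -, -, h2, h3, h4⟩ := coeffs_of_eq_zero (k := k) (c := α * a + β * b) (a := 0)
      (b := 0) (m₁ := α) (m₂ := γ - 1) (m₃ := γ + 1) (m₄ := β)
      (by rw [← sub_eq_zero.2 h.symm, pow_two, pow_two]; module)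
  exact two_ne_zero (α := k) (by linear_combination h3 - h2)

theorem CommutativeForm.exists_inBst {F : Fin 3 → FreeAlgebra k (Fin 2)}
    (h : CommutativeForm (Submodule.span k (Set.range F))) :
    ∃ f' g' : FreeAlgebra k (Fin 2), InBst ![f', g'] ![X k * Y k - Y k * X k] ∧
      FreeSTEquiv F ![f', g', X k * Y k - Y k * X k] := by
  rcases h with ⟨β, l, hl, h⟩ | ⟨a, c, ha, hc, l, hl, h⟩
  · have e : X k * X k + β • (X k * Y k) + l = quad (![1, 0] 0) β 0 (![1, 0] 1) + l := by
      simp [quad]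
    rw [e] at h
    have hind : LinearIndependent k ![Y k * Y k, quad (![1, 0] 0) β 0 (![1, 0] 1) + l,
        X k * Y k - Y k * X k] := linearIndependent_triple fun a b c h' => by
      obtain ⟨c₀, a₀, b₀, rfl⟩ := mem_low.1 hl
      rw [← e] at h'
      obtain ⟨-, -, -, h1, -, h3, h4⟩ := coeffs_of_eq_zero (k := k) (c := b * c₀) (a := b * a₀)
        (b := b * b₀) (m₁ := b) (m₂ := b * β + c) (m₃ := -c) (m₄ := a) (by rw [← h']; module)
      exact ⟨h4, h1, neg_eq_zero.1 h3⟩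
    exact ⟨_, _, inBst_of_product (c := ![1, 0]) β hl (i₁ := 1) (i₂ := 1) (by simp) (by simp) hind,
      h.stEquiv hind⟩
  · have e : a • (X k * X k) + c • (Y k * Y k) + l = quad (![a, c] 0) 0 0 (![a, c] 1) + l := by
      simp [quad]
    rw [e] at h
    have hind : LinearIndependent k ![X k * Y k, quad (![a, c] 0) 0 0 (![a, c] 1) + l,
        X k * Y k - Y k * X k] := linearIndependent_triple fun a' b' c' h' => by
      obtain ⟨c₀, a₀, b₀, rfl⟩ := mem_low.1 hl
      rw [← e] at h'
      obtain ⟨-, -, -, h1, h2, h3, -⟩ := coeffs_of_eq_zero (k := k) (c := b' * c₀) (a := b' * a₀)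
        (b := b' * b₀) (m₁ := b' * a) (m₂ := a' + c') (m₃ := -c') (m₄ := b' * c)
        (by rw [← h']; module)
      exact ⟨by linear_combination h2 + h3, (mul_eq_zero.1 h1).resolve_right ha, neg_eq_zero.1 h3⟩
    exact ⟨_, _, inBst_of_product (c := ![a, c]) 0 hl (i₁ := 0) (i₂ := 1) (by simpa using hc)
      (by simpa using ha) hind, h.stEquiv hind⟩

/-- Equal ideals give distinct quotient types; stating this for arbitrary I and J lets the equality
be substituted. -/
theorem isStronglyRegularNormalSeq_congr {I J : Ideal (FreeAlgebra k (Fin 2))} [I.IsTwoSided]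
    [J.IsTwoSided] (hIJ : I = J) {m : ℕ} {F : Fin m → FreeAlgebra k (Fin 2)}
    (h : IsStronglyRegularNormalSeq
      (fun i => (freeGrading k 2 i).map (Ideal.Quotient.mkₐ k I).toLinearMap) 2
      fun i => Ideal.Quotient.mkₐ k I (F i)) :
    IsStronglyRegularNormalSeq
      (fun i => (freeGrading k 2 i).map (Ideal.Quotient.mkₐ k J).toLinearMap) 2
      fun i => Ideal.Quotient.mkₐ k J (F i) := by
  subst hIJ
  exact h

theorem InAst.inBst_of_eq_smul {f g h : FreeAlgebra k (Fin 2)} (hA : InAst ![f, g] ![h]) {ε : k}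
    (hε : ε ≠ 0) (hh : h = ε • (X k * Y k - Y k * X k)) :
    InBst ![f, g] ![X k * Y k - Y k * X k] := by
  have hI : idealOf (Set.range ![h]) = idealOf (Set.range ![X k * Y k - Y k * X k]) := by
    apply le_antisymm
    · refine idealOf_mono_of_subset ?_
      rintro _ ⟨i, rfl⟩
      fin_cases i
      change h ∈ _
      rw [hh, Algebra.smul_def]
      exact Ideal.mul_mem_left _ _ (subset_idealOf ⟨0, rfl⟩)
    · refine idealOf_mono_of_subset ?_
      rintro _ ⟨i, rfl⟩
      fin_cases i
      change X k * Y k - Y k * X k ∈ _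
      rw [← inv_smul_smul₀ hε (X k * Y k - Y k * X k), ← hh, Algebra.smul_def]
      exact Ideal.mul_mem_left _ _ (subset_idealOf ⟨0, rfl⟩)
  obtain ⟨e, he⟩ := exists_equiv_mvPolynomial (k := k)
  refine ⟨⟨hA.degree, fun i => ?_, ?_, isQuantumPolynomialAlgebra_commutator,
    isStronglyRegularNormalSeq_congr hI hA.stronglyRegularNormal⟩, e, mem_quotGrading_iff e he⟩
  · fin_cases i
    exact commutator_mem
  · rw [fin_append_eq]
    have := hA.linearIndependent
    rw [fin_append_eq] at this
    refine linearIndependent_triple fun a b c h0 => ?_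
    have h1 := Fintype.linearIndependent_iff.1 this ![a, b, c / ε] (by
      rw [← h0, hh]
      simp [Fin.sum_univ_three, smul_smul, hε])
    have h2 : c / ε = 0 := h1 2
    exact ⟨h1 0, h1 1, by simpa [hε] using h2⟩

/-- Every triple is equivalent to one of the normal forms. -/
theorem InAst.standardForm_or [CharZero k] [IsAlgClosed k] {f g h : FreeAlgebra k (Fin 2)}
    (hA : InAst ![f, g] ![h]) : StandardForm (Submodule.span k (Set.range ![f, g, h])) ∨
      ∃ f' g' : FreeAlgebra k (Fin 2), InBst ![f', g'] ![X k * Y k - Y k * X k] ∧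
        FreeSTEquiv ![f, g, h] ![f', g', X k * Y k - Y k * X k] := by
  obtain ⟨p, q, D⟩ := hA.exists_quadraticData
  have hli := hA.linearIndependent
  rw [fin_append_eq] at hli
  rcases D.normalForm (hli.ne_zero 2) with hS | hC | ⟨ε, hε, hh⟩
  · exact Or.inl hS
  · exact Or.inr hC.exists_inBst
  · have hB := hA.inBst_of_eq_smul hε hh
    refine Or.inr ⟨f, g, hB, stEquiv_of_mem_span (by simpa only [fin_append_eq] using
      hB.1.linearIndependent) (φ := AlgEquiv.refl) (fun _ _ => Iff.rfl) fun j => ?_⟩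
    fin_cases j
    · exact Submodule.subset_span ⟨0, rfl⟩
    · exact Submodule.subset_span ⟨1, rfl⟩
    · change X k * Y k - Y k * X k ∈ _
      rw [← Submodule.smul_mem_iff _ hε, ← hh]
      exact Submodule.subset_span ⟨2, rfl⟩

/-- The quotient is commutative if and only if the commutator is a linear combination of the
relations. -/
theorem InAst.commutative_iff {f g h : FreeAlgebra k (Fin 2)} (hA : InAst ![f, g] ![h]) :
    (∀ a b : FreeQuot ![f, g, h], a * b = b * a) ↔
      X k * Y k - Y k * X k ∈ Submodule.span k (Set.range ![f, g, h]) := by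
  constructor
  · intro hE
    obtain ⟨p, q, D⟩ := hA.exists_quadraticData
    have h1 : X k * Y k - Y k * X k ∈ idealOf (Set.range ![f, g, h]) := by
      refine Ideal.Quotient.eq.1 ?_
      rw [map_mul, map_mul]
      exact hE _ _
    rw [← idealOf_span] at h1
    -- The commutator is a quadratic element of the ideal, so it already lies in the span.
    have := D.inter 0 (zero_mem _) _ commutator_mem (by rwa [zero_add])
    rwa [zero_add] at this
  · intro h1
    refine commute_of_mem_idealOf ?_
    rw [← idealOf_span]
    exact subset_idealOf h1

/-- Replacing x by -x turns xy + y² into y² - xy, which is y² + yx minus xy + yx. -/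
theorem HasForm.skew' {W : Submodule k (FreeAlgebra k (Fin 2))}
    (h : HasForm W ![X k ^ 2, Y k ^ 2 + Y k * X k, X k * Y k + Y k * X k]) :
    HasForm W ![X k ^ 2, X k * Y k + Y k ^ 2, X k * Y k + Y k * X k] := by
  obtain ⟨ψ, hψ, hj⟩ := h
  obtain ⟨φ, hφ, hX, hY⟩ := exists_linearSubstitution (k := k) (a := -1) (b := 0) (c := 0)
    (d := 1) (by norm_num)
  have h0 : ψ (X k ^ 2) ∈ W := hj 0
  have h1 : ψ (Y k ^ 2 + Y k * X k) ∈ W := hj 1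
  have h2 : ψ (X k * Y k + Y k * X k) ∈ W := hj 2
  have e0 : φ (X k ^ 2) = X k ^ 2 := by
    rw [map_pow, hX]; simp
  have e1 : φ (X k * Y k + Y k ^ 2) = (Y k ^ 2 + Y k * X k) - (X k * Y k + Y k * X k) := by
    rw [map_add, map_mul, map_pow, hX, hY]
    simp
    abel
  have e2 : φ (X k * Y k + Y k * X k) = -(X k * Y k + Y k * X k) := by
    rw [map_add, map_mul, map_mul, hX, hY]
    simp
    abel
  refine ⟨φ.trans ψ, hφ.trans hψ, fun j => ?_⟩
  fin_cases j
  · change ψ (φ (X k ^ 2)) ∈ W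
    rwa [e0]
  · change ψ (φ (X k * Y k + Y k ^ 2)) ∈ W
    rw [e1, map_sub]
    exact sub_mem h1 h2
  · change ψ (φ (X k * Y k + Y k * X k)) ∈ W
    rw [e2, map_neg]
    exact neg_mem h2

end Classification

end

end NAPC

open NAPC in
theorem mainTheorem3 {k : Type u} [Field k] [IsAlgClosed k] [CharZero k]
    (f g h : FreeAlgebra k (Fin 2)) (hA : InAst ![f, g] ![h]) :
    -- noncommutative case
    ((¬ ∀ a b : FreeQuot ![f, g, h], a * b = b * a) ↔
      (∃ c : k, c ≠ 0 ∧ c ≠ 1 ∧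
        FreeSTEquiv ![f, g, h] ![X k ^ 2, Y k ^ 2, X k * Y k - c • (Y k * X k)]) ∨
      FreeSTEquiv ![f, g, h] ![X k ^ 2, Y k ^ 2 + Y k * X k, X k * Y k + Y k * X k] ∨
      FreeSTEquiv ![f, g, h] ![X k ^ 2, Y k ^ 2 + 1, X k * Y k + Y k * X k] ∨
      FreeSTEquiv ![f, g, h] ![X k ^ 2 + 1, Y k ^ 2 + 1, X k * Y k + Y k * X k]) ∧
    -- commutative case
    ((∀ a b : FreeQuot ![f, g, h], a * b = b * a) ↔
      ∃ f' g' : FreeAlgebra k (Fin 2),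
        InBst ![f', g'] ![X k * Y k - Y k * X k] ∧
        FreeSTEquiv ![f, g, h] ![f', g', X k * Y k - Y k * X k]) ∧
    -- triples whose st-class contains no element of the commutative set
    ((¬ ∃ f' g' h' : FreeAlgebra k (Fin 2),
        InBst ![f', g'] ![h'] ∧ FreeSTEquiv ![f, g, h] ![f', g', h']) →
      (∃ c : k, c ≠ 0 ∧ c ≠ 1 ∧
        FreeSTEquiv ![f, g, h] ![X k ^ 2, Y k ^ 2, X k * Y k - c • (Y k * X k)]) ∨
      FreeSTEquiv ![f, g, h] ![X k ^ 2, X k * Y k + Y k ^ 2, X k * Y k + Y k * X k] ∨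
      FreeSTEquiv ![f, g, h] ![X k ^ 2, Y k ^ 2 + 1, X k * Y k + Y k * X k] ∨
      FreeSTEquiv ![f, g, h] ![X k ^ 2 + 1, Y k ^ 2 + 1, X k * Y k + Y k * X k]) := by
  have hcomm := hA.commutative_iff
  have hback : ∀ F' : Fin 3 → FreeAlgebra k (Fin 2), FreeSTEquiv ![f, g, h] F' →
      X k * Y k - Y k * X k ∉ Submodule.span k (Set.range F') →
      ¬ ∀ a b : FreeQuot ![f, g, h], a * b = b * a := fun F' hF' hn hE =>
    hn ((commutator_mem_span_iff hF').1 (hcomm.1 hE))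
  have hback' : ∀ f' g' : FreeAlgebra k (Fin 2),
      FreeSTEquiv ![f, g, h] ![f', g', X k * Y k - Y k * X k] →
      ∀ a b : FreeQuot ![f, g, h], a * b = b * a := fun f' g' hF' =>
    hcomm.2 ((commutator_mem_span_iff hF').2 (Submodule.subset_span ⟨2, rfl⟩))
  have hmain := hA.standardForm_or
  have hnc : (∃ c : k, c ≠ 0 ∧ c ≠ 1 ∧
        FreeSTEquiv ![f, g, h] ![X k ^ 2, Y k ^ 2, X k * Y k - c • (Y k * X k)]) ∨
      FreeSTEquiv ![f, g, h] ![X k ^ 2, Y k ^ 2 + Y k * X k, X k * Y k + Y k * X k] ∨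
      FreeSTEquiv ![f, g, h] ![X k ^ 2, Y k ^ 2 + 1, X k * Y k + Y k * X k] ∨
      FreeSTEquiv ![f, g, h] ![X k ^ 2 + 1, Y k ^ 2 + 1, X k * Y k + Y k * X k] →
      ¬ ∀ a b : FreeQuot ![f, g, h], a * b = b * a := by
    rintro (⟨c, -, hc, H⟩ | H | H | H)
    · exact hback _ H (commutator_notMem_quantum hc)
    · exact hback _ H commutator_notMem_skew
    · exact hback _ H (commutator_notMem_clifford (a := 0) (b := 1) (by simp) (by simp))
    · exact hback _ H (commutator_notMem_clifford (a := 1) (b := 1) (by simp) (by simp))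
  have hlist : StandardForm (Submodule.span k (Set.range ![f, g, h])) →
      (∃ c : k, c ≠ 0 ∧ c ≠ 1 ∧
        FreeSTEquiv ![f, g, h] ![X k ^ 2, Y k ^ 2, X k * Y k - c • (Y k * X k)]) ∨
      FreeSTEquiv ![f, g, h] ![X k ^ 2, Y k ^ 2 + Y k * X k, X k * Y k + Y k * X k] ∨
      FreeSTEquiv ![f, g, h] ![X k ^ 2, Y k ^ 2 + 1, X k * Y k + Y k * X k] ∨
      FreeSTEquiv ![f, g, h] ![X k ^ 2 + 1, Y k ^ 2 + 1, X k * Y k + Y k * X k] := by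
    rintro (⟨c, h0, h1, H⟩ | H | H | H)
    · exact Or.inl ⟨c, h0, h1, H.stEquiv (linearIndependent_quantum c)⟩
    · exact Or.inr (Or.inl (H.stEquiv linearIndependent_skew))
    · exact Or.inr (Or.inr (Or.inl
        (H.stEquiv_clifford (a := 0) (b := 1) (by simp) (by simp))))
    · exact Or.inr (Or.inr (Or.inr
        (H.stEquiv_clifford (a := 1) (b := 1) (by simp) (by simp))))
  refine ⟨⟨fun hE => ?_, hnc⟩, ⟨fun hE => ?_, fun ⟨f', g', _, H⟩ => hback' f' g' H⟩, fun hB => ?_⟩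
  · rcases hmain with hS | ⟨f', g', _, H⟩
    · exact hlist hS
    · exact absurd (hback' f' g' H) hE
  · rcases hmain with hS | H
    · exact absurd hE (hnc (hlist hS))
    · exact H
  -- The commutative alternative is excluded by hypothesis; of the others only the skew form changes
  -- its representative.
  · rcases hmain with hS | ⟨f', g', H, H'⟩
    · rcases hS with ⟨c, h0, h1, H⟩ | H | H | H
      · exact Or.inl ⟨c, h0, h1, H.stEquiv (linearIndependent_quantum c)⟩
      · exact Or.inr (Or.inl (H.skew'.stEquiv linearIndependent_skew'))
      · exact Or.inr (Or.inr (Or.inl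
          (H.stEquiv_clifford (a := 0) (b := 1) (by simp) (by simp))))
      · exact Or.inr (Or.inr (Or.inr
          (H.stEquiv_clifford (a := 1) (b := 1) (by simp) (by simp))))
    · exact absurd ⟨f', g', _, H, H'⟩ hB
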